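/- **Yoke graphs.** For integers $n\ge 1$, $m\ge 0$, the vertices of $Y_{n,m}$ are the vectors $v=(v_0,\dots,v_{m+1})\in\mathbb{Z}_n\times\{0,1\}^m\times\mathbb{Z}_n$ with $\sum_{i=0}^{m+1}v_i\equiv 0 \pmod n$. Distinct vertices $u,v$ are adjacent if for some $0\le i\le m$ they differ by *shifting a unit between the entries $i$ and $i+1$*: $u_j=v_j$ for $j\notin\{i,i+1\}$, and either $u_i=v_i+1$, $u_{i+1}=v_{i+1}-1$, or $u_i=v_i-1$, $u_{i+1}=v_{i+1}+1$ (modulo $n$ in the entries $0$ and $m+1$, in $\mathbb{Z}$ elsewhere). A vertex is determined by its first $m+1$ entries. **Theorem.** 1. Let $n\ge 5$ and label the vertices of a convex $n$-gon cyclically by $\mathbb{Z}_n$. A triangulation is triangle-free if none of its triangles has three chords (diagonals) as sides. A colored triangle-free triangulation is a triangle-free triangulation whose $n-3$ chords are labeled by $0,\dots,n-4$, each label once, so that chords with consecutive labels are sides of a common triangle; the chords labeled $0$ and $n-4$ are then the two short chords, those of the form $(a-1,a+1)$. A flip of the chord labeled $i$ replaces it by the other diagonal of the quadrilateral formed by its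 two adjacent triangles; the new chord gets the label $i$, and all other labels are kept. Let $\Gamma_n$ be the graph on the colored triangle-free triangulations whose edges are the flips. Then there is a graph isomorphism $g:\Gamma_n\to Y_{n,n-4}$ given as follows. If the chord of $T$ labeled $0$ is $(a-1,a+1)$, then $g(T)_0=a$. For $1\le i\le n-4$, if the chord labeled $i-1$ is $(k,t)$ (where the chord labeled $0$ is written $(a-1,a+1)$), then the chord labeled $i$ is either $(k-1,t)$ or $(k,t+1)$, and $g(T)_i$ is $0$ in the former case and $1$ in the latter; write the chord labeled $i$ in this form for the next step. Moreover, $T'$ is obtained from $T$ by a flip of the chord labeled $i$ if and only if $g(T)$ and $g(T')$ differ by shifting a unit between the entries $i$ and $i+1$. 2. Let $n\ge 2$. An arc permutation is a permutation $\pi$ of $\{1,\dots,n\}$ such that, for every prefix and every suffix of $\pi(1)\pi(2)\cdots\pi(n)$, its set of letters is an interval in $\mathbb{Z}_n$ (with $n$ representing $0$). Let $X_n$ be the graph on the arc permutations in which $\pi$ and $\sigma$ are adjacent if $\pi=\sigma\circ(i,i+1)$ for some $1\le i\le n-1$. Then there is a graph isomorphism $f:X_n\to Y_{n,n-2}$ given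 by $f(\pi)_0=\pi(1)-1$ and, for $1\le i\le n-2$, with $I_i=\{\pi(1),\dots,\pi(i)\}\subseteq\mathbb{Z}_n$: $f(\pi)_i=1$ if $\pi(i+1)-1\in I_i$, and $f(\pi)_i=0$ if $\pi(i+1)+1\in I_i$ (exactly one of the two holds). Moreover, for $1\le i\le n-1$, $\pi=\sigma\circ(i,i+1)$ if and only if $f(\pi)$ and $f(\sigma)$ differ by shifting a unit between the entries $i-1$ and $i$. 3. Let $n\ge 3$ and label the vertices of a convex $n$-gon cyclically by $\mathbb{Z}_n$. A geometric caterpillar of order $n$ is a non-crossing spanning tree, with straight edges, on these vertices whose non-leaves form an interval in $\mathbb{Z}_n$. Its spine is its longest simple path whose edges are sides of the polygon. Let $\mathcal{G}_n$ be the graph on the geometric caterpillars of order $n$ in which two distinct caterpillars are adjacent if one is obtained from the other by replacing an edge $\{x,w\}$ by an edge $\{x,w'\}$, where $\{w,w'\}$ is an edge of the spine. Then there is a graph isomorphism $h:\mathcal{G}_n\to Y_{n,n-3}$ given as follows. Let the spine of $C$ run through $a,a+1,\dots,a+k$. Put $h(C)_0=a$ and $[l_0,r_0]=[a,a+1]$.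 For $1\le i\le n-3$, if $(l_{i-1}-1,r_{i-1})$ is an edge of $C$, put $[l_i,r_i]=[l_{i-1}-1,r_{i-1}]$ and $h(C)_i=0$; otherwise put $[l_i,r_i]=[l_{i-1},r_{i-1}+1]$ and $h(C)_i=1$. In particular $\Gamma_n\cong Y_{n,n-4}$ for $n\ge5$, $X_n\cong Y_{n,n-2}$ for $n\ge2$, and $\mathcal{G}_n\cong Y_{n,n-3}$ for $n\ge3$. -/

import Mathlib

namespace YokeFlip

/-! ### Yoke graphs -/

/-- The positions `0` and `m + 1` of a vector `(v_0, …, v_{m+1})`, whose entries lie in `ℤ/n`. -/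
def IsBucket {m : ℕ} (i : Fin (m + 2)) : Prop := i = 0 ∨ i = Fin.last (m + 1)

/-- The vertices of `Y_{n,m}`: vectors in `ℤ/n × {0,1}^m × ℤ/n` whose entries sum to `0` modulo `n`.
The two entries in `ℤ/n` are given by their representatives in `{0, …, n-1}`. -/
def YokeVertex (n m : ℕ) : Type :=
  {v : Fin (m + 2) → ℕ //
    (∀ i, IsBucket i → v i < n) ∧ (∀ i, ¬ IsBucket i → v i < 2) ∧ n ∣ ∑ i, v i}

/-- `y = x + 1` for entries at position `i`: modulo `n` in a bucket, in `ℤ` elsewhere. -/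
def EntrySucc (n : ℕ) {m : ℕ} (i : Fin (m + 2)) (x y : ℕ) : Prop :=
  (IsBucket i ∧ (y : ZMod n) = (x : ZMod n) + 1) ∨ (¬ IsBucket i ∧ y = x + 1)

/-- `u` and `v` differ by shifting a unit between the entries `i` and `i + 1`. -/
def YokeShift {n m : ℕ} (i : Fin (m + 1)) (u v : YokeVertex n m) : Prop :=
  (∀ j, j ≠ i.castSucc → j ≠ i.succ → u.1 j = v.1 j) ∧
    ((EntrySucc n i.castSucc (v.1 i.castSucc) (u.1 i.castSucc) ∧
        EntrySucc n i.succ (u.1 i.succ) (v.1 i.succ)) ∨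
      (EntrySucc n i.castSucc (u.1 i.castSucc) (v.1 i.castSucc) ∧
        EntrySucc n i.succ (v.1 i.succ) (u.1 i.succ)))

/-- The Yoke graph `Y_{n,m}`. -/
def yokeGraph (n m : ℕ) : SimpleGraph (YokeVertex n m) :=
  SimpleGraph.fromRel fun u v => ∃ i, YokeShift i u v

/-! ### The convex polygon with vertices labeled by `ℤ/n` in cyclic order -/

/-- A side (boundary edge) of the polygon. -/
def IsSide {n : ℕ} (e : Sym2 (ZMod n)) : Prop := ∃ a : ZMod n, e = s(a, a + 1)

/-- A diagonal of the polygon. -/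
def IsDiagonal {n : ℕ} (e : Sym2 (ZMod n)) : Prop := ¬ e.IsDiag ∧ ¬ IsSide e

/-- Two segments between vertices of the polygon cross (in an interior point): their endpoints
are four distinct vertices that alternate in the cyclic order. -/
def Crosses {n : ℕ} (e f : Sym2 (ZMod n)) : Prop :=
  ∃ a b c d : ZMod n, e = s(a, b) ∧ f = s(c, d) ∧ sbtw a c b ∧ sbtw b d a

def IsNoncrossing {n : ℕ} (S : Set (Sym2 (ZMod n))) : Prop :=
  ∀ e ∈ S, ∀ f ∈ S, ¬ Crosses e f

/-- An interval `{a, a+1, …, a+k-1}` in `ℤ/n`. -/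
def IsCyclicInterval {n : ℕ} (S : Set (ZMod n)) : Prop :=
  ∃ (a : ZMod n) (k : ℕ), S = {x | ∃ j < k, x = a + (j : ZMod n)}

/-! ### Colored triangle-free triangulations -/

/-- A triangulation of the polygon, given by its set of chords: a maximal set of pairwise
non-crossing diagonals. -/
def IsTriangulation {n : ℕ} (T : Set (Sym2 (ZMod n))) : Prop :=
  Maximal (fun S : Set (Sym2 (ZMod n)) => (∀ e ∈ S, IsDiagonal e) ∧ IsNoncrossing S) T

/-- `a, b, c` are the vertices of a triangle of the triangulation with set of chords `T`. -/
def IsTriangleOf {n : ℕ} (T : Set (Sym2 (ZMod n))) (a b c : ZMod n) : Prop :=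
  (s(a, b) ∈ T ∨ IsSide s(a, b)) ∧ (s(b, c) ∈ T ∨ IsSide s(b, c)) ∧
    (s(a, c) ∈ T ∨ IsSide s(a, c))

/-- No triangle has three chords as its sides. -/
def IsTriangleFree {n : ℕ} (T : Set (Sym2 (ZMod n))) : Prop :=
  ¬ ∃ a b c : ZMod n, s(a, b) ∈ T ∧ s(b, c) ∈ T ∧ s(a, c) ∈ T

/-- A short chord: it forms a triangle with two sides of the polygon. -/
def IsShort {n : ℕ} (e : Sym2 (ZMod n)) : Prop := ∃ a : ZMod n, e = s(a - 1, a + 1)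

/-- `CTFT(n)`: a triangle-free triangulation of the `n`-gon with its chords labeled by
`0, …, n-4` along one of its two linear orders: the chord labeled `i` is `chord i`, the first and
the last chord are short, and consecutive chords are sides of a common triangle. -/
structure CTFT (n : ℕ) where
  chord : Fin (n - 3) → Sym2 (ZMod n)
  injective : Function.Injective chord
  triangulation : IsTriangulation (Set.range chord)
  triangleFree : IsTriangleFree (Set.range chord)
  short_first : ∀ i : Fin (n - 3), i.val = 0 → IsShort (chord i)
  short_last : ∀ i : Fin (n - 3), i.val + 1 = n - 3 → IsShort (chord i)
  consecutive : ∀ i j : Fin (n - 3), i.val + 1 = j.val →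
    ∃ a b c : ZMod n, IsTriangleOf (Set.range chord) a b c ∧ chord i = s(a, b) ∧ chord j = s(b, c)

/-- `e` and `e'` are the two diagonals of a quadrilateral that is the union of two triangles of
the triangulation `T` with the common side `e`. -/
def IsOtherDiagonal {n : ℕ} (T : Set (Sym2 (ZMod n))) (e e' : Sym2 (ZMod n)) : Prop :=
  ∃ a b c d : ZMod n, e = s(a, c) ∧ e' = s(b, d) ∧ b ≠ d ∧
    IsTriangleOf T a b c ∧ IsTriangleOf T a d c

/-- `D` is obtained from `C` by flipping the chord labeled `i` (the new chord inherits the label,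
all other chords keep theirs). -/
def CTFTFlip {n : ℕ} (i : Fin (n - 3)) (C D : CTFT n) : Prop :=
  (∀ j, j ≠ i → C.chord j = D.chord j) ∧
    IsOtherDiagonal (Set.range C.chord) (C.chord i) (D.chord i)

/-- The flip graph `Γ_n`. -/
def ctftGraph (n : ℕ) : SimpleGraph (CTFT n) :=
  SimpleGraph.fromRel fun C D => ∃ i, CTFTFlip i C D

/-- The relation `v = g(C)`. The chord labeled `i` is `(k i, t i)`; the chord labeled `0` is
`(a-1, a+1)` with `a = v_0`; and for `1 ≤ i ≤ n - 4` the chord labeled `i` is `(k-1, t)` if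
`v_i = 0` and `(k, t+1)` if `v_i = 1`, where `(k, t)` is the chord labeled `i - 1`. -/
def CTFTCode {n : ℕ} (C : CTFT n) (v : YokeVertex n (n - 4)) : Prop :=
  ∃ k t : ℕ → ZMod n, (∀ i : Fin (n - 3), C.chord i = s(k i, t i)) ∧
    k 0 = (v.1 0 : ZMod n) - 1 ∧ t 0 = (v.1 0 : ZMod n) + 1 ∧
    ∀ i : Fin (n - 4 + 2), 1 ≤ i.val → i.val ≤ n - 4 →
      (v.1 i = 0 ∧ k i = k (i.val - 1) - 1 ∧ t i = t (i.val - 1)) ∨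
      (v.1 i = 1 ∧ k i = k (i.val - 1) ∧ t i = t (i.val - 1) + 1)

/-! ### Arc permutations -/

/-- The class in `ℤ/n` of the letter of `{1, …, n}` that corresponds to `x : Fin n`; the element
`x` of `Fin n` stands for the letter `x + 1`. -/
def letter {n : ℕ} (x : Fin n) : ZMod n := (x.val : ZMod n) + 1

/-- The set of the first `k` letters of a permutation, as classes in `ℤ/n`. -/
def prefixSet {n : ℕ} (π : Equiv.Perm (Fin n)) (k : ℕ) : Set (ZMod n) :=
  {x | ∃ i : Fin n, i.val < k ∧ x = letter (π i)}

/-- The set of all letters after the first `k`, as classes in `ℤ/n`. -/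
def suffixSet {n : ℕ} (π : Equiv.Perm (Fin n)) (k : ℕ) : Set (ZMod n) :=
  {x | ∃ i : Fin n, k ≤ i.val ∧ x = letter (π i)}

/-- Arc permutations: every prefix and every suffix forms an interval in `ℤ/n`. -/
def ArcPerm (n : ℕ) : Type :=
  {π : Equiv.Perm (Fin n) // ∀ k ≤ n,
    IsCyclicInterval (prefixSet π k) ∧ IsCyclicInterval (suffixSet π k)}

/-- `π = σ ∘ (i+1, i+2)`, a product with a simple reflection (`i` counts positions from `0`). -/
def ArcSwap {n : ℕ} (i : ℕ) (hi : i + 1 < n) (π σ : ArcPerm n) : Prop :=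
  π.1 = σ.1 * Equiv.swap ⟨i, Nat.lt_of_succ_lt hi⟩ ⟨i + 1, hi⟩

/-- The flip graph `X_n`. -/
def arcGraph (n : ℕ) : SimpleGraph (ArcPerm n) :=
  SimpleGraph.fromRel fun π σ => ∃ (i : ℕ) (hi : i + 1 < n), ArcSwap i hi π σ

/-- The relation `v = f(π)`: `v_0 = π(1) - 1`, and for `1 ≤ i ≤ n - 2`, with
`I_i = {π(1), …, π(i)}`, the entry `v_i` is `1` if `π(i+1) - 1 ∈ I_i`, and `0` if
`π(i+1) + 1 ∈ I_i`, in `ℤ/n`. -/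
def ArcCode {n : ℕ} (π : ArcPerm n) (v : YokeVertex n (n - 2)) : Prop :=
  (∀ p : Fin n, p.val = 0 → v.1 0 = (π.1 p).val) ∧
    ∀ (i : Fin (n - 2 + 2)) (p : Fin n), 1 ≤ i.val → i.val ≤ n - 2 → p.val = i.val →
      (letter (π.1 p) - 1 ∈ prefixSet π.1 i ∧ v.1 i = 1) ∨
      (letter (π.1 p) + 1 ∈ prefixSet π.1 i ∧ v.1 i = 0)

/-! ### Geometric caterpillars -/

def IsLeaf {V : Type*} (G : SimpleGraph V) (v : V) : Prop := ∃! w, G.Adj v w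

/-- Geometric caterpillars of order `n`: non-crossing spanning trees of the complete graph on the
vertices of a convex polygon whose non-leaves form an interval in `ℤ/n`. -/
def Caterpillar (n : ℕ) : Type :=
  {C : SimpleGraph (ZMod n) // C.IsTree ∧ IsNoncrossing C.edgeSet ∧
    IsCyclicInterval {v | ¬ IsLeaf C v}}

/-- A spine: a longest path whose edges are on the boundary of the polygon. -/
def IsSpine {n : ℕ} {C : SimpleGraph (ZMod n)} {u v : ZMod n} (p : C.Walk u v) : Prop :=
  (p.IsPath ∧ ∀ e ∈ p.edges, IsSide e) ∧
    ∀ (u' v' : ZMod n) (q : C.Walk u' v'), q.IsPath → (∀ e ∈ q.edges, IsSide e) →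
      q.length ≤ p.length

/-- `D` is obtained from `C` by shifting the endpoint `w` of an edge `{x, w}` along an edge
`{w, w'}` of the spine, to `w'`. -/
def CaterpillarShift {n : ℕ} (C D : Caterpillar n) : Prop :=
  ∃ (u v : ZMod n) (p : C.1.Walk u v), IsSpine p ∧
    ∃ x w w' : ZMod n, C.1.Adj x w ∧ s(w, w') ∈ p.edges ∧
      D.1.edgeSet = (C.1.edgeSet \ {s(x, w)}) ∪ {s(x, w')}

/-- The flip graph `𝒢_n`. -/
def caterpillarGraph (n : ℕ) : SimpleGraph (Caterpillar n) :=
  SimpleGraph.fromRel fun C D => CaterpillarShift C D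

/-- The relation `v = h(C)`. The spine runs through `a, a+1, …`, and `v_0 = a`. Intervals
`[l i, r i]` are built from `[a, a+1]`: for `1 ≤ i ≤ n - 3`, if `(l-1, r)` is an edge of `C`, the
interval `[l, r]` is extended to `[l-1, r]` and `v_i = 0`, otherwise it is extended to `[l, r+1]`
and `v_i = 1`. -/
def CaterpillarCode {n : ℕ} (C : Caterpillar n) (v : YokeVertex n (n - 3)) : Prop :=
  ∃ (a b : ZMod n) (p : C.1.Walk a b), IsSpine p ∧
    (∀ j ≤ p.length, p.getVert j = a + (j : ZMod n)) ∧
    (v.1 0 : ZMod n) = a ∧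
    ∃ l r : ℕ → ZMod n, l 0 = a ∧ r 0 = a + 1 ∧
      ∀ i : Fin (n - 3 + 2), 1 ≤ i.val → i.val ≤ n - 3 →
        (C.1.Adj (l (i.val - 1) - 1) (r (i.val - 1)) ∧
          l i = l (i.val - 1) - 1 ∧ r i = r (i.val - 1) ∧ v.1 i = 0) ∨
        (¬ C.1.Adj (l (i.val - 1) - 1) (r (i.val - 1)) ∧
          l i = l (i.val - 1) ∧ r i = r (i.val - 1) + 1 ∧ v.1 i = 1)

end YokeFlip

open YokeFlip

/-!
The partial sums `r i = v 0 + ⋯ + v i` of a vertex `v` of the Yoke graph `Y_{n,m}` form an arbitrary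
sequence in `ℤ/n` whose steps are `0` or `1`, and shifting a unit between the entries `i` and `i+1`
changes `r i` and no other partial sum. Such a sequence encodes a growing sequence of arcs of the
polygon, in which `r i` is the right end of the `i`-th arc: the next arc has one more vertex on the
left when the step is `0`, and on the right when the step is `1`. All three kinds of objects are
such sequences: the chords of a triangulation cut off the arcs, the prefixes of an arc permutation
are the arcs, and the edges of a caterpillar join each new vertex to the right end of the previous
arc. A flip of a chord and an adjacent transposition replace exactly one arc. For a caterpillar, the
degrees determine the multiset of the values of the sequence, and so the sequence, because its steps
are `0` or `1`; a shift of an edge along the spine changes the degrees as adding `±1` to a single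
value does.
-/

namespace YokeFlip

lemma exists_iso_fromRel_of_biUnique {A B : Type*} {r : A → A → Prop} {s : B → B → Prop}
    {R : A → B → Prop} (htotal : Relator.BiTotal R) (hunique : Relator.BiUnique R)
    (hrs : ∀ ⦃a a' b b'⦄, R a b → R a' b' → (r a a' ↔ s b b')) :
    ∃ e : SimpleGraph.fromRel r ≃g SimpleGraph.fromRel s, ∀ a, R a (e a) := by
  choose f hf using htotal.left
  have hinj : f.Injective := fun a a' h => hunique.left (hf a) (h ▸ hf a')
  have hsurj : f.Surjective := fun b =>
    (htotal.right b).imp fun a hab => hunique.right (hf a) hab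
  refine ⟨⟨Equiv.ofBijective f ⟨hinj, hsurj⟩, fun {a a'} => ?_⟩, hf⟩
  rw [SimpleGraph.fromRel_adj, SimpleGraph.fromRel_adj, hrs (hf a) (hf a'), hrs (hf a') (hf a)]
  exact and_congr_left' hinj.ne_iff

/-! ### Residues and integer coordinates -/

section Residues
variable {n : ℕ}

lemma zmod_one_ne_zero (hn : 2 ≤ n) : (1 : ZMod n) ≠ 0 := by
  have : Fact (1 < n) := ⟨hn⟩
  exact one_ne_zero

lemma natCast_eq_iff_of_lt {a b : ℕ} (ha : a < n) (hb : b < n) : (a : ZMod n) = b ↔ a = b := by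
  rw [ZMod.natCast_eq_natCast_iff, Nat.ModEq, Nat.mod_eq_of_lt ha, Nat.mod_eq_of_lt hb]

lemma natCast_ne_zero_of_lt {k : ℕ} (h0 : 0 < k) (hk : k < n) : (k : ZMod n) ≠ 0 := by
  rw [Ne, ← Nat.cast_zero, natCast_eq_iff_of_lt hk (h0.trans hk)]
  exact h0.ne'

lemma intCast_eq_iff {x y : ℤ} (h₁ : x - y < n) (h₂ : y - x < n) :
    (x : ZMod n) = y ↔ x = y := by
  refine ⟨fun h => ?_, congrArg _⟩
  have hdvd : (n : ℤ) ∣ x - y := by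
    rw [← ZMod.intCast_zmod_eq_zero_iff_dvd, Int.cast_sub, h, sub_self]
  exact sub_eq_zero.1 (Int.eq_zero_of_abs_lt_dvd hdvd (abs_lt.2 ⟨by linarith, h₁⟩))

variable [NeZero n]

lemma exists_natCast_eq (x : ZMod n) : ∃ k < n, (k : ZMod n) = x :=
  ⟨x.val, ZMod.val_lt x, ZMod.natCast_zmod_val x⟩

lemma sbtw_iff_val_lt (a b c : ZMod n) :
    sbtw a b c ↔ a.val < b.val ∧ b.val < c.val ∨ b.val < c.val ∧ c.val < a.val ∨
      c.val < a.val ∧ a.val < b.val := by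
  cases n with
  | zero => exact absurd rfl (NeZero.ne 0)
  | succ k => exact Iff.rfl

lemma val_intCast_of_mem_window {b w : ℤ} (hb : b ≤ w) (hw : w < b + n) :
    (((w : ZMod n).val : ℤ) = w - n * (b / n) ∧ w < n * (b / n) + n) ∨
      (((w : ZMod n).val : ℤ) = w - n * (b / n) - n ∧ n * (b / n) + n ≤ w) := by
  have hn : (0 : ℤ) < n := by exact_mod_cast NeZero.pos n
  have hdecomp := Int.emod_add_mul_ediv b n
  have hmod := Int.emod_nonneg b hn.ne'
  have hmod' := Int.emod_lt_of_pos b hn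
  rw [ZMod.val_intCast, Int.emod_def]
  rcases lt_or_ge w (n * (b / n) + n) with h | h
  · have : w / n = b / n := by rw [Int.ediv_eq_iff_of_pos hn]; constructor <;> nlinarith
    exact .inl ⟨by rw [this], h⟩
  · have : w / n = b / n + 1 := by rw [Int.ediv_eq_iff_of_pos hn]; constructor <;> nlinarith
    exact .inr ⟨by rw [this]; ring, h⟩

lemma sbtw_intCast_iff {x y z b : ℤ} (hx : b ≤ x) (hx' : x < b + n) (hy : b ≤ y) (hy' : y < b + n)
    (hz : b ≤ z) (hz' : z < b + n) : sbtw (x : ZMod n) (y : ZMod n) (z : ZMod n) ↔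
      x < y ∧ y < z ∨ y < z ∧ z < x ∨ z < x ∧ x < y := by
  rw [sbtw_iff_val_lt]
  zify
  have hvx := val_intCast_of_mem_window hx hx'
  have hvy := val_intCast_of_mem_window hy hy'
  have hvz := val_intCast_of_mem_window hz hz'
  generalize (n : ℤ) * (b / n) = q at hvx hvy hvz
  omega

lemma crosses_intCast_iff {x y z w b : ℤ} (hx : b ≤ x) (hxy : x ≤ y) (hy : y < b + n)
    (hz : b ≤ z) (hzw : z ≤ w) (hw : w < b + n) :
    Crosses s((x : ZMod n), (y : ZMod n)) s((z : ZMod n), (w : ZMod n)) ↔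
      x < z ∧ z < y ∧ y < w ∨ z < x ∧ x < w ∧ w < y := by
  have hsbtw {p q t : ℤ} (hp : b ≤ p ∧ p < b + n) (hq : b ≤ q ∧ q < b + n)
      (ht : b ≤ t ∧ t < b + n) :=
    sbtw_intCast_iff (n := n) hp.1 hp.2 hq.1 hq.2 ht.1 ht.2
  constructor
  · rintro ⟨a, b', c, d, hab, hcd, h, h'⟩
    rw [Sym2.eq_iff] at hab hcd
    rcases hab with ⟨rfl, rfl⟩ | ⟨rfl, rfl⟩ <;> rcases hcd with ⟨rfl, rfl⟩ | ⟨rfl, rfl⟩ <;>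
      rw [hsbtw (by omega) (by omega) (by omega)] at h h' <;> omega
  · rintro (h | h)
    · refine ⟨x, y, z, w, rfl, rfl, ?_, ?_⟩ <;>
        rw [hsbtw (by omega) (by omega) (by omega)] <;> omega
    · refine ⟨x, y, w, z, rfl, Sym2.eq_swap, ?_, ?_⟩ <;>
        rw [hsbtw (by omega) (by omega) (by omega)] <;> omega

end Residues

/-! ### Sequences with increments 0 and 1 -/

/-- A sequence whose increments are `0` or `1`. Such a sequence `r` in `ℤ/n` encodes a growing
sequence of arcs, the `i`-th of which has `i + 1` vertices and the right end `r i`. -/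
def IsStepSeq {R : Type*} [Add R] [One R] (r : ℕ → R) : Prop :=
  ∀ i, r (i + 1) = r i ∨ r (i + 1) = r i + 1

namespace IsStepSeq

lemma exists_add {R : Type*} [AddMonoidWithOne R] {r : ℕ → R} (hr : IsStepSeq r) (i d : ℕ) :
    ∃ e ≤ d, r (i + d) = r i + (e : R) := by
  induction d with
  | zero => exact ⟨0, le_rfl, by simp⟩
  | succ d ih =>
    obtain ⟨e, he, h⟩ := ih
    rcases hr (i + d) with h' | h'
    · exact ⟨e, by omega, by rw [← add_assoc, h', h]⟩
    · exact ⟨e + 1, by omega, by rw [← add_assoc, h', h, Nat.cast_succ, add_assoc]⟩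

lemma monotone {N : ℕ → ℕ} (hN : IsStepSeq N) : Monotone N :=
  monotone_nat_of_le_succ fun i => by rcases hN i with h | h <;> omega

lemma le_of_zero {N : ℕ → ℕ} (hN : IsStepSeq N) (h0 : N 0 = 0) (j : ℕ) : N j ≤ j := by
  obtain ⟨e, he, h⟩ := hN.exists_add 0 j
  rw [zero_add, h0, zero_add] at h
  exact h.trans_le he

lemma exists_lt_and_succ_eq {N : ℕ → ℕ} (hN : IsStepSeq N) {k q : ℕ} (h0 : N 0 ≤ q) (hk : q < N k) :
    ∃ j < k, N j = q ∧ N (j + 1) = q + 1 := by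
  induction k with
  | zero => omega
  | succ k ih =>
    rcases lt_or_ge q (N k) with hq | hq
    · obtain ⟨j, hj, h⟩ := ih hq
      exact ⟨j, by omega, h⟩
    · have hs := hN k
      exact ⟨k, by omega, by omega, by omega⟩

lemma exists_lift {R : Type*} [AddMonoidWithOne R] {r : ℕ → R} (hr : IsStepSeq r) :
    ∃ N : ℕ → ℕ, IsStepSeq N ∧ N 0 = 0 ∧ ∀ j, r j = r 0 + (N j : R) := by
  classical
  let N (j : ℕ) : ℕ := ((Finset.range j).filter fun i => r (i + 1) ≠ r i).card
  have hN (j : ℕ) : N (j + 1) = if r (j + 1) = r j then N j else N j + 1 := by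
    simp only [N, Finset.range_add_one, Finset.filter_insert, ite_not]
    split_ifs
    · rfl
    · simp
  refine ⟨N, fun j => ?_, rfl, fun j => ?_⟩
  · rw [hN]
    exact (ite_eq_or_eq _ _ _)
  · induction j with
    | zero => simp [N]
    | succ j ih =>
      rw [hN]
      split_ifs with h
      · rw [h, ih]
      · rw [(hr j).resolve_left h, ih, Nat.cast_succ, add_assoc]

variable {n : ℕ} {r r' : ℕ → ZMod n}

lemma eq_of_succ_eq_add_one (hr : IsStepSeq r) (hr' : IsStepSeq r') (hn : 3 ≤ n) {i : ℕ}
    (h : r i = r' i) (hs : r (i + 1) = r' (i + 1) + 1) : r i = r' (i + 1) := by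
  have htwo := natCast_ne_zero_of_lt (n := n) (k := 2) (by omega) (by omega)
  have hone := zmod_one_ne_zero (n := n) (by omega)
  push_cast at htwo
  rcases hr' i with hi' | hi'
  · rw [hi', h]
  · rcases hr i with hi | hi
    · exact absurd (by linear_combination hi - hs - hi' + h) htwo
    · exact absurd (by linear_combination hi - hs - hi' + h) hone

lemma succ_eq_of_eq_add_one (hr : IsStepSeq r) (hr' : IsStepSeq r') (hn : 3 ≤ n) {i : ℕ}
    (h : r (i + 1) = r' (i + 1)) (hs : r i = r' i + 1) : r (i + 1) = r i := by
  have htwo := natCast_ne_zero_of_lt (n := n) (k := 2) (by omega) (by omega)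
  have hone := zmod_one_ne_zero (n := n) (by omega)
  push_cast at htwo
  rcases hr i with hi | hi
  · exact hi
  · rcases hr' i with hi' | hi'
    · exact absurd (by linear_combination h - hi + hi' - hs) htwo
    · exact absurd (by linear_combination h - hi + hi' - hs) hone

end IsStepSeq

/-! ### Partial sums of the vertices of a Yoke graph -/

/-- The partial sum `v_0 + ⋯ + v_i` in `ℤ/n`. The last entry `v_{m+1}`, which is determined by the
others, is left out, so that the sequence of partial sums is constant from `m` on. -/
def YokeVertex.psum {n m : ℕ} (v : YokeVertex n m) (i : ℕ) : ZMod n :=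
  ∑ j ∈ Finset.range (i + 1), if h : j < m + 1 then (v.1 ⟨j, by omega⟩ : ZMod n) else 0

section PartialSums
variable {n m : ℕ} {u v : YokeVertex n m}

lemma isBucket_iff (i : Fin (m + 2)) : IsBucket i ↔ i.val = 0 ∨ i.val = m + 1 := by
  rw [IsBucket, Fin.ext_iff, Fin.ext_iff, Fin.val_zero, Fin.val_last]

lemma psum_zero (v : YokeVertex n m) : v.psum 0 = (v.1 0 : ZMod n) := by
  simp [YokeVertex.psum]

lemma psum_succ (v : YokeVertex n m) {i : ℕ} (hi : i < m) :
    v.psum (i + 1) = v.psum i + (v.1 ⟨i + 1, by omega⟩ : ZMod n) := by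
  rw [YokeVertex.psum, Finset.sum_range_succ, dif_pos (by omega), YokeVertex.psum]

lemma psum_succ_of_le (v : YokeVertex n m) {i : ℕ} (hi : m ≤ i) : v.psum (i + 1) = v.psum i := by
  rw [YokeVertex.psum, Finset.sum_range_succ, dif_neg (by omega), add_zero, YokeVertex.psum]

lemma psum_add_last (v : YokeVertex n m) : v.psum m + v.1 (Fin.last (m + 1)) = 0 := by
  rw [← (ZMod.natCast_eq_zero_iff _ _).2 v.2.2.2, Fin.sum_univ_castSucc, YokeVertex.psum,
    Finset.sum_range]
  simp only [Fin.is_lt, dite_true]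
  push_cast
  rfl

lemma cast_succ_eq_sub (v : YokeVertex n m) (j : Fin (m + 1)) :
    (v.1 j.succ : ZMod n) = (if j.val < m then v.psum (j + 1) else 0) - v.psum j := by
  split_ifs with hj
  · rw [psum_succ v hj]
    exact (add_sub_cancel_left _ _).symm
  · obtain rfl : j = Fin.last m := Fin.ext (by rw [Fin.val_last]; omega)
    rw [zero_sub, Fin.succ_last, Fin.val_last, eq_neg_iff_add_eq_zero, add_comm, psum_add_last]

lemma psum_step (v : YokeVertex n m) {i : ℕ} (h : i < m) :
    (v.1 ⟨i + 1, by omega⟩ = 0 ∧ v.psum (i + 1) = v.psum i) ∨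
      (v.1 ⟨i + 1, by omega⟩ = 1 ∧ v.psum (i + 1) = v.psum i + 1) := by
  have hlt : v.1 ⟨i + 1, by omega⟩ < 2 :=
    v.2.2.1 _ (by rw [isBucket_iff]; dsimp only; omega)
  rw [psum_succ v h]
  interval_cases v.1 ⟨i + 1, by omega⟩ <;> simp

lemma isStepSeq_psum (v : YokeVertex n m) : IsStepSeq v.psum := fun i => by
  rcases lt_or_ge i m with h | h
  · exact (psum_step v h).imp And.right And.right
  · exact .inl (psum_succ_of_le v h)

lemma entry_lt (hn : 2 ≤ n) (v : YokeVertex n m) (j : Fin (m + 2)) : v.1 j < n := by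
  by_cases hb : IsBucket j
  · exact v.2.1 j hb
  · exact (v.2.2.1 j hb).trans_le hn

lemma entry_eq_iff_cast (hn : 2 ≤ n) {j : Fin (m + 2)} :
    u.1 j = v.1 j ↔ (u.1 j : ZMod n) = v.1 j :=
  (natCast_eq_iff_of_lt (entry_lt hn u j) (entry_lt hn v j)).symm

lemma eq_of_psum_eq (hn : 2 ≤ n) (h : ∀ i ≤ m, u.psum i = v.psum i) : u = v := by
  refine Subtype.ext (funext fun j => (entry_eq_iff_cast hn).2 ?_)
  induction j using Fin.cases with
  | zero => rw [← psum_zero, ← psum_zero, h 0 m.zero_le]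
  | succ j =>
    rw [cast_succ_eq_sub, cast_succ_eq_sub, h j j.is_le]
    split_ifs with hj
    · rw [h _ hj]
    · rfl

lemma exists_psum_eq (hn : 2 ≤ n) {r : ℕ → ZMod n}
    (hr : ∀ i < m, r (i + 1) = r i ∨ r (i + 1) = r i + 1) :
    ∃ v : YokeVertex n m, ∀ i ≤ m, v.psum i = r i := by
  have : NeZero n := ⟨by omega⟩
  let s : ℕ → ZMod n := fun i => if i ≤ m then r i else 0
  let w : Fin (m + 2) → ℕ := Fin.cons (r 0).val fun j : Fin (m + 1) => (s (j + 1) - s j).val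
  have hbucket : ∀ i, w i < n := Fin.cases (ZMod.val_lt _) fun j => ZMod.val_lt _
  have hinner : ∀ i, ¬ IsBucket i → w i < 2 := by
    refine Fin.cases (fun h => absurd (.inl rfl) h) fun j hj => ?_
    rw [isBucket_iff, Fin.val_succ] at hj
    simp only [w, s, Fin.cons_succ]
    rw [if_pos (by omega), if_pos (by omega)]
    rcases hr j (by omega) with h | h <;> rw [h]
    · simp
    · have : Fact (1 < n) := ⟨hn⟩
      rw [add_sub_cancel_left, ZMod.val_one]
      exact one_lt_two
  have hsum : n ∣ ∑ i, w i := by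
    rw [← ZMod.natCast_eq_zero_iff, Fin.sum_univ_succ]
    simp only [w, Fin.cons_zero, Fin.cons_succ, Nat.cast_add, Nat.cast_sum, ZMod.natCast_zmod_val]
    rw [← Finset.sum_range fun j => s (j + 1) - s j, Finset.sum_range_sub]
    simp [s]
  let v : YokeVertex n m := ⟨w, fun i _ => hbucket i, hinner, hsum⟩
  refine ⟨v, fun i hi => ?_⟩
  induction i with
  | zero => exact (psum_zero v).trans (ZMod.natCast_zmod_val _)
  | succ i ih =>
    have hv : (v.1 ⟨i + 1, by omega⟩ : ZMod n) = s (i + 1) - s i := ZMod.natCast_zmod_val _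
    rw [psum_succ v hi, ih (by omega), hv]
    simp only [s, if_pos hi, if_pos (Nat.le_of_succ_le hi), add_sub_cancel]

end PartialSums

/-! ### Shifting a unit changes a single partial sum -/

section Shifts
variable {n m : ℕ} {u v : YokeVertex n m}

lemma EntrySucc.cast_eq {i : Fin (m + 2)} {x y : ℕ} (h : EntrySucc n i x y) :
    (y : ZMod n) = x + 1 := by
  rcases h with h | h
  · exact h.2
  · rw [h.2, Nat.cast_add, Nat.cast_one]

lemma entrySucc_iff_cast (hn : 3 ≤ n ∨ m = 0) {i : Fin (m + 2)} :
    EntrySucc n i (u.1 i) (v.1 i) ↔ (v.1 i : ZMod n) = u.1 i + 1 := by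
  refine ⟨EntrySucc.cast_eq, fun h => ?_⟩
  by_cases hb : IsBucket i
  · exact .inl ⟨hb, h⟩
  · refine .inr ⟨hb, ?_⟩
    have hu := u.2.2.1 i hb
    have hv := v.2.2.1 i hb
    rw [isBucket_iff] at hb
    rwa [← Nat.cast_add_one, natCast_eq_iff_of_lt (by omega) (by omega)] at h

/-- The pairs `(n, m)` for which every change of a single partial sum of a vertex of `Y_{n,m}` is a
shift of a unit. For `m ≥ 1` this excludes `n = 2`, where entries of `{0, 1}` and of `ℤ/n` cannot be
told apart; for `m = 0` the only partial sum is arbitrary, so `ℤ/n` must not exceed `{-1, 0, 1}`. -/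
def YokeTight (n m : ℕ) : Prop := 2 ≤ n ∧ (3 ≤ n ∧ 1 ≤ m ∨ m = 0 ∧ n ≤ 3)

lemma psum_eq_add_one_or (hnm : YokeTight n m) {i : ℕ} (hi : i ≤ m)
    (h : ∀ j ≤ m, u.psum j = v.psum j ↔ j ≠ i) :
    u.psum i = v.psum i + 1 ∨ v.psum i = u.psum i + 1 := by
  have hne : u.psum i ≠ v.psum i := fun he => (h i hi).1 he rfl
  obtain ⟨hn, ⟨-, hm⟩ | ⟨rfl, hn'⟩⟩ := hnm
  · rcases Nat.eq_zero_or_pos i with rfl | hi0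
    · have he : u.psum 1 = v.psum 1 := (h 1 hm).2 one_ne_zero
      rcases psum_step u hm with ⟨-, hu⟩ | ⟨-, hu⟩ <;>
        rcases psum_step v hm with ⟨-, hv⟩ | ⟨-, hv⟩ <;> rw [zero_add] at hu hv <;>
        rw [hu, hv] at he
      · exact absurd he hne
      · exact .inl he
      · exact .inr he.symm
      · exact absurd (add_right_cancel he) hne
    · obtain ⟨i, rfl⟩ := Nat.exists_eq_add_of_le' hi0
      have he : u.psum i = v.psum i := (h i (by omega)).2 (by omega)
      rcases psum_step u hi with ⟨-, hu⟩ | ⟨-, hu⟩ <;>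
        rcases psum_step v hi with ⟨-, hv⟩ | ⟨-, hv⟩ <;> rw [hu, hv, he] at hne ⊢
      · exact absurd rfl hne
      · exact .inr rfl
      · exact .inl rfl
      · exact absurd rfl hne
  · generalize u.psum i = x at *
    generalize v.psum i = y at *
    interval_cases n <;> clear * - hne <;> revert x y <;> decide

lemma psum_sub_of_cast_sub {i : Fin (m + 1)} {ε : ZMod n}
    (hrest : ∀ j, j ≠ i.castSucc → j ≠ i.succ → u.1 j = v.1 j)
    (hfst : (u.1 i.castSucc : ZMod n) = v.1 i.castSucc + ε)
    (hsnd : (v.1 i.succ : ZMod n) = u.1 i.succ + ε) {j : ℕ} (hj : j ≤ m) :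
    u.psum j - v.psum j = if j = i.val then ε else 0 := by
  induction j with
  | zero =>
    rw [psum_zero, psum_zero]
    split_ifs with h0
    · obtain rfl : i = 0 := Fin.ext h0.symm
      exact sub_eq_of_eq_add' hfst
    · rw [hrest 0 (fun h => h0 (congrArg Fin.val h)) (Fin.succ_ne_zero i).symm, sub_self]
  | succ j ih =>
    rw [psum_succ u hj, psum_succ v hj, add_sub_add_comm, ih (by omega)]
    rcases eq_or_ne i.val (j + 1) with h | h
    · have hi : (⟨j + 1, by omega⟩ : Fin (m + 2)) = i.castSucc := Fin.ext h.symm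
      rw [if_neg (by omega), if_pos h.symm, hi, hfst]
      ring
    · rw [if_neg h.symm]
      rcases eq_or_ne i.val j with h' | h'
      · have hi : (⟨j + 1, by omega⟩ : Fin (m + 2)) = i.succ :=
          Fin.ext (congrArg Nat.succ h'.symm)
        rw [if_pos h'.symm, hi, hsnd]
        ring
      · rw [if_neg h'.symm, hrest _ (fun hc => h (Fin.mk.inj hc).symm)
          (fun hc => h' (Nat.succ.inj (Fin.mk.inj hc)).symm), sub_self, add_zero]

lemma YokeShift.psum_eq_iff (hn : 2 ≤ n) {i : Fin (m + 1)} (h : YokeShift i u v) {j : ℕ}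
    (hj : j ≤ m) : u.psum j = v.psum j ↔ j ≠ i.val := by
  obtain ⟨ε, hε, hsub⟩ : ∃ ε : ZMod n, ε ≠ 0 ∧
      u.psum j - v.psum j = if j = i.val then ε else 0 := by
    rcases h.2 with ⟨hfst, hsnd⟩ | ⟨hfst, hsnd⟩
    · exact ⟨1, zmod_one_ne_zero hn, psum_sub_of_cast_sub h.1 hfst.cast_eq hsnd.cast_eq hj⟩
    · refine ⟨-1, neg_ne_zero.2 (zmod_one_ne_zero hn), psum_sub_of_cast_sub h.1 ?_ ?_ hj⟩
      · rw [hfst.cast_eq]; ring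
      · rw [hsnd.cast_eq]; ring
  rw [← sub_eq_zero, hsub]
  simp [hε]

lemma cast_castSucc_sub_of_psum {i : Fin (m + 1)} (h : ∀ j < i.val, u.psum j = v.psum j) :
    (u.1 i.castSucc : ZMod n) - v.1 i.castSucc = u.psum i - v.psum i := by
  induction i using Fin.cases with
  | zero => rw [Fin.val_zero, psum_zero, psum_zero, Fin.castSucc_zero]
  | succ i =>
    rw [Fin.val_succ, psum_succ u i.2, psum_succ v i.2, h i (by simp), add_sub_add_left_eq_sub]
    rfl

lemma yokeShift_iff_psum (hnm : YokeTight n m) {i : Fin (m + 1)} :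
    YokeShift i u v ↔ ∀ j ≤ m, u.psum j = v.psum j ↔ j ≠ i.val := by
  refine ⟨fun h j => h.psum_eq_iff hnm.1, fun h => ⟨fun j hj hj' => ?_, ?_⟩⟩
  · rw [entry_eq_iff_cast hnm.1]
    induction j using Fin.cases with
    | zero => rw [← psum_zero, ← psum_zero,
        (h 0 m.zero_le).2 fun h0 => hj (Fin.ext h0)]
    | succ j =>
      have hji : j.val ≠ i.val := fun h0 => hj' (congrArg _ (Fin.ext h0))
      have hji' : j.val + 1 ≠ i.val := fun h0 => hj (Fin.ext h0)
      rw [cast_succ_eq_sub, cast_succ_eq_sub, (h j j.is_le).2 hji]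
      split_ifs with hlt
      · rw [(h _ hlt).2 hji']
      · rfl
  · have hn : 3 ≤ n ∨ m = 0 := hnm.2.imp And.left And.left
    have hfst : (u.1 i.castSucc : ZMod n) - v.1 i.castSucc = u.psum i - v.psum i :=
      cast_castSucc_sub_of_psum fun j hj => (h j (by omega)).2 hj.ne
    have hsnd : (u.1 i.succ : ZMod n) - v.1 i.succ = v.psum i - u.psum i := by
      rw [cast_succ_eq_sub, cast_succ_eq_sub]
      split_ifs with hlt
      · rw [(h _ hlt).2 (by omega), sub_sub_sub_cancel_left]
      · rw [sub_sub_sub_cancel_left]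
    simp only [entrySucc_iff_cast hn]
    rcases psum_eq_add_one_or hnm i.is_le h with hd | hd
    · exact .inl ⟨by linear_combination hfst + hd, by linear_combination hd - hsnd⟩
    · exact .inr ⟨by linear_combination hd - hfst, by linear_combination hsnd + hd⟩

end Shifts

/-! ### Arcs -/

/-- The arc `{e, e - 1, …, e - (k - 1)}` of `k` consecutive vertices of the polygon, given by its
right end `e`. -/
def arcSet {n : ℕ} (e : ZMod n) (k : ℕ) : Set (ZMod n) := {x | ∃ d < k, x = e - (d : ZMod n)}

section Arcs
variable {n : ℕ}

lemma self_mem_arcSet (x : ZMod n) (k : ℕ) : x ∈ arcSet x (k + 1) := ⟨0, k.succ_pos, by simp⟩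

lemma sub_mem_arcSet_iff {e : ZMod n} {d k : ℕ} (hd : d < n) (hk : k ≤ n) :
    e - d ∈ arcSet e k ↔ d < k := by
  refine ⟨?_, fun h => ⟨d, h, rfl⟩⟩
  rintro ⟨d', hd', h⟩
  rw [sub_right_inj, natCast_eq_iff_of_lt hd (hd'.trans_le hk)] at h
  exact h.trans_lt hd'

lemma exists_eq_sub_of_arcSet_subset {e e' : ZMod n} {k k' : ℕ} (hk : 1 ≤ k) (hkk : k ≤ k')
    (hk' : k' < n) (h : arcSet e k ⊆ arcSet e' k') : ∃ d ≤ k' - k, e = e' - (d : ZMod n) := by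
  obtain ⟨d, hd, rfl⟩ := (h ⟨0, hk, by simp⟩ : e ∈ arcSet e' k')
  refine ⟨d, ?_, rfl⟩
  by_contra hlt
  have hmem : e' - (d : ZMod n) - ((k' - d : ℕ) : ZMod n) ∈ arcSet e' k' :=
    h ⟨k' - d, by omega, rfl⟩
  rw [sub_sub, ← Nat.cast_add, sub_mem_arcSet_iff (by omega) hk'.le] at hmem
  omega

lemma arcSet_injective {e e' : ZMod n} {k : ℕ} (hk : 1 ≤ k) (hk' : k < n)
    (h : arcSet e k = arcSet e' k) : e = e' := by
  obtain ⟨d, hd, rfl⟩ := exists_eq_sub_of_arcSet_subset hk le_rfl hk' h.subset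
  obtain rfl : d = 0 := by omega
  simp

lemma eq_or_eq_add_one_of_arcSet_subset {e e' : ZMod n} {k : ℕ} (hk : 1 ≤ k) (hk' : k + 1 < n)
    (h : arcSet e k ⊆ arcSet e' (k + 1)) : e' = e ∨ e' = e + 1 := by
  obtain ⟨d, hd, rfl⟩ := exists_eq_sub_of_arcSet_subset hk k.le_succ hk' h
  rcases (by omega : d = 0 ∨ d = 1) with rfl | rfl
  · left; simp
  · right; simp

lemma setOf_add_eq_arcSet (a : ZMod n) (k : ℕ) :
    {x | ∃ j < k, x = a + (j : ZMod n)} = arcSet (a + (k : ZMod n) - 1) k := by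
  have hreflect {d : ℕ} (hd : d < k) :
      a + (k : ZMod n) - 1 - (d : ZMod n) = a + ((k - 1 - d : ℕ) : ZMod n) := by
    rw [Nat.cast_sub (by omega), Nat.cast_sub (by omega)]
    push_cast
    ring
  ext x
  constructor
  · rintro ⟨j, hj, rfl⟩
    refine ⟨k - 1 - j, by omega, ?_⟩
    rw [hreflect (by omega), Nat.sub_sub_self (by omega)]
  · rintro ⟨d, hd, rfl⟩
    exact ⟨k - 1 - d, by omega, hreflect hd⟩

lemma isCyclicInterval_arcSet (e : ZMod n) (k : ℕ) : IsCyclicInterval (arcSet e k) :=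
  ⟨e + 1 - (k : ZMod n), k, by rw [setOf_add_eq_arcSet, sub_add_cancel, add_sub_cancel_right]⟩

lemma IsCyclicInterval.exists_arcSet {S : Set (ZMod n)} (h : IsCyclicInterval S) :
    ∃ e k, S = arcSet e k := by
  obtain ⟨a, k, rfl⟩ := h
  exact ⟨a + (k : ZMod n) - 1, k, setOf_add_eq_arcSet a k⟩

lemma exists_eq_sub_natCast [NeZero n] (e x : ZMod n) : ∃ d < n, x = e - (d : ZMod n) :=
  ⟨(e - x).val, ZMod.val_lt _, by rw [ZMod.natCast_zmod_val, sub_sub_cancel]⟩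

lemma compl_arcSet [NeZero n] (e : ZMod n) {k : ℕ} (hk : k ≤ n) :
    (arcSet e k)ᶜ = arcSet (e - (k : ZMod n)) (n - k) := by
  ext x
  obtain ⟨d, hd, rfl⟩ := exists_eq_sub_natCast e x
  rw [Set.mem_compl_iff, sub_mem_arcSet_iff hd hk]
  constructor
  · intro h
    refine ⟨d - k, by omega, ?_⟩
    rw [sub_sub, ← Nat.cast_add, Nat.add_sub_cancel' (not_lt.1 h)]
  · rintro ⟨d', hd', h⟩
    rw [sub_sub, sub_right_inj, ← Nat.cast_add, natCast_eq_iff_of_lt hd (by omega)] at h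
    omega

lemma ncard_arcSet (e : ZMod n) {k : ℕ} (hk : k ≤ n) : (arcSet e k).ncard = k := by
  have himage : arcSet e k = (fun d : ℕ => e - (d : ZMod n)) '' (Finset.range k : Set ℕ) := by
    ext x
    simp [arcSet, eq_comm]
  rw [himage, Set.InjOn.ncard_image, Set.ncard_coe_finset, Finset.card_range]
  intro a ha b hb h
  rw [Finset.coe_range, Set.mem_Iio] at ha hb
  rwa [sub_right_inj, natCast_eq_iff_of_lt (by omega) (by omega)] at h

lemma arcSet_eq_univ [NeZero n] (e : ZMod n) {k : ℕ} (hk : n ≤ k) : arcSet e k = Set.univ :=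
  Set.eq_univ_of_forall fun x => (exists_eq_sub_natCast e x).imp fun _ h => ⟨h.1.trans_le hk, h.2⟩

lemma add_one_eq_sub_natCast (hn : 1 ≤ n) (x : ZMod n) : x + 1 = x - ((n - 1 : ℕ) : ZMod n) := by
  simp [Nat.cast_sub hn]

end Arcs

/-! ### Growing sequences of arcs -/

/-- The vertices in the order in which they enter the arcs `arcSet (r i) (i + 1)`, for a sequence
`r` with increments `0` and `1`. -/
def arcVertex {n : ℕ} (r : ℕ → ZMod n) : ℕ → ZMod n
  | 0 => r 0
  | i + 1 => if r (i + 1) = r i then r i - ((i + 1 : ℕ) : ZMod n) else r i + 1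

section GrowingArcs
variable {n : ℕ} {r : ℕ → ZMod n}

lemma arcVertex_succ_of_eq {i : ℕ} (h : r (i + 1) = r i) :
    arcVertex r (i + 1) = r i - ((i + 1 : ℕ) : ZMod n) := if_pos h

lemma arcVertex_succ_of_eq_add (hn : 2 ≤ n) {i : ℕ} (h : r (i + 1) = r i + 1) :
    arcVertex r (i + 1) = r i + 1 :=
  if_neg fun h' => zmod_one_ne_zero hn (left_eq_add.1 (h'.symm.trans h))

namespace IsStepSeq

lemma arcSet_succ (hr : IsStepSeq r) (hn : 2 ≤ n) (i : ℕ) :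
    arcSet (r (i + 1)) (i + 2) = insert (arcVertex r (i + 1)) (arcSet (r i) (i + 1)) := by
  ext x
  rw [Set.mem_insert_iff]
  rcases hr i with h | h
  · rw [arcVertex_succ_of_eq h, h]
    constructor
    · rintro ⟨d, hd, rfl⟩
      rcases Nat.lt_succ_iff_lt_or_eq.1 hd with hd | rfl
      · exact .inr ⟨d, hd, rfl⟩
      · exact .inl rfl
    · rintro (rfl | ⟨d, hd, rfl⟩)
      · exact ⟨i + 1, by omega, rfl⟩
      · exact ⟨d, by omega, rfl⟩
  · rw [arcVertex_succ_of_eq_add hn h, h]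
    constructor
    · rintro ⟨_ | d, hd, rfl⟩
      · left; simp
      · exact .inr ⟨d, by omega, by push_cast; ring⟩
    · rintro (rfl | ⟨d, hd, rfl⟩)
      · exact self_mem_arcSet _ _
      · exact ⟨d + 1, by omega, by push_cast; ring⟩

lemma mem_arcSet_iff_exists (hr : IsStepSeq r) (hn : 2 ≤ n) {i : ℕ} {x : ZMod n} :
    x ∈ arcSet (r i) (i + 1) ↔ ∃ j ≤ i, x = arcVertex r j := by
  induction i with
  | zero => simp [arcSet, arcVertex]
  | succ i ih =>
    rw [hr.arcSet_succ hn, Set.mem_insert_iff, ih]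
    constructor
    · rintro (h | ⟨j, hj, h⟩)
      · exact ⟨i + 1, le_rfl, h⟩
      · exact ⟨j, by omega, h⟩
    · rintro ⟨j, hj, h⟩
      rcases Nat.le_succ_iff.1 hj with hj | rfl
      · exact .inr ⟨j, hj, h⟩
      · exact .inl h

lemma arcVertex_notMem (hr : IsStepSeq r) (hn : 2 ≤ n) {i : ℕ} (hi : i + 1 < n) :
    arcVertex r (i + 1) ∉ arcSet (r i) (i + 1) := by
  rcases hr i with h | h
  · rw [arcVertex_succ_of_eq h, sub_mem_arcSet_iff hi hi.le]
    exact lt_irrefl _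
  · rw [arcVertex_succ_of_eq_add hn h, add_one_eq_sub_natCast (by omega),
      sub_mem_arcSet_iff (by omega) hi.le]
    omega

lemma arcSet_mono (hr : IsStepSeq r) (hn : 2 ≤ n) {i j : ℕ} (hij : i ≤ j) :
    arcSet (r i) (i + 1) ⊆ arcSet (r j) (j + 1) := fun x => by
  rw [hr.mem_arcSet_iff_exists hn, hr.mem_arcSet_iff_exists hn]
  exact fun ⟨k, hk, h⟩ => ⟨k, hk.trans hij, h⟩

lemma mem_arcSet (hr : IsStepSeq r) (hn : 2 ≤ n) {i j : ℕ} (hij : i ≤ j) :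
    r i ∈ arcSet (r j) (j + 1) := hr.arcSet_mono hn hij (self_mem_arcSet _ _)

lemma arcVertex_mem_iff (hr : IsStepSeq r) (hn : 2 ≤ n) {i j : ℕ} (hi : i < n) :
    arcVertex r i ∈ arcSet (r j) (j + 1) ↔ i ≤ j := by
  refine ⟨fun h => ?_, fun h => (hr.mem_arcSet_iff_exists hn).2 ⟨i, h, rfl⟩⟩
  by_contra! hij
  obtain ⟨i, rfl⟩ := Nat.exists_eq_add_of_le' (Nat.one_le_of_lt hij)
  exact hr.arcVertex_notMem hn hi (hr.arcSet_mono hn (Nat.le_of_lt_succ hij) h)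

lemma arcVertex_inj (hr : IsStepSeq r) (hn : 2 ≤ n) {i j : ℕ} (hi : i < n) (hj : j < n) :
    arcVertex r i = arcVertex r j ↔ i = j := by
  refine ⟨fun h => le_antisymm ?_ ?_, congrArg _⟩
  · rw [← hr.arcVertex_mem_iff hn hi, h, hr.arcVertex_mem_iff hn hj]
  · rw [← hr.arcVertex_mem_iff hn hj, ← h, hr.arcVertex_mem_iff hn hi]

lemma exists_eq_arcVertex (hr : IsStepSeq r) (hn : 2 ≤ n) (x : ZMod n) :
    ∃ j < n, x = arcVertex r j := by
  have : NeZero n := ⟨by omega⟩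
  have hx : x ∈ arcSet (r (n - 1)) (n - 1 + 1) := by
    rw [arcSet_eq_univ _ (by omega)]
    exact Set.mem_univ x
  obtain ⟨j, hj, h⟩ := (hr.mem_arcSet_iff_exists hn).1 hx
  exact ⟨j, by omega, h⟩

end IsStepSeq

end GrowingArcs

/-! ### Arc permutations -/

section Prefixes
variable {n : ℕ} {π σ : Equiv.Perm (Fin n)}

lemma letter_injective : Function.Injective (letter : Fin n → ZMod n) := by
  intro x y h
  rw [letter, letter, add_left_inj, natCast_eq_iff_of_lt x.2 y.2] at h
  exact Fin.ext h

lemma letter_surjective [NeZero n] : Function.Surjective (letter : Fin n → ZMod n) := fun x =>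
  ⟨⟨(x - 1).val, ZMod.val_lt _⟩, by rw [letter, ZMod.natCast_zmod_val, sub_add_cancel]⟩

lemma letter_mem_prefixSet {k : ℕ} {p : Fin n} : letter (π p) ∈ prefixSet π k ↔ p.val < k := by
  refine ⟨?_, fun h => ⟨p, h, rfl⟩⟩
  rintro ⟨i, hi, h⟩
  rwa [π.injective (letter_injective h)]

lemma suffixSet_eq_compl [NeZero n] (π : Equiv.Perm (Fin n)) (k : ℕ) :
    suffixSet π k = (prefixSet π k)ᶜ := by
  ext x
  obtain ⟨q, rfl⟩ := letter_surjective x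
  obtain ⟨p, rfl⟩ := π.surjective q
  rw [Set.mem_compl_iff, letter_mem_prefixSet, not_lt]
  refine ⟨?_, fun h => ⟨p, h, rfl⟩⟩
  rintro ⟨i, hi, h⟩
  rwa [π.injective (letter_injective h)]

lemma ncard_prefixSet (π : Equiv.Perm (Fin n)) {k : ℕ} (hk : k ≤ n) :
    (prefixSet π k).ncard = k := by
  have hrange : prefixSet π k = Set.range fun i : Fin k => letter (π (i.castLE hk)) := by
    ext x
    constructor
    · rintro ⟨i, hi, rfl⟩
      exact ⟨⟨i, hi⟩, rfl⟩
    · rintro ⟨i, rfl⟩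
      exact ⟨i.castLE hk, i.2, rfl⟩
  have hinj : Function.Injective fun i : Fin k => letter (π (i.castLE hk)) :=
    letter_injective.comp (π.injective.comp (Fin.castLE_injective hk))
  rw [hrange, ← Set.image_univ, Set.ncard_image_of_injective _ hinj, Set.ncard_univ, Nat.card_fin]

lemma prefixSet_zero (π : Equiv.Perm (Fin n)) : prefixSet π 0 = ∅ := by
  simp [prefixSet]

lemma prefixSet_of_le (π : Equiv.Perm (Fin n)) {k : ℕ} (hk : n ≤ k) :
    prefixSet π k = Set.range letter := by
  ext x
  constructor
  · rintro ⟨i, -, rfl⟩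
    exact ⟨π i, rfl⟩
  · rintro ⟨p, rfl⟩
    exact ⟨π.symm p, (π.symm p).2.trans_le hk, by rw [π.apply_symm_apply]⟩

lemma prefixSet_mono (π : Equiv.Perm (Fin n)) : Monotone (prefixSet π) := by
  rintro k l hkl x ⟨i, hi, rfl⟩
  exact ⟨i, hi.trans_le hkl, rfl⟩

lemma prefixSet_succ (π : Equiv.Perm (Fin n)) (p : Fin n) :
    prefixSet π (p + 1) = insert (letter (π p)) (prefixSet π p) := by
  ext x
  constructor
  · rintro ⟨i, hi, rfl⟩
    rcases Nat.lt_succ_iff_lt_or_eq.1 hi with h | h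
    · exact .inr ⟨i, h, rfl⟩
    · exact .inl (by rw [Fin.ext h])
  · rintro (rfl | ⟨i, hi, rfl⟩)
    · exact ⟨p, p.val.lt_succ_self, rfl⟩
    · exact ⟨i, hi.trans p.val.lt_succ_self, rfl⟩

lemma prefixSet_eq_of_imp {k : ℕ} (h : 0 < k → k < n → prefixSet π k = prefixSet σ k) :
    prefixSet π k = prefixSet σ k := by
  rcases Nat.eq_zero_or_pos k with rfl | hk
  · rw [prefixSet_zero, prefixSet_zero]
  · rcases lt_or_ge k n with hkn | hkn
    · exact h hk hkn
    · rw [prefixSet_of_le π hkn, prefixSet_of_le σ hkn]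

lemma perm_eq_of_prefixSet_eq
    (h : ∀ k, 0 < k → k < n → prefixSet π k = prefixSet σ k) : π = σ := by
  refine Equiv.ext fun p => ?_
  obtain ⟨q, hq⟩ := σ.surjective (π p)
  have hmem : letter (σ q) ∈ prefixSet σ (p + 1) := by
    rw [hq, ← prefixSet_eq_of_imp (h _), letter_mem_prefixSet]
    exact p.val.lt_succ_self
  have hnotMem : letter (σ q) ∉ prefixSet σ p := by
    rw [hq, ← prefixSet_eq_of_imp (h _), letter_mem_prefixSet]
    exact lt_irrefl _
  rw [letter_mem_prefixSet] at hmem hnotMem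
  rw [← hq, Fin.ext (by omega : q.val = p.val)]

lemma prefixSet_mul_swap (σ : Equiv.Perm (Fin n)) {p q : Fin n} (hpq : p.val + 1 = q.val) {k : ℕ}
    (hk : k ≠ q.val) : prefixSet (σ * Equiv.swap p q) k = prefixSet σ k := by
  have hlt (i : Fin n) : (Equiv.swap p q i).val < k ↔ i.val < k := by
    rw [Equiv.swap_apply_def]
    split_ifs with hp hq
    · rw [hp]; omega
    · rw [hq]; omega
    · rfl
  ext x
  constructor
  · rintro ⟨i, hi, rfl⟩
    exact ⟨Equiv.swap p q i, (hlt i).2 hi, rfl⟩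
  · rintro ⟨i, hi, rfl⟩
    exact ⟨Equiv.swap p q i, (hlt i).2 hi, by rw [Equiv.Perm.mul_apply, Equiv.swap_apply_self]⟩

lemma eq_mul_swap_iff_prefixSet {p q : Fin n} (hpq : p.val + 1 = q.val) :
    π = σ * Equiv.swap p q ↔
      ∀ k, 0 < k → k < n → (prefixSet π k = prefixSet σ k ↔ k ≠ q.val) := by
  constructor
  · rintro rfl k - -
    refine ⟨?_, prefixSet_mul_swap σ hpq⟩
    rintro h rfl
    have hmem : letter ((σ * Equiv.swap p q) p) ∈ prefixSet σ q := by
      rw [← h, letter_mem_prefixSet]; omega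
    rw [Equiv.Perm.mul_apply, Equiv.swap_apply_left, letter_mem_prefixSet] at hmem
    exact lt_irrefl _ hmem
  · intro h
    have hne {k : ℕ} (hk : k ≠ q.val) : prefixSet π k = prefixSet σ k :=
      prefixSet_eq_of_imp fun h0 hn => (h k h0 hn).2 hk
    have hπ : prefixSet π q = insert (letter (π p)) (prefixSet σ p) := by
      rw [← hpq, prefixSet_succ, hne (by omega)]
    have hσ (x : Fin n) (hx : σ p = x) : prefixSet σ q = insert (letter x) (prefixSet σ p) := by
      rw [← hpq, prefixSet_succ, hx]
    have hpπ : letter (π p) = letter (σ q) := by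
      have hmem : letter (π p) ∈ prefixSet σ (q + 1) := by
        rw [← hne (by omega), letter_mem_prefixSet]; omega
      have hnotMem : letter (π p) ∉ prefixSet σ p := by
        rw [← hne (by omega), letter_mem_prefixSet]; omega
      rw [prefixSet_succ, hσ _ rfl] at hmem
      refine hmem.resolve_right fun hmem => (h q (by omega) q.2).1 ?_ rfl
      rw [hπ, hσ _ (letter_injective (hmem.resolve_right hnotMem)).symm]
    refine perm_eq_of_prefixSet_eq fun k _ _ => ?_
    rcases eq_or_ne k q.val with rfl | hk
    · rw [hπ, hpπ, ← hpq, prefixSet_succ, Equiv.Perm.mul_apply, Equiv.swap_apply_left,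
        prefixSet_mul_swap σ hpq (by omega)]
    · rw [hne hk, prefixSet_mul_swap σ hpq hk]

end Prefixes

/-- `π` lists the letters in the order in which they enter the arcs that end at the partial sums of
`v`. The shift by one is that between the letters `1, …, n` and the entry `v_0 = π(1) - 1`. -/
def ArcRel {n : ℕ} (π : ArcPerm n) (v : YokeVertex n (n - 2)) : Prop :=
  ∀ p : Fin n, letter (π.1 p) = arcVertex (fun i => v.psum i + 1) p

section ArcPermutations
variable {n : ℕ}

lemma IsStepSeq.add_const {r : ℕ → ZMod n} (hr : IsStepSeq r) (c : ZMod n) :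
    IsStepSeq fun i => r i + c := fun i =>
  (hr i).imp (congrArg (· + c)) fun h => (congrArg (· + c) h).trans (add_right_comm _ _ _)

lemma prefixSet_of_letter_eq_arcVertex (hn : 2 ≤ n) {r : ℕ → ZMod n} (hr : IsStepSeq r)
    {π : Equiv.Perm (Fin n)} (h : ∀ p : Fin n, letter (π p) = arcVertex r p) {i : ℕ} (hi : i < n) :
    prefixSet π (i + 1) = arcSet (r i) (i + 1) := by
  ext x
  rw [hr.mem_arcSet_iff_exists hn]
  constructor
  · rintro ⟨p, hp, rfl⟩
    exact ⟨p, Nat.le_of_lt_succ hp, h p⟩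
  · rintro ⟨j, hj, rfl⟩
    exact ⟨⟨j, hj.trans_lt hi⟩, Nat.lt_succ_of_le hj, (h ⟨j, hj.trans_lt hi⟩).symm⟩

lemma IsStepSeq.exists_arcPerm (hn : 2 ≤ n) {r : ℕ → ZMod n} (hr : IsStepSeq r) :
    ∃ π : ArcPerm n, ∀ p : Fin n, letter (π.1 p) = arcVertex r p := by
  have : NeZero n := ⟨by omega⟩
  choose f hf using fun p : Fin n => letter_surjective (arcVertex r p)
  have hinj : f.Injective := fun p q h =>
    Fin.ext ((hr.arcVertex_inj hn p.2 q.2).1 (by rw [← hf, h, hf]))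
  let π : Equiv.Perm (Fin n) := Equiv.ofBijective f (Finite.injective_iff_bijective.1 hinj)
  refine ⟨⟨π, fun k hk => ?_⟩, hf⟩
  obtain ⟨e, he⟩ : ∃ e, prefixSet π k = arcSet e k := by
    rcases k with _ | k
    · exact ⟨0, by simp [prefixSet, arcSet]⟩
    · exact ⟨r k, prefixSet_of_letter_eq_arcVertex hn hr hf hk⟩
  rw [suffixSet_eq_compl, he, compl_arcSet e hk]
  exact ⟨isCyclicInterval_arcSet _ _, isCyclicInterval_arcSet _ _⟩

lemma exists_prefixSet_eq_arcSet (π : ArcPerm n) {k : ℕ} (hk : k < n) :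
    ∃ e, prefixSet π.1 k = arcSet e k := by
  have : NeZero n := ⟨by omega⟩
  obtain ⟨e, l, h⟩ := (π.2 k hk.le).1.exists_arcSet
  refine ⟨e, ?_⟩
  have hcard := ncard_prefixSet π.1 hk.le
  rw [h] at hcard ⊢
  rcases le_total l n with hl | hl
  · rw [ncard_arcSet e hl] at hcard
    rw [hcard]
  · rw [arcSet_eq_univ e hl, Set.ncard_univ, Nat.card_zmod] at hcard
    omega

namespace ArcRel
variable {π σ : ArcPerm n} {u v : YokeVertex n (n - 2)}

lemma prefixSet_succ (h : ArcRel π v) (hn : 2 ≤ n) {i : ℕ} (hi : i < n) :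
    prefixSet π.1 (i + 1) = arcSet (v.psum i + 1) (i + 1) :=
  prefixSet_of_letter_eq_arcVertex hn ((isStepSeq_psum v).add_const 1) h hi

lemma prefixSet_eq_iff (hu : ArcRel π u) (hv : ArcRel σ v) (hn : 2 ≤ n) {i : ℕ} (hi : i ≤ n - 2) :
    prefixSet π.1 (i + 1) = prefixSet σ.1 (i + 1) ↔ u.psum i = v.psum i := by
  rw [hu.prefixSet_succ hn (by omega), hv.prefixSet_succ hn (by omega)]
  exact ⟨fun h => add_right_cancel (arcSet_injective (by omega) (by omega) h), fun h => by rw [h]⟩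

lemma biTotal (hn : 2 ≤ n) : Relator.BiTotal (ArcRel (n := n)) := by
  have hright (v : YokeVertex n (n - 2)) : ∃ π, ArcRel π v :=
    ((isStepSeq_psum v).add_const 1).exists_arcPerm hn
  refine ⟨fun π => ?_, hright⟩
  choose! e he using fun i (hi : i + 1 < n) => exists_prefixSet_eq_arcSet π hi
  obtain ⟨v, hv⟩ := exists_psum_eq (m := n - 2) hn (r := fun i => e i - 1) fun i hi => by
    have hsub : arcSet (e i) (i + 1) ⊆ arcSet (e (i + 1)) (i + 2) := by
      rw [← he i (by omega), ← he (i + 1) (by omega)]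
      exact prefixSet_mono π.1 (Nat.le_succ _)
    rcases eq_or_eq_add_one_of_arcSet_subset (by omega) (by omega) hsub with h | h
    · exact .inl (by rw [h])
    · exact .inr (by rw [h, sub_add_cancel, add_sub_cancel_right])
  obtain ⟨σ, hσ⟩ := hright v
  obtain rfl : σ = π := Subtype.ext <| perm_eq_of_prefixSet_eq fun k h0 hk => by
    obtain ⟨i, rfl⟩ := Nat.exists_eq_add_of_le' h0
    rw [hσ.prefixSet_succ hn (by omega), he i hk, hv i (by omega), sub_add_cancel]
  exact ⟨v, hσ⟩

lemma biUnique (hn : 2 ≤ n) : Relator.BiUnique (ArcRel (n := n)) :=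
  ⟨fun _ _ _ h h' => Subtype.ext <| Equiv.ext fun p => letter_injective ((h p).trans (h' p).symm),
    fun _ _ _ h h' => eq_of_psum_eq hn fun _ hi => (h.prefixSet_eq_iff h' hn hi).1 rfl⟩

lemma arcSwap_iff (hu : ArcRel π u) (hv : ArcRel σ v) (hn : 2 ≤ n) {i : ℕ} (hi : i + 1 < n) :
    ArcSwap i hi π σ ↔ ∀ j ≤ n - 2, u.psum j = v.psum j ↔ j ≠ i := by
  rw [ArcSwap, eq_mul_swap_iff_prefixSet (rfl : i + 1 = i + 1)]
  constructor
  · intro h j hj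
    rw [← hu.prefixSet_eq_iff hv hn hj, h (j + 1) (by omega) (by omega), Ne, Ne, add_left_inj]
  · intro h k h0 hk
    obtain ⟨j, rfl⟩ := Nat.exists_eq_add_of_le' h0
    rw [hu.prefixSet_eq_iff hv hn (by omega), h j (by omega), Ne, Ne, add_left_inj]

lemma arcCode (h : ArcRel π v) (hn : 2 ≤ n) : ArcCode π v := by
  refine ⟨fun p hp => ?_, ?_⟩
  · have hletter := h p
    rw [hp, letter, arcVertex, psum_zero, add_left_inj,
      natCast_eq_iff_of_lt (π.1 p).2 (v.2.1 0 (.inl rfl))] at hletter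
    exact hletter.symm
  · rintro ⟨_ | i, hi⟩ p h1 hi' hp
    · exact absurd h1 (by simp)
    change p.val = i + 1 at hp
    change _ ∈ prefixSet π.1 (i + 1) ∧ _ ∨ _ ∈ prefixSet π.1 (i + 1) ∧ _
    rw [h.prefixSet_succ hn (by omega), h p, hp]
    rcases psum_step v hi' with ⟨hv, hs⟩ | ⟨hv, hs⟩
    · refine .inr ⟨⟨i, i.lt_succ_self, ?_⟩, hv⟩
      rw [arcVertex_succ_of_eq (by rw [hs])]
      push_cast
      ring
    · refine .inl ⟨?_, hv⟩
      rw [arcVertex_succ_of_eq_add hn (by rw [hs]), add_sub_cancel_right]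
      exact self_mem_arcSet _ _

end ArcRel

lemma yokeTight_arc (hn : 2 ≤ n) : YokeTight n (n - 2) := ⟨hn, by omega⟩

theorem exists_arcGraph_iso (hn : 2 ≤ n) : ∃ f : arcGraph n ≃g yokeGraph n (n - 2),
    (∀ π : ArcPerm n, ArcCode π (f π)) ∧
      ∀ (π σ : ArcPerm n) (i : ℕ) (hi : i + 1 < n) (j : Fin (n - 2 + 1)), i = j.val →
        (ArcSwap i hi π σ ↔ YokeShift j (f π) (f σ)) := by
  have hswap ⦃π σ : ArcPerm n⦄ ⦃u v⦄ (hu : ArcRel π u) (hv : ArcRel σ v) {i : ℕ} (hi : i + 1 < n)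
      {j : Fin (n - 2 + 1)} (hij : i = j) : ArcSwap i hi π σ ↔ YokeShift j u v := by
    rw [hu.arcSwap_iff hv hn hi, yokeShift_iff_psum (yokeTight_arc hn), hij]
  obtain ⟨f, hf⟩ := exists_iso_fromRel_of_biUnique (ArcRel.biTotal hn) (ArcRel.biUnique hn)
    fun π σ u v hu hv => (⟨fun ⟨i, hi, h⟩ => ⟨⟨i, by omega⟩, (hswap hu hv hi rfl).1 h⟩,
      fun ⟨j, h⟩ => ⟨j, by omega, (hswap hu hv _ rfl).2 h⟩⟩ :
        (∃ i hi, ArcSwap i hi π σ) ↔ ∃ j, YokeShift j u v)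
  exact ⟨f, fun π => (hf π).arcCode hn, fun π σ i hi j => hswap (hf π) (hf σ) hi⟩

end ArcPermutations

/-! ### The triangulation of a growing sequence of arcs -/

section Sides
variable {n : ℕ}

lemma isSide_iff {x y : ZMod n} : IsSide s(x, y) ↔ y = x + 1 ∨ x = y + 1 := by
  constructor
  · rintro ⟨a, h⟩
    rcases Sym2.eq_iff.1 h with ⟨rfl, rfl⟩ | ⟨rfl, rfl⟩
    · exact .inl rfl
    · exact .inr rfl
  · rintro (rfl | rfl)
    · exact ⟨x, rfl⟩
    · exact ⟨y, Sym2.eq_swap⟩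

lemma isSide_intCast_iff {x y : ℤ} (h : x < y) (h' : y < x + n) :
    IsSide s((x : ZMod n), (y : ZMod n)) ↔ y = x + 1 ∨ y = x + n - 1 := by
  have hfst : ((y : ZMod n) = x + 1) ↔ y = x + 1 := by
    rw [← intCast_eq_iff (n := n) (by omega) (by omega)]
    push_cast
    rfl
  have hsnd : ((x : ZMod n) = y + 1) ↔ x = y + 1 - n := by
    rw [← intCast_eq_iff (n := n) (by omega) (by omega)]
    push_cast
    rw [ZMod.natCast_self, sub_zero]
  rw [isSide_iff, hfst, hsnd]
  omega

lemma isDiagonal_intCast_iff {x y : ℤ} (h : x < y) (h' : y < x + n) :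
    IsDiagonal s((x : ZMod n), (y : ZMod n)) ↔ y ≠ x + 1 ∧ y ≠ x + n - 1 := by
  rw [IsDiagonal, isSide_intCast_iff h h', Sym2.mk_isDiag_iff, intCast_eq_iff (by omega) (by omega)]
  omega

lemma IsSide.ne (hn : 2 ≤ n) {x y : ZMod n} (h : IsSide s(x, y)) : x ≠ y := by
  rintro rfl
  exact zmod_one_ne_zero hn (left_eq_add.1 (or_self_iff.1 (isSide_iff.1 h)))

end Sides

/-- The chord that cuts off the `i`-th arc `{r_i - i, …, r_i}` from the polygon. -/
def arcChord {n : ℕ} (r : ℕ → ZMod n) (i : ℕ) : Sym2 (ZMod n) := s(r i - i - 1, r i + 1)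

/-- The part of the polygon cut off by `arcChord r i`: the `i`-th arc and the two endpoints of its
chord. -/
def closedArc {n : ℕ} (r : ℕ → ZMod n) (i : ℕ) : Set (ZMod n) := arcSet (r i + 1) (i + 3)

section ArcChords
variable {n : ℕ} {r : ℕ → ZMod n}

lemma arcChord_congr {r' : ℕ → ZMod n} {i : ℕ} (h : r i = r' i) : arcChord r i = arcChord r' i := by
  rw [arcChord, arcChord, h]

lemma arcChord_eq_intCast {i : ℕ} {y : ℤ} (h : r i = (y : ZMod n)) :
    arcChord r i = s(((y - i - 1 : ℤ) : ZMod n), ((y + 1 : ℤ) : ZMod n)) := by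
  rw [arcChord, h]
  push_cast
  rfl

lemma arcChord_eq_intCast_iff {i : ℕ} {x y z : ℤ} (h : r i = (y : ZMod n))
    (hx : y - i - 1 - n < x) (hx' : x < y + 1 + n) (hxi : x < y - i - 1 + n) (hxi' : y + 1 - n < x)
    (hz : y - i - 1 - n < z) (hz' : z < y + 1 + n) (hzi : z < y - i - 1 + n)
    (hzi' : y + 1 - n < z) :
    arcChord r i = s((x : ZMod n), (z : ZMod n)) ↔
      x = y - i - 1 ∧ z = y + 1 ∨ z = y - i - 1 ∧ x = y + 1 := by
  rw [arcChord_eq_intCast h, Sym2.eq_iff, intCast_eq_iff (by omega) (by omega),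
    intCast_eq_iff (by omega) (by omega), intCast_eq_iff (by omega) (by omega),
    intCast_eq_iff (by omega) (by omega)]
  omega

lemma arcChord_succ_of_eq {i : ℕ} (h : r (i + 1) = r i) :
    arcChord r (i + 1) = s(r i - i - 2, r i + 1) := by
  rw [arcChord, h]
  push_cast
  exact Sym2.eq_iff.2 (.inl ⟨by ring, rfl⟩)

lemma arcChord_succ_of_eq_add {i : ℕ} (h : r (i + 1) = r i + 1) :
    arcChord r (i + 1) = s(r i - i - 1, r i + 2) := by
  rw [arcChord, h]
  push_cast
  exact Sym2.eq_iff.2 (.inl ⟨by ring, by ring⟩)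

lemma mem_closedArc_iff {i : ℕ} {x : ZMod n} {y : ℤ} (h : r i = (y : ZMod n)) :
    x ∈ closedArc r i ↔ ∃ w : ℤ, y - i - 1 ≤ w ∧ w ≤ y + 1 ∧ x = (w : ZMod n) := by
  rw [closedArc, h]
  constructor
  · rintro ⟨d, hd, rfl⟩
    exact ⟨y + 1 - d, by omega, by omega, by push_cast; rfl⟩
  · rintro ⟨w, hw, hw', rfl⟩
    obtain ⟨d, hd⟩ := Int.le.dest hw'
    exact ⟨d, by omega, by rw [eq_sub_iff_add_eq]; exact_mod_cast congrArg _ hd⟩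

lemma isDiagonal_arcChord (r : ℕ → ZMod n) {i : ℕ} (hi : i + 4 ≤ n) :
    IsDiagonal (arcChord r i) := by
  obtain ⟨y, hy⟩ := ZMod.intCast_surjective (r i)
  rw [arcChord_eq_intCast hy.symm, isDiagonal_intCast_iff (by omega) (by omega)]
  omega

lemma isShort_arcChord_zero (r : ℕ → ZMod n) : IsShort (arcChord r 0) := ⟨r 0, by simp [arcChord]⟩

lemma natCast_eq_neg_of_add_eq {i k : ℕ} (h : i + k = n) : (i : ZMod n) = -(k : ZMod n) := by
  rw [eq_neg_iff_add_eq_zero, ← Nat.cast_add, h, ZMod.natCast_self]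

lemma isShort_arcChord_of_add_four_eq (r : ℕ → ZMod n) {i : ℕ} (hi : i + 4 = n) :
    IsShort (arcChord r i) := by
  refine ⟨r i + 2, ?_⟩
  rw [arcChord, natCast_eq_neg_of_add_eq hi]
  exact Sym2.eq_iff.2 (.inr ⟨by push_cast; ring, by ring⟩)

namespace IsStepSeq

lemma exists_intCast (hr : IsStepSeq r) {i j : ℕ} (hij : i ≤ j) :
    ∃ (y : ℤ) (e : ℕ), e ≤ j - i ∧ r i = (y : ZMod n) ∧ r j = ((y + e : ℤ) : ZMod n) := by
  obtain ⟨y, hy⟩ := ZMod.intCast_surjective (r i)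
  obtain ⟨e, he, h⟩ := hr.exists_add i (j - i)
  refine ⟨y, e, he, hy.symm, ?_⟩
  rw [← Nat.add_sub_cancel' hij, h, ← hy]
  push_cast
  rfl

lemma not_crosses_arcChord [NeZero n] (hr : IsStepSeq r) {i j : ℕ} (hi : i + 3 ≤ n)
    (hj : j + 3 ≤ n) : ¬ Crosses (arcChord r i) (arcChord r j) := by
  rcases le_total i j with hij | hij <;> obtain ⟨y, e, he, hy, hy'⟩ := hr.exists_intCast hij <;>
    rw [arcChord_eq_intCast hy, arcChord_eq_intCast hy']
  · rw [crosses_intCast_iff (b := y + e - j - 1) (by omega) (by omega) (by omega) (by omega)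
      (by omega) (by omega)]
    omega
  · rw [crosses_intCast_iff (b := y + e - i - 1) (by omega) (by omega) (by omega) (by omega)
      (by omega) (by omega)]
    omega

lemma arcChord_mem_closedArc (hr : IsStepSeq r) {i j : ℕ} (hij : i ≤ j) {x : ZMod n}
    (h : x ∈ arcChord r i) : x ∈ closedArc r j := by
  obtain ⟨y, e, he, hy, hy'⟩ := hr.exists_intCast hij
  rw [arcChord_eq_intCast hy, Sym2.mem_iff] at h
  rw [mem_closedArc_iff hy']
  rcases h with rfl | rfl
  · exact ⟨y - i - 1, by omega, by omega, rfl⟩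
  · exact ⟨y + 1, by omega, by omega, rfl⟩

lemma arcChord_ne_of_mem_closedArc (hr : IsStepSeq r) {i j : ℕ} (hij : i < j) (hj : j + 4 ≤ n)
    {a c : ZMod n} (ha : a ∈ closedArc r i) (hc : c ∈ closedArc r i) : arcChord r j ≠ s(a, c) := by
  obtain ⟨y, e, he, hy, hy'⟩ := hr.exists_intCast hij.le
  obtain ⟨a, ha, ha', rfl⟩ := (mem_closedArc_iff hy).1 ha
  obtain ⟨c, hc, hc', rfl⟩ := (mem_closedArc_iff hy).1 hc
  rw [Ne, arcChord_eq_intCast_iff hy' (by omega) (by omega) (by omega) (by omega) (by omega)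
    (by omega) (by omega) (by omega)]
  omega

lemma arcChord_injective (hr : IsStepSeq r) {i j : ℕ} (hi : i + 4 ≤ n) (hj : j + 4 ≤ n)
    (h : arcChord r i = arcChord r j) : i = j := by
  have hle {i j : ℕ} (hj : j + 4 ≤ n) (h : arcChord r i = arcChord r j) : j ≤ i := by
    by_contra! hij
    exact hr.arcChord_ne_of_mem_closedArc hij hj (hr.arcChord_mem_closedArc le_rfl
      (Sym2.mem_mk_left _ _)) (hr.arcChord_mem_closedArc le_rfl (Sym2.mem_mk_right _ _)) h.symm
  exact le_antisymm (hle hi h.symm) (hle hj h)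

end IsStepSeq

end ArcChords

section Snake
variable {n : ℕ} {r : ℕ → ZMod n}

lemma arcChord_zero_eq_of_mem_closedArc {x w : ZMod n} (hn : 3 ≤ n) (hx : x ∈ closedArc r 0)
    (hw : w ∈ closedArc r 0) (hd : IsDiagonal s(x, w)) : 4 ≤ n ∧ arcChord r 0 = s(x, w) := by
  obtain ⟨y, hy⟩ := ZMod.intCast_surjective (r 0)
  obtain ⟨x, hx₁, hx₂, rfl⟩ := (mem_closedArc_iff hy.symm).1 hx
  obtain ⟨w, hw₁, hw₂, rfl⟩ := (mem_closedArc_iff hy.symm).1 hw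
  rw [arcChord_eq_intCast_iff hy.symm (by omega) (by omega) (by omega) (by omega) (by omega)
    (by omega) (by omega) (by omega)]
  rcases lt_trichotomy x w with h | rfl | h
  · rw [isDiagonal_intCast_iff h (by omega)] at hd
    omega
  · exact absurd rfl hd.1
  · rw [Sym2.eq_swap, isDiagonal_intCast_iff h (by omega)] at hd
    omega

namespace IsStepSeq

lemma eq_of_notMem_closedArc (hr : IsStepSeq r) {i : ℕ} {x w : ZMod n}
    (hx : x ∈ closedArc r (i + 1)) (hw : w ∈ closedArc r (i + 1)) (hx' : x ∉ closedArc r i)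
    (hw' : w ∉ closedArc r i) : x = w := by
  obtain ⟨y, e, he, hy, hy'⟩ := hr.exists_intCast i.le_succ
  obtain ⟨x, hx₁, hx₂, rfl⟩ := (mem_closedArc_iff hy').1 hx
  obtain ⟨w, hw₁, hw₂, rfl⟩ := (mem_closedArc_iff hy').1 hw
  have hout {z : ℤ} (hz : (z : ZMod n) ∉ closedArc r i) : ¬ (y - i - 1 ≤ z ∧ z ≤ y + 1) :=
    fun h => hz ((mem_closedArc_iff hy).2 ⟨z, h.1, h.2, rfl⟩)
  have hxout := hout hx'
  have hwout := hout hw'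
  rw [show x = w by omega]

lemma arcChord_succ_eq_of_notMem_closedArc [NeZero n] (hr : IsStepSeq r) {i : ℕ} (hi : i + 4 ≤ n)
    {x w : ZMod n} (hx : x ∈ closedArc r (i + 1)) (hx' : x ∉ closedArc r i)
    (hw : w ∈ closedArc r i) (hd : IsDiagonal s(x, w)) (hc : ¬ Crosses (arcChord r i) s(x, w)) :
    i + 5 ≤ n ∧ arcChord r (i + 1) = s(x, w) := by
  obtain ⟨y, e, he, hy, hy'⟩ := hr.exists_intCast i.le_succ
  obtain ⟨x, hx₁, hx₂, rfl⟩ := (mem_closedArc_iff hy').1 hx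
  obtain ⟨w, hw₁, hw₂, rfl⟩ := (mem_closedArc_iff hy).1 hw
  have hx₃ : ¬ (y - i - 1 ≤ x ∧ x ≤ y + 1) := fun h =>
    hx' ((mem_closedArc_iff hy).2 ⟨x, h.1, h.2, rfl⟩)
  rw [arcChord_eq_intCast hy] at hc
  rw [arcChord_eq_intCast_iff hy' (by omega) (by omega) (by omega) (by omega) (by omega)
    (by omega) (by omega) (by omega)]
  rcases (by omega : e = 0 ∨ e = 1) with rfl | rfl
  · rw [crosses_intCast_iff (b := y - i - 2) (by omega) (by omega) (by omega) (by omega)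
      (by omega) (by omega)] at hc
    rw [isDiagonal_intCast_iff (by omega) (by omega)] at hd
    omega
  · rw [Sym2.eq_swap (a := (x : ZMod n)), crosses_intCast_iff (b := y - i - 1) (by omega)
      (by omega) (by omega) (by omega) (by omega) (by omega)] at hc
    rw [Sym2.eq_swap (a := (x : ZMod n)), isDiagonal_intCast_iff (by omega) (by omega)] at hd
    omega

lemma exists_arcChord_eq [NeZero n] (hr : IsStepSeq r) {i : ℕ} (hi : i + 3 ≤ n) {x w : ZMod n}
    (hx : x ∈ closedArc r i) (hw : w ∈ closedArc r i) (hd : IsDiagonal s(x, w))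
    (hc : ∀ j < i, ¬ Crosses (arcChord r j) s(x, w)) :
    ∃ j ≤ i, j + 4 ≤ n ∧ arcChord r j = s(x, w) := by
  induction i with
  | zero => exact ⟨0, le_rfl, arcChord_zero_eq_of_mem_closedArc hi hx hw hd⟩
  | succ i ih =>
    by_cases hx' : x ∈ closedArc r i <;> by_cases hw' : w ∈ closedArc r i
    · obtain ⟨j, hj, h⟩ := ih (by omega) hx' hw' fun j hj => hc j (by omega)
      exact ⟨j, hj.trans i.le_succ, h⟩
    · rw [Sym2.eq_swap] at hd hc ⊢
      exact ⟨i + 1, le_rfl, hr.arcChord_succ_eq_of_notMem_closedArc (by omega) hw hw' hx' hd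
        (hc i i.lt_succ_self)⟩
    · exact ⟨i + 1, le_rfl, hr.arcChord_succ_eq_of_notMem_closedArc (by omega) hx hx' hw' hd
        (hc i i.lt_succ_self)⟩
    · exact absurd (hr.eq_of_notMem_closedArc hx hw hx' hw') hd.1

lemma isTriangulation_arcChord [NeZero n] (hr : IsStepSeq r) (hn : 3 ≤ n) :
    IsTriangulation (Set.range fun i : Fin (n - 3) => arcChord r i) := by
  refine ⟨⟨?_, ?_⟩, ?_⟩
  · rintro _ ⟨i, rfl⟩
    exact isDiagonal_arcChord r (by omega)
  · rintro _ ⟨i, rfl⟩ _ ⟨j, rfl⟩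
    exact hr.not_crosses_arcChord (by omega) (by omega)
  · rintro S ⟨hdiag, hcross⟩ hTS ⟨x, w⟩ he
    have huniv : closedArc r (n - 3) = Set.univ := arcSet_eq_univ _ (by omega)
    obtain ⟨j, -, hj, h⟩ := hr.exists_arcChord_eq (i := n - 3) (by omega) (huniv ▸ Set.mem_univ x)
      (huniv ▸ Set.mem_univ w) (hdiag _ he) fun j hj => hcross _ (hTS ⟨⟨j, hj⟩, rfl⟩) _ he
    exact ⟨⟨j, by omega⟩, h⟩

lemma arcChord_ne_of_lt_of_lt (hr : IsStepSeq r) {i j l : ℕ} (hil : i < l) (hjl : j < l)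
    (hl : l + 4 ≤ n) {a b c : ZMod n} (hi : arcChord r i = s(a, b)) (hj : arcChord r j = s(b, c)) :
    arcChord r l ≠ s(a, c) :=
  hr.arcChord_ne_of_mem_closedArc (max_lt hil hjl) hl
    (hr.arcChord_mem_closedArc (le_max_left i j) (hi ▸ Sym2.mem_mk_left a b))
    (hr.arcChord_mem_closedArc (le_max_right i j) (hj ▸ Sym2.mem_mk_right b c))

/-- The chord with the largest index among three would join two vertices of an earlier arc. -/
lemma isTriangleFree_arcChord (hr : IsStepSeq r) :
    IsTriangleFree (Set.range fun i : Fin (n - 3) => arcChord r i) := by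
  rintro ⟨a, b, c, ⟨⟨i, hi⟩, hab⟩, ⟨⟨j, hj⟩, hbc⟩, ⟨⟨l, hl⟩, hac⟩⟩
  change arcChord r i = _ at hab
  change arcChord r j = _ at hbc
  change arcChord r l = _ at hac
  have hba := hab.trans Sym2.eq_swap
  have hcb := hbc.trans Sym2.eq_swap
  have hne {i : ℕ} (hi : i < n - 3) {x y : ZMod n} (h : arcChord r i = s(x, y)) : x ≠ y := by
    have := (isDiagonal_arcChord r (i := i) (by omega)).1
    rwa [h, Sym2.mk_isDiag_iff] at this
  have hij : i ≠ j := by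
    rintro rfl
    exact hne hl hac (Sym2.congr_right.1 (hba.symm.trans hbc))
  have hil : i ≠ l := by
    rintro rfl
    exact hne hj hbc (Sym2.congr_right.1 (hab.symm.trans hac))
  have hjl : j ≠ l := by
    rintro rfl
    exact hne hi hab (Sym2.congr_left.1 (hac.symm.trans hbc))
  rcases (by omega : i < l ∧ j < l ∨ i < j ∧ l < j ∨ j < i ∧ l < i) with h | h | h
  · exact hr.arcChord_ne_of_lt_of_lt h.1 h.2 (by omega) hab hbc hac
  · exact hr.arcChord_ne_of_lt_of_lt h.1 h.2 (by omega) hba hac hbc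
  · exact hr.arcChord_ne_of_lt_of_lt h.2 h.1 (by omega) hac hcb hab

lemma exists_isTriangleOf_arcChord_succ (hr : IsStepSeq r) {T : Set (Sym2 (ZMod n))} {i : ℕ}
    (hi : arcChord r i ∈ T) (hi' : arcChord r (i + 1) ∈ T) :
    ∃ a b c, IsTriangleOf T a b c ∧ arcChord r i = s(a, b) ∧ arcChord r (i + 1) = s(b, c) := by
  rcases hr i with h | h
  · have hfst : arcChord r i = s(r i - i - 1, r i + 1) := rfl
    have hsnd := (arcChord_succ_of_eq h).trans Sym2.eq_swap
    exact ⟨_, _, _, ⟨.inl (hfst ▸ hi), .inl (hsnd ▸ hi'), .inr (isSide_iff.2 (.inr (by ring)))⟩,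
      hfst, hsnd⟩
  · have hfst : arcChord r i = s(r i + 1, r i - i - 1) := Sym2.eq_swap
    have hsnd := arcChord_succ_of_eq_add h
    exact ⟨_, _, _, ⟨.inl (hfst ▸ hi), .inl (hsnd ▸ hi'), .inr (isSide_iff.2 (.inl (by ring)))⟩,
      hfst, hsnd⟩

end IsStepSeq

/-- The colored triangle-free triangulation whose chords cut off the arcs of a growing sequence. -/
def ctftOfStepSeq (hn : 3 ≤ n) (hr : IsStepSeq r) : CTFT n :=
  have : NeZero n := ⟨by omega⟩
  { chord := fun i => arcChord r i
    injective := fun i j h => Fin.ext (hr.arcChord_injective (by omega) (by omega) h)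
    triangulation := hr.isTriangulation_arcChord hn
    triangleFree := hr.isTriangleFree_arcChord
    short_first := fun i hi => by rw [hi]; exact isShort_arcChord_zero r
    short_last := fun i hi => isShort_arcChord_of_add_four_eq r (by omega)
    consecutive := fun i j hij => by
      rw [← hij]
      exact hr.exists_isTriangleOf_arcChord_succ ⟨i, rfl⟩ ⟨j, congrArg _ hij.symm⟩ }

end Snake

/-! ### Colored triangle-free triangulations -/

/-- The chords of the triangulation `C` cut off the arcs encoded by the partial sums of `v`. -/
def CTFTRel {n : ℕ} (C : CTFT n) (v : YokeVertex n (n - 4)) : Prop :=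
  ∀ i : Fin (n - 3), C.chord i = arcChord v.psum i

section ArcChordDeterminesArc
variable {n : ℕ} {r r' : ℕ → ZMod n}

lemma eq_of_arcChord_eq {i : ℕ} (hi : i + 4 ≤ n)
    (hd : r i = r' i ∨ r i = r' i + 1 ∨ r' i = r i + 1) (h : arcChord r i = arcChord r' i) :
    r i = r' i := by
  rcases Sym2.eq_iff.1 h with ⟨-, h⟩ | ⟨h, -⟩
  · exact add_right_cancel h
  · rcases hd with hd | hd | hd
    · exact hd
    · refine absurd ?_ (natCast_ne_zero_of_lt (n := n) (k := i + 1) (by omega) (by omega))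
      push_cast
      linear_combination hd - h
    · refine absurd ?_ (natCast_ne_zero_of_lt (n := n) (k := i + 3) (by omega) (by omega))
      push_cast
      linear_combination -h - hd

lemma eq_of_arcChord_eq_of_short (hn : 5 ≤ n) {i : ℕ} (hi : i = 0 ∨ i + 4 = n)
    (h : arcChord r i = arcChord r' i) : r i = r' i := by
  rcases Sym2.eq_iff.1 h with ⟨-, h⟩ | ⟨h, h'⟩
  · exact add_right_cancel h
  · refine absurd ?_ (natCast_ne_zero_of_lt (n := n) (k := 4) (by omega) (by omega))
    rcases hi with rfl | hi
    · push_cast at h h' ⊢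
      linear_combination h' - h
    · have hneg := natCast_eq_neg_of_add_eq hi
      push_cast at hneg ⊢
      linear_combination 2 * hneg - h' + h

namespace IsStepSeq

lemma succ_close (hr : IsStepSeq r) (hr' : IsStepSeq r') {i : ℕ} (h : r i = r' i) :
    r (i + 1) = r' (i + 1) ∨ r (i + 1) = r' (i + 1) + 1 ∨ r' (i + 1) = r (i + 1) + 1 := by
  rcases hr i with hi | hi <;> rcases hr' i with hi' | hi' <;> rw [hi, hi', h] <;> simp

lemma close_of_succ_eq (hr : IsStepSeq r) (hr' : IsStepSeq r') {i : ℕ}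
    (h : r (i + 1) = r' (i + 1)) : r i = r' i ∨ r i = r' i + 1 ∨ r' i = r i + 1 := by
  rcases hr i with hi | hi <;> rcases hr' i with hi' | hi' <;> rw [hi, hi'] at h
  · exact .inl h
  · exact .inr (.inl h)
  · exact .inr (.inr h.symm)
  · exact .inl (add_right_cancel h)

lemma eq_of_arcChord_eq_of_le (hr : IsStepSeq r) (hr' : IsStepSeq r') (hn : 5 ≤ n) {i : ℕ}
    (hi : i + 4 ≤ n) (h : ∀ j ≤ i, arcChord r j = arcChord r' j) : r i = r' i := by
  induction i with
  | zero => exact eq_of_arcChord_eq_of_short hn (.inl rfl) (h 0 le_rfl)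
  | succ i ih =>
    have hprev := ih (by omega) fun j hj => h j (by omega)
    exact eq_of_arcChord_eq hi (hr.succ_close hr' hprev) (h _ le_rfl)

lemma eq_of_arcChord_eq_of_ge (hr : IsStepSeq r) (hr' : IsStepSeq r') (hn : 5 ≤ n) {i : ℕ}
    (hi : i + 4 ≤ n) (h : ∀ j ≥ i, j + 4 ≤ n → arcChord r j = arcChord r' j) : r i = r' i := by
  induction hk : n - 4 - i generalizing i with
  | zero => exact eq_of_arcChord_eq_of_short hn (.inr (by omega)) (h i le_rfl hi)
  | succ k ih =>
    have hnext := ih (i := i + 1) (by omega) (fun j hj => h j (by omega)) (by omega)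
    exact eq_of_arcChord_eq hi (hr.close_of_succ_eq hr' hnext) (h i le_rfl hi)

end IsStepSeq

end ArcChordDeterminesArc

section ChordsOfTriangulation
variable {n : ℕ} {C D : CTFT n}

namespace CTFT

lemma exists_chord_eq (C : CTFT n) {i j : Fin (n - 3)} (hij : i.val + 1 = j.val) :
    ∃ a b c : ZMod n, C.chord i = s(a, b) ∧ C.chord j = s(b, c) ∧ (c = a + 1 ∨ c = a - 1) := by
  obtain ⟨a, b, c, ⟨-, -, hac⟩, hi, hj⟩ := C.consecutive i j hij
  refine ⟨a, b, c, hi, hj, ?_⟩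
  rcases hac with hac | hac
  · exact absurd ⟨a, b, c, hi ▸ ⟨i, rfl⟩, hj ▸ ⟨j, rfl⟩, hac⟩ C.triangleFree
  · exact (isSide_iff.1 hac).imp_right fun h => eq_sub_of_add_eq h.symm

lemma chord_notMem_closedArc (C : CTFT n) {r : ℕ → ZMod n} (hr : IsStepSeq r) {k : ℕ}
    (hk : k + 1 < n - 3) (h : ∀ (i : ℕ) (hi : i ≤ k), C.chord ⟨i, by omega⟩ = arcChord r i)
    {x w : ZMod n} (hx : x ∈ closedArc r k) (hw : w ∈ closedArc r k) :
    C.chord ⟨k + 1, hk⟩ ≠ s(x, w) := by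
  intro hxw
  have : NeZero n := ⟨by omega⟩
  obtain ⟨hdiag, hcross⟩ := C.triangulation.prop
  obtain ⟨j, hj, -, hjxw⟩ := hr.exists_arcChord_eq (by omega) hx hw (hdiag _ ⟨⟨k + 1, hk⟩, hxw⟩)
    fun j hj => hcross _ ⟨⟨j, by omega⟩, h j hj.le⟩ _ ⟨⟨k + 1, hk⟩, hxw⟩
  rw [← hxw, ← h j hj] at hjxw
  exact absurd (Fin.mk.inj (C.injective hjxw)) (by omega)

/-- The chord with label `k + 1` shares an endpoint with the chord with label `k`, and its other
endpoint is a neighbour of the other one. Two of the four such chords stay inside the part of the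
polygon that is already triangulated. -/
lemma exists_chord_succ_eq (C : CTFT n) {r : ℕ → ZMod n} (hr : IsStepSeq r) {k : ℕ}
    (hk : k + 1 < n - 3) (h : ∀ (i : ℕ) (hi : i ≤ k), C.chord ⟨i, by omega⟩ = arcChord r i) :
    ∃ x, (x = r k ∨ x = r k + 1) ∧ C.chord ⟨k + 1, hk⟩ = s(x - (k + 1 : ℕ) - 1, x + 1) := by
  obtain ⟨a, b, c, hab, hbc, hc⟩ := C.exists_chord_eq (i := ⟨k, by omega⟩) (j := ⟨k + 1, hk⟩) rfl
  have hnot {d e : ℕ} (hd : d < k + 3) (he : e < k + 3) :=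
    C.chord_notMem_closedArc hr hk h ⟨d, hd, rfl⟩ ⟨e, he, rfl⟩
  rw [h k le_rfl, arcChord, Sym2.eq_iff] at hab
  rcases hab with ⟨rfl, rfl⟩ | ⟨rfl, rfl⟩ <;> rcases hc with rfl | rfl
  · refine absurd (hbc.trans (Sym2.eq_iff.2 (.inl ⟨?_, ?_⟩)))
      (hnot (d := 0) (e := k + 1) (by omega) (by omega)) <;> push_cast <;> ring
  · refine ⟨r k, .inl rfl, hbc.trans (Sym2.eq_iff.2 (.inr ⟨rfl, ?_⟩))⟩
    push_cast
    ring
  · refine ⟨r k + 1, .inr rfl, hbc.trans (Sym2.eq_iff.2 (.inl ⟨?_, rfl⟩))⟩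
    push_cast
    ring
  · refine absurd (hbc.trans (Sym2.eq_iff.2 (.inl ⟨?_, ?_⟩)))
      (hnot (d := k + 2) (e := 1) (by omega) (by omega)) <;> push_cast <;> ring

lemma exists_isStepSeq (C : CTFT n) {k : ℕ} (hk : k < n - 3) : ∃ r : ℕ → ZMod n, IsStepSeq r ∧
    ∀ (i : ℕ) (hi : i ≤ k), C.chord ⟨i, by omega⟩ = arcChord r i := by
  induction k with
  | zero =>
    obtain ⟨a, ha⟩ := C.short_first ⟨0, hk⟩ rfl
    refine ⟨fun _ => a, fun _ => .inl rfl, fun i hi => ?_⟩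
    obtain rfl := Nat.le_zero.1 hi
    simp [ha, arcChord]
  | succ k ih =>
    obtain ⟨r, hr, h⟩ := ih (by omega)
    obtain ⟨x, hx, hc⟩ := C.exists_chord_succ_eq hr hk h
    refine ⟨fun i => if i ≤ k then r i else x, fun i => ?_, fun i hi => ?_⟩
    · rcases lt_trichotomy i k with hik | rfl | hik
      · simpa only [if_pos (show i + 1 ≤ k from hik), if_pos hik.le] using hr i
      · simpa only [if_pos le_rfl, if_neg (Nat.not_succ_le_self i)] using hx
      · exact .inl (by simp only [if_neg (show ¬ i ≤ k by omega),
          if_neg (show ¬ i + 1 ≤ k by omega)])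
    · rcases Nat.le_succ_iff.1 hi with hik | rfl
      · exact (h i hik).trans (arcChord_congr (if_pos hik).symm)
      · rw [hc, arcChord, if_neg (Nat.not_succ_le_self k)]

lemma ext_chord (h : C.chord = D.chord) : C = D := by
  cases C
  cases D
  congr

end CTFT

namespace CTFTRel
variable {u v : YokeVertex n (n - 4)}

lemma biTotal (hn : 5 ≤ n) : Relator.BiTotal (CTFTRel (n := n)) := by
  refine ⟨fun C => ?_, fun v => ⟨ctftOfStepSeq (by omega) (isStepSeq_psum v), fun _ => rfl⟩⟩
  obtain ⟨r, hr, h⟩ := C.exists_isStepSeq (k := n - 4) (by omega)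
  obtain ⟨v, hv⟩ := exists_psum_eq (m := n - 4) (by omega) fun i _ => hr i
  refine ⟨v, fun i => ?_⟩
  rw [h i (by omega)]
  exact arcChord_congr (hv i (by omega)).symm

lemma biUnique (hn : 5 ≤ n) : Relator.BiUnique (CTFTRel (n := n)) :=
  ⟨fun _ _ _ h h' => CTFT.ext_chord (funext fun i => (h i).trans (h' i).symm),
    fun _ u v hu hv => eq_of_psum_eq (by omega) fun _ _ =>
      (isStepSeq_psum u).eq_of_arcChord_eq_of_le (isStepSeq_psum v) hn (by omega) fun j _ =>
        (hu ⟨j, by omega⟩).symm.trans (hv ⟨j, by omega⟩)⟩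

lemma ctftCode (h : CTFTRel C v) : CTFTCode C v := by
  refine ⟨fun i => v.psum i - i - 1, fun i => v.psum i + 1, h, ?_, by simp only [psum_zero], ?_⟩
  · simp only [psum_zero, Nat.cast_zero, sub_zero]
  · rintro ⟨_ | i, hi⟩ h1 h2
    · exact absurd h1 (by simp)
    simp only [add_tsub_cancel_right]
    rcases psum_step v h2 with ⟨hv, hs⟩ | ⟨hv, hs⟩ <;> rw [hs]
    · exact .inl ⟨hv, by push_cast; ring, rfl⟩
    · exact .inr ⟨hv, by push_cast; ring, rfl⟩

end CTFTRel

end ChordsOfTriangulation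

/-! ### Flips of colored triangle-free triangulations -/

section Flips
variable {n : ℕ} {T : Set (Sym2 (ZMod n))}

lemma isOtherDiagonal_of_quadrilateral {a b c d : ZMod n} (hbd : b ≠ d) (hac : s(a, c) ∈ T)
    (hab : s(a, b) ∈ T ∨ IsSide s(a, b)) (hbc : s(b, c) ∈ T ∨ IsSide s(b, c))
    (hcd : s(c, d) ∈ T ∨ IsSide s(c, d)) (had : s(a, d) ∈ T ∨ IsSide s(a, d)) :
    IsOtherDiagonal T s(a, c) s(b, d) :=
  ⟨a, b, c, d, rfl, rfl, hbd, ⟨hab, hbc, .inl hac⟩, ⟨had, Sym2.eq_swap ▸ hcd, .inl hac⟩⟩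

lemma IsOtherDiagonal.ne (hn : 2 ≤ n) (hT : ∀ e ∈ T, IsDiagonal e) {e e' : Sym2 (ZMod n)}
    (h : IsOtherDiagonal T e e') : e ≠ e' := by
  obtain ⟨a, b, c, d, rfl, rfl, -, ⟨hab, hbc, -⟩, -⟩ := h
  have hne {x y : ZMod n} (h : s(x, y) ∈ T ∨ IsSide s(x, y)) : x ≠ y := by
    rcases h with h | h
    · rintro rfl
      exact (hT _ h).1 rfl
    · exact h.ne hn
  intro h
  rcases Sym2.eq_iff.1 h with ⟨h, -⟩ | ⟨-, h⟩
  · exact hne hab h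
  · exact hne hbc h.symm

namespace IsStepSeq
variable {r r' : ℕ → ZMod n}

/-- The quadrilateral has the vertices `x - i - 1`, `x - i`, `x + 1`, `x + 2`, where `x = r' i`. -/
lemma isOtherDiagonal_arcChord (hr : IsStepSeq r) (hr' : IsStepSeq r') {i : ℕ} (hi : i + 4 ≤ n)
    (h : r i = r' i + 1) (hne : ∀ j, j + 4 ≤ n → j ≠ i → r j = r' j)
    (hT : ∀ j, j + 4 ≤ n → j ≠ i → arcChord r j ∈ T) :
    (arcChord r i ∈ T → IsOtherDiagonal T (arcChord r i) (arcChord r' i)) ∧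
      (arcChord r' i ∈ T → IsOtherDiagonal T (arcChord r' i) (arcChord r i)) := by
  have hfst : s(r' i - (i : ZMod n), r' i + 1) ∈ T ∨ IsSide s(r' i - (i : ZMod n), r' i + 1) := by
    rcases i with _ | i
    · right
      simpa using isSide_iff.2 (.inl rfl)
    · left
      have hri := hr.eq_of_succ_eq_add_one hr' (by omega) (hne i (by omega) (by omega)) h
      convert hT i (by omega) (by omega) using 1
      rw [arcChord, hri]
      push_cast
      exact Sym2.eq_iff.2 (.inl ⟨by ring, rfl⟩)
  have hsnd : s(r' i - (i : ZMod n) - 1, r' i + 2) ∈ T ∨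
      IsSide s(r' i - (i : ZMod n) - 1, r' i + 2) := by
    rcases (by omega : i + 4 = n ∨ i + 5 ≤ n) with hin | hin
    · refine .inr (isSide_iff.2 (.inr ?_))
      rw [natCast_eq_neg_of_add_eq hin]
      push_cast
      ring
    · left
      have hri := hr.succ_eq_of_eq_add_one hr' (by omega) (hne (i + 1) hin (by omega)) h
      convert hT (i + 1) hin (by omega) using 1
      rw [arcChord_succ_of_eq hri, h]
      exact Sym2.eq_iff.2 (.inl ⟨by ring, by ring⟩)
  have hleft : IsSide s(r' i - (i : ZMod n) - 1, r' i - (i : ZMod n)) :=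
    isSide_iff.2 (.inl (by ring))
  have hright : IsSide s(r' i + 1, r' i + 2) := isSide_iff.2 (.inl (by ring))
  have hi2 := natCast_ne_zero_of_lt (n := n) (k := i + 2) (by omega) (by omega)
  push_cast at hi2
  have hri : arcChord r i = s(r' i - (i : ZMod n), r' i + 2) := by
    rw [arcChord, h]
    exact Sym2.eq_iff.2 (.inl ⟨by ring, by ring⟩)
  rw [hri, arcChord]
  constructor <;> intro hmem
  · exact isOtherDiagonal_of_quadrilateral (fun h => hi2 (by linear_combination -h)) hmem
      (.inr (Sym2.eq_swap ▸ hleft)) hsnd (.inr (Sym2.eq_swap ▸ hright)) hfst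
  · exact isOtherDiagonal_of_quadrilateral (fun h => hi2 (by linear_combination -h)) hmem
      (.inr hleft) hfst (.inr hright) hsnd

end IsStepSeq

lemma yokeTight_ctft (hn : 5 ≤ n) : YokeTight n (n - 4) := ⟨by omega, by omega⟩

namespace CTFTRel
variable {C D : CTFT n} {u v : YokeVertex n (n - 4)}

lemma psum_eq_iff_of_ctftFlip (hu : CTFTRel C u) (hv : CTFTRel D v) (hn : 5 ≤ n) {i : Fin (n - 3)}
    (h : CTFTFlip i C D) {j : ℕ} (hj : j ≤ n - 4) : u.psum j = v.psum j ↔ j ≠ i := by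
  have hchord {k : ℕ} (hk : k + 4 ≤ n) (hki : k ≠ i) : arcChord u.psum k = arcChord v.psum k := by
    rw [← hu ⟨k, by omega⟩, ← hv ⟨k, by omega⟩]
    exact h.1 _ fun h' => hki (congrArg Fin.val h')
  constructor
  · rintro hj rfl
    refine h.2.ne (by omega) C.triangulation.prop.1 ?_
    rw [hu i, hv i, arcChord_congr hj]
  · intro hji
    rcases lt_or_gt_of_ne hji with hji | hji
    · exact (isStepSeq_psum u).eq_of_arcChord_eq_of_le (isStepSeq_psum v) hn (by omega)
        fun k hk => hchord (by omega) (by omega)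
    · exact (isStepSeq_psum u).eq_of_arcChord_eq_of_ge (isStepSeq_psum v) hn (by omega)
        fun k hk hkn => hchord hkn (by omega)

lemma ctftFlip_iff (hu : CTFTRel C u) (hv : CTFTRel D v) (hn : 5 ≤ n) {i : Fin (n - 3)} :
    CTFTFlip i C D ↔ ∀ j ≤ n - 4, u.psum j = v.psum j ↔ j ≠ i := by
  refine ⟨fun h j => psum_eq_iff_of_ctftFlip hu hv hn h, fun h => ?_⟩
  have hne (j : ℕ) (hj : j + 4 ≤ n) (hji : j ≠ i) : u.psum j = v.psum j :=
    (h j (by omega)).2 hji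
  have hmem (j : ℕ) (hj : j + 4 ≤ n) : arcChord u.psum j ∈ Set.range C.chord :=
    ⟨⟨j, by omega⟩, hu _⟩
  have hi : i + 4 ≤ n := by omega
  refine ⟨fun j hji => ?_, ?_⟩
  · rw [hu j, hv j, arcChord_congr (hne j (by omega) fun h' => hji (Fin.ext h'))]
  · rw [hu i, hv i]
    rcases psum_eq_add_one_or (yokeTight_ctft hn) (by omega) h with hs | hs
    · exact ((isStepSeq_psum u).isOtherDiagonal_arcChord (isStepSeq_psum v) hi hs hne
        fun j hj _ => hmem j hj).1 (hmem i hi)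
    · refine ((isStepSeq_psum v).isOtherDiagonal_arcChord (isStepSeq_psum u) hi hs
        (fun j hj hji => (hne j hj hji).symm) fun j hj hji => ?_).2 (hmem i hi)
      rw [← arcChord_congr (hne j hj hji)]
      exact hmem j hj

end CTFTRel

theorem exists_ctftGraph_iso (hn : 5 ≤ n) : ∃ g : ctftGraph n ≃g yokeGraph n (n - 4),
    (∀ T : CTFT n, CTFTCode T (g T)) ∧
      ∀ (T T' : CTFT n) (i : Fin (n - 3)) (j : Fin (n - 4 + 1)), i.val = j.val →
        (CTFTFlip i T T' ↔ YokeShift j (g T) (g T')) := by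
  have hflip ⦃C D : CTFT n⦄ ⦃u v⦄ (hu : CTFTRel C u) (hv : CTFTRel D v) {i : Fin (n - 3)}
      {j : Fin (n - 4 + 1)} (hij : i.val = j) : CTFTFlip i C D ↔ YokeShift j u v := by
    rw [hu.ctftFlip_iff hv hn, yokeShift_iff_psum (yokeTight_ctft hn), hij]
  obtain ⟨g, hg⟩ := exists_iso_fromRel_of_biUnique (CTFTRel.biTotal hn) (CTFTRel.biUnique hn)
    fun C D u v hu hv => (⟨fun ⟨i, h⟩ => ⟨⟨i, by omega⟩, (hflip hu hv rfl).1 h⟩,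
      fun ⟨j, h⟩ => ⟨⟨j, by omega⟩, (hflip hu hv rfl).2 h⟩⟩ :
        (∃ i, CTFTFlip i C D) ↔ ∃ j, YokeShift j u v)
  exact ⟨g, fun T => (hg T).ctftCode, fun T T' i j => hflip (hg T) (hg T')⟩

end Flips

/-! ### The tree of a growing sequence of arcs -/

section Noncrossing
variable {n : ℕ} {e f : Sym2 (ZMod n)}

lemma Crosses.symm [NeZero n] (h : Crosses e f) : Crosses f e := by
  obtain ⟨a, b, c, d, rfl, rfl, hacb, hbda⟩ := h
  rw [sbtw_iff_val_lt] at hacb hbda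
  refine ⟨c, d, b, a, rfl, Sym2.eq_swap, ?_, ?_⟩ <;> rw [sbtw_iff_val_lt] <;> omega

lemma not_crosses_self (e : Sym2 (ZMod n)) : ¬ Crosses e e := by
  rintro ⟨a, b, c, d, rfl, he, hacb, -⟩
  rcases Sym2.eq_iff.1 he with ⟨rfl, -⟩ | ⟨-, rfl⟩
  · exact sbtw_irrefl_left hacb
  · exact sbtw_irrefl_right hacb

lemma not_crosses_of_mem_arcSet [NeZero n] {x y a w : ZMod n} {k : ℕ} (hk : k ≤ n)
    (hx : x ∈ arcSet a k) (hy : y ∈ arcSet a k) (hw : w ∉ arcSet a k) :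
    ¬ Crosses s(x, y) s(a, w) := by
  obtain ⟨d, hd, rfl⟩ := hx
  obtain ⟨d', hd', rfl⟩ := hy
  obtain ⟨t, ht, rfl⟩ := exists_eq_sub_natCast a w
  rw [sub_mem_arcSet_iff ht hk] at hw
  obtain ⟨z, rfl⟩ := ZMod.intCast_surjective a
  wlog hdd : d' ≤ d generalizing d d'
  · rw [Sym2.eq_swap]
    exact this d' hd' d hd (le_of_not_ge hdd)
  have hcast (m : ℕ) : (z : ZMod n) - (m : ZMod n) = ((z - m : ℤ) : ZMod n) := by push_cast; rfl
  rw [hcast, hcast, hcast, Sym2.eq_swap (a := (z : ZMod n)),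
    crosses_intCast_iff (b := z - n + 1) (by omega) (by omega) (by omega) (by omega) (by omega)
      (by omega)]
  omega

end Noncrossing

/-- The edge that joins the vertex entering the arc of index `j + 1` to the right end of the
previous arc. -/
def arcEdge {n : ℕ} (r : ℕ → ZMod n) (j : ℕ) : Sym2 (ZMod n) := s(r j, arcVertex r (j + 1))

/-- The graph in which every vertex that enters the growing arc is joined to the right end of
the previous arc. When `r` starts with an increment `1`, this is the caterpillar that the
sequence encodes. -/
def arcTree {n : ℕ} (r : ℕ → ZMod n) : SimpleGraph (ZMod n) :=
  SimpleGraph.fromEdgeSet (arcEdge r '' Set.Iio (n - 1))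

section ArcTree
variable {n : ℕ} {r : ℕ → ZMod n}

lemma arcEdge_of_eq {j : ℕ} (h : r (j + 1) = r j) :
    arcEdge r j = s(r j, r j - ((j + 1 : ℕ) : ZMod n)) := by
  rw [arcEdge, arcVertex_succ_of_eq h]

lemma arcEdge_of_eq_add (hn : 2 ≤ n) {j : ℕ} (h : r (j + 1) = r j + 1) :
    arcEdge r j = s(r j, r j + 1) := by
  rw [arcEdge, arcVertex_succ_of_eq_add hn h]

namespace IsStepSeq

lemma arcEdge_last (hr : IsStepSeq r) (hn : 2 ≤ n) {j : ℕ} (hj : j + 2 = n) :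
    arcEdge r j = s(r j, r j + 1) := by
  rcases hr j with h | h
  · rw [arcEdge_of_eq h, add_one_eq_sub_natCast (by omega), show n - 1 = j + 1 by omega]
  · exact arcEdge_of_eq_add hn h

lemma le_of_arcVertex_eq (hr : IsStepSeq r) (hn : 2 ≤ n) {i j : ℕ} (hi : i < n)
    (h : arcVertex r i = r j) : i ≤ j := by
  rw [← hr.arcVertex_mem_iff hn hi, h]
  exact self_mem_arcSet _ _

lemma arcVertex_mem_arcEdge_iff (hr : IsStepSeq r) (hn : 2 ≤ n) {i j : ℕ} (hi : i < n)
    (hj : j + 1 < n) : arcVertex r i ∈ arcEdge r j ↔ i = j + 1 ∨ arcVertex r i = r j := by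
  rw [arcEdge, Sym2.mem_iff, hr.arcVertex_inj hn hi hj, or_comm]

lemma arcEdge_injOn (hr : IsStepSeq r) (hn : 2 ≤ n) : Set.InjOn (arcEdge r) (Set.Iio (n - 1)) := by
  have hle {i j : ℕ} (hi : i ∈ Set.Iio (n - 1)) (hj : j ∈ Set.Iio (n - 1))
      (h : arcEdge r i = arcEdge r j) : i ≤ j := by
    rw [Set.mem_Iio] at hi hj
    have hmem : arcVertex r (i + 1) ∈ arcEdge r j := h ▸ Sym2.mem_mk_right _ _
    rcases (hr.arcVertex_mem_arcEdge_iff hn (by omega) (by omega)).1 hmem with h' | h'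
    · omega
    · have := hr.le_of_arcVertex_eq hn (by omega) h'
      omega
  exact fun i hi j hj h => le_antisymm (hle hi hj h) (hle hj hi h.symm)

lemma edgeSet_arcTree (hr : IsStepSeq r) (hn : 2 ≤ n) :
    (arcTree r).edgeSet = arcEdge r '' Set.Iio (n - 1) := by
  rw [arcTree, SimpleGraph.edgeSet_fromEdgeSet, sdiff_eq_left, Set.disjoint_left]
  rintro _ ⟨j, hj, rfl⟩ (hdiag : r j = arcVertex r (j + 1))
  rw [Set.mem_Iio] at hj
  exact absurd (hr.le_of_arcVertex_eq hn (by omega) hdiag.symm) (by omega)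

lemma arcTree_adj (hr : IsStepSeq r) (hn : 2 ≤ n) {x y : ZMod n} :
    (arcTree r).Adj x y ↔ ∃ j, j + 1 < n ∧ arcEdge r j = s(x, y) := by
  simp only [← SimpleGraph.mem_edgeSet, hr.edgeSet_arcTree hn, Set.mem_image, Set.mem_Iio,
    Nat.lt_sub_iff_add_lt]

lemma connected_arcTree (hr : IsStepSeq r) (hn : 2 ≤ n) : (arcTree r).Connected := by
  have hreach (j : ℕ) : j < n → (arcTree r).Reachable (arcVertex r 0) (arcVertex r j) := by
    induction j using Nat.strong_induction_on with
    | _ j ih =>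
      intro hj
      rcases j with _ | j
      · exact .refl _
      · obtain ⟨k, hk, h⟩ := (hr.mem_arcSet_iff_exists hn).1 (self_mem_arcSet (r j) j)
        exact (h ▸ ih k (by omega) (by omega)).trans
          ((hr.arcTree_adj hn).2 ⟨j, hj, rfl⟩).reachable
  refine (SimpleGraph.connected_iff _).2 ⟨fun x y => ?_, ⟨0⟩⟩
  obtain ⟨i, hi, rfl⟩ := hr.exists_eq_arcVertex hn x
  obtain ⟨j, hj, rfl⟩ := hr.exists_eq_arcVertex hn y
  exact (hreach i hi).symm.trans (hreach j hj)

lemma isTree_arcTree (hr : IsStepSeq r) (hn : 2 ≤ n) : (arcTree r).IsTree := by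
  have : NeZero n := ⟨by omega⟩
  rw [SimpleGraph.isTree_iff_connected_and_card]
  refine ⟨hr.connected_arcTree hn, ?_⟩
  rw [Nat.card_coe_set_eq, hr.edgeSet_arcTree hn, (hr.arcEdge_injOn hn).ncard_image,
    Set.ncard_Iio_nat, Nat.card_zmod]
  omega

lemma isNoncrossing_arcTree (hr : IsStepSeq r) (hn : 2 ≤ n) :
    IsNoncrossing (arcTree r).edgeSet := by
  have : NeZero n := ⟨by omega⟩
  have hnot {i j : ℕ} (hij : i ≤ j) (hj : j < n - 1) : ¬ Crosses (arcEdge r i) (arcEdge r j) := by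
    rcases hij.lt_or_eq with hij | rfl
    · exact not_crosses_of_mem_arcSet (by omega) (hr.mem_arcSet hn hij.le)
        ((hr.arcVertex_mem_iff hn (by omega)).2 hij) (hr.arcVertex_notMem hn (by omega))
    · exact not_crosses_self _
  rw [hr.edgeSet_arcTree hn]
  rintro _ ⟨i, hi, rfl⟩ _ ⟨j, hj, rfl⟩
  rcases le_total i j with h | h
  · exact hnot h hj
  · exact fun hcross => hnot h hi hcross.symm

end IsStepSeq

lemma isLeaf_iff_ncard_incidenceSet {V : Type*} (G : SimpleGraph V) (x : V) :
    IsLeaf G x ↔ (G.incidenceSet x).ncard = 1 := by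
  classical
  have hcard : (G.incidenceSet x).ncard = (G.neighborSet x).ncard :=
    Nat.card_congr (G.incidenceSetEquivNeighborSet x)
  rw [hcard, Set.ncard_eq_one, IsLeaf]
  simp only [ExistsUnique, Set.eq_singleton_iff_unique_mem, SimpleGraph.mem_neighborSet]

/-- The values of `r` at the indices `1, …, n - 2`, with multiplicity. In the tree `arcTree r` the
multiplicity of a vertex is one less than its degree. -/
def spineValues {n : ℕ} (r : ℕ → ZMod n) : Multiset (ZMod n) := (Finset.Icc 1 (n - 2)).val.map r

lemma mem_spineValues_iff {x : ZMod n} :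
    x ∈ spineValues r ↔ ∃ j, (1 ≤ j ∧ j ≤ n - 2) ∧ r j = x := by
  simp only [spineValues, Multiset.mem_map, Finset.mem_val, Finset.mem_Icc]

namespace IsStepSeq

/-- The edge `arcEdge r (i - 1)` joins `arcVertex r i` to the tree that was built before it. For
`i = 0` the truncated index `i - 1 = 0` is the right one, since `arcVertex r 0 = r 0`. -/
lemma arcVertex_mem_arcEdge_iff_eq_pred (hr : IsStepSeq r) (hn : 2 ≤ n) {i j : ℕ} (hi : i < n)
    (hj : j + 1 < n) :
    arcVertex r i ∈ arcEdge r j ↔ j = i - 1 ∨ 1 ≤ j ∧ arcVertex r i = r j := by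
  rw [hr.arcVertex_mem_arcEdge_iff hn hi hj]
  constructor
  · rintro (rfl | h)
    · exact .inl rfl
    · have hle := hr.le_of_arcVertex_eq hn hi h
      rcases j.eq_zero_or_pos with rfl | hpos
      · exact .inl (by omega)
      · exact .inr ⟨hpos, h⟩
  · rintro (rfl | ⟨-, h⟩)
    · rcases i with _ | i
      · exact .inr rfl
      · exact .inl rfl
    · exact .inr h

lemma ncard_incidenceSet_arcTree (hr : IsStepSeq r) (hn : 2 ≤ n) (x : ZMod n) :
    ((arcTree r).incidenceSet x).ncard = (spineValues r).count x + 1 := by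
  obtain ⟨i, hi, rfl⟩ := hr.exists_eq_arcVertex hn x
  set F := (Finset.Icc 1 (n - 2)).filter fun j => arcVertex r i = r j with hF
  have hmem (j : ℕ) : j ∈ insert (i - 1) F ↔ j < n - 1 ∧ arcVertex r i ∈ arcEdge r j := by
    rw [Finset.mem_insert, hF, Finset.mem_filter, Finset.mem_Icc]
    by_cases hj : j + 1 < n
    · rw [hr.arcVertex_mem_arcEdge_iff_eq_pred hn hi hj]
      grind
    · grind
  have hnotMem : i - 1 ∉ F := by
    rw [hF, Finset.mem_filter, Finset.mem_Icc]
    rintro ⟨h1, h⟩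
    have := hr.le_of_arcVertex_eq hn hi h
    omega
  have himage : (arcTree r).incidenceSet (arcVertex r i) = arcEdge r '' ↑(insert (i - 1) F) := by
    ext e
    rw [SimpleGraph.incidenceSet, Set.mem_sep_iff, hr.edgeSet_arcTree hn]
    constructor
    · rintro ⟨⟨j, hj, rfl⟩, h⟩
      exact ⟨j, (hmem j).2 ⟨hj, h⟩, rfl⟩
    · rintro ⟨j, hj, rfl⟩
      have hj := (hmem j).1 hj
      exact ⟨⟨j, hj.1, rfl⟩, hj.2⟩
  have hinj : Set.InjOn (arcEdge r) ↑(insert (i - 1) F) :=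
    (hr.arcEdge_injOn hn).mono fun j hj => ((hmem j).1 hj).1
  rw [himage, hinj.ncard_image, Set.ncard_coe_finset, Finset.card_insert_of_notMem hnotMem,
    spineValues, Multiset.count_map, ← Finset.filter_val, Finset.card_val]

lemma isLeaf_arcTree_iff (hr : IsStepSeq r) (hn : 2 ≤ n) {x : ZMod n} :
    IsLeaf (arcTree r) x ↔ x ∉ spineValues r := by
  rw [isLeaf_iff_ncard_incidenceSet, hr.ncard_incidenceSet_arcTree hn, Nat.add_eq_right,
    Multiset.count_eq_zero]

end IsStepSeq

end ArcTree

section Paths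

/-- Any path with boundary edges consists of distinct edges of `p`, hence is not longer. -/
lemma isSpine_of_forall_mem {n : ℕ} {C : SimpleGraph (ZMod n)} {u v : ZMod n} {p : C.Walk u v}
    (hp : p.IsPath) (hside : ∀ e ∈ p.edges, IsSide e)
    (hall : ∀ e ∈ C.edgeSet, IsSide e → e ∈ p.edges) : IsSpine p := by
  refine ⟨⟨hp, hside⟩, fun u' v' q hq hqside => ?_⟩
  rw [← SimpleGraph.Walk.length_edges, ← SimpleGraph.Walk.length_edges]
  exact (hq.isTrail.edges_nodup.subperm fun e he =>
    hall e (q.edges_subset_edgeSet he) (hqside e he)).length_le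

lemma exists_isPath_of_adj {V : Type*} {G : SimpleGraph V} {f : ℕ → V} {k : ℕ} {u : V}
    (h0 : f 0 = u) (hinj : Set.InjOn f {j | j ≤ k}) (hadj : ∀ q < k, G.Adj (f q) (f (q + 1))) :
    ∃ p : G.Walk u (f k), p.IsPath ∧ p.length = k ∧ ∀ j ≤ k, p.getVert j = f j := by
  subst h0
  obtain ⟨p, hlen, hvert⟩ : ∃ p : G.Walk (f 0) (f k),
      p.length = k ∧ ∀ j ≤ k, p.getVert j = f j := by
    clear hinj
    induction k with
    | zero => exact ⟨.nil, rfl, fun j hj => by rw [Nat.le_zero.1 hj, SimpleGraph.Walk.getVert_zero]⟩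
    | succ k ih =>
      obtain ⟨p, hlen, hvert⟩ := ih fun q hq => hadj q (by omega)
      refine ⟨p.concat (hadj k (by omega)), by rw [SimpleGraph.Walk.length_concat, hlen], ?_⟩
      intro j hj
      rcases hj.lt_or_eq with hj | rfl
      · rw [SimpleGraph.Walk.concat_eq_append, SimpleGraph.Walk.getVert_append]
        split_ifs with h
        · exact hvert j (by omega)
        · obtain rfl : j = k := by omega
          simp [hlen]
      · exact SimpleGraph.Walk.getVert_of_length_le _ (by simp [hlen])
  refine ⟨p, SimpleGraph.Walk.IsPath.getVert_injOn_iff p |>.1 fun i hi j hj h => ?_, hlen, hvert⟩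
  rw [Set.mem_ofPred_eq, hlen] at hi hj
  exact hinj hi hj (by rw [← hvert i hi, h, hvert j hj])

end Paths

section ArcCaterpillar
variable {n : ℕ} {r : ℕ → ZMod n}

namespace IsStepSeq

lemma exists_lift_of_one_eq (hr : IsStepSeq r) (hn : 2 ≤ n) (h01 : r 1 = r 0 + 1) :
    ∃ N : ℕ → ℕ, IsStepSeq N ∧ N 0 = 0 ∧ N 1 = 1 ∧ ∀ j, r j = r 0 + (N j : ZMod n) := by
  obtain ⟨N, hN, h0, hrN⟩ := hr.exists_lift
  refine ⟨N, hN, h0, ?_, hrN⟩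
  rcases hN 0 with h | h
  · rw [h0] at h
    rw [hrN 1, h, Nat.cast_zero, add_right_inj] at h01
    exact absurd h01.symm (zmod_one_ne_zero hn)
  · rwa [h0] at h

lemma isCyclicInterval_arcTree (hr : IsStepSeq r) (hn : 2 ≤ n) (h01 : r 1 = r 0 + 1) :
    IsCyclicInterval {x | ¬ IsLeaf (arcTree r) x} := by
  obtain ⟨N, hN, h0, h1, hrN⟩ := hr.exists_lift_of_one_eq hn h01
  refine ⟨r 0 + 1, N (n - 2), Set.ext fun x => ?_⟩
  rw [Set.mem_ofPred_eq, hr.isLeaf_arcTree_iff hn, not_not, mem_spineValues_iff]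
  constructor
  · rintro ⟨j, ⟨hj, hj'⟩, rfl⟩
    have hpos : N 1 ≤ N j := hN.monotone hj
    have hle : N j ≤ N (n - 2) := hN.monotone hj'
    refine ⟨N j - 1, by omega, ?_⟩
    rw [hrN j, Nat.cast_sub (by omega), Nat.cast_one]
    ring
  · rintro ⟨q, hq, rfl⟩
    obtain ⟨j, hj, -, hjq⟩ := hN.exists_lt_and_succ_eq (h0.le.trans q.zero_le) hq
    refine ⟨j + 1, ⟨by omega, by omega⟩, ?_⟩
    rw [hrN, hjq, Nat.cast_succ]
    ring

lemma exists_arcEdge_eq_of_le_lift (hr : IsStepSeq r) (hn : 2 ≤ n) {N : ℕ → ℕ} (hN : IsStepSeq N)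
    (h0 : N 0 = 0) (hrN : ∀ j, r j = r 0 + (N j : ZMod n)) {q : ℕ} (hq : q ≤ N (n - 2)) :
    ∃ j, j + 1 < n ∧ arcEdge r j = s(r 0 + (q : ZMod n), r 0 + (q : ZMod n) + 1) := by
  rcases hq.lt_or_eq with hq | rfl
  · obtain ⟨j, hj, hjq, hjq'⟩ := hN.exists_lt_and_succ_eq (h0.le.trans q.zero_le) hq
    refine ⟨j, by omega, ?_⟩
    rw [arcEdge_of_eq_add hn, hrN j, hjq]
    rw [hrN, hrN j, hjq, hjq', Nat.cast_succ, add_assoc]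
  · exact ⟨n - 2, by omega, by rw [hr.arcEdge_last hn (by omega), ← hrN]⟩

lemma arcEdge_eq_of_isSide (hr : IsStepSeq r) (hn : 2 ≤ n) (h01 : r 1 = r 0 + 1) {j : ℕ}
    (hj : j + 1 < n) (hside : IsSide (arcEdge r j)) : arcEdge r j = s(r j, r j + 1) := by
  rcases hr j with h | h
  · by_contra hne
    have hpos : 0 < j := Nat.pos_of_ne_zero fun h0 => hne (arcEdge_of_eq_add hn (by rwa [h0]))
    have hlt : j + 2 < n := by
      have : j + 2 ≠ n := fun h => hne (hr.arcEdge_last hn h)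
      omega
    rw [arcEdge_of_eq h, isSide_iff] at hside
    rcases hside with h' | h'
    · refine natCast_ne_zero_of_lt (n := n) (k := j + 2) (by omega) hlt ?_
      push_cast at h' ⊢
      linear_combination -h'
    · refine natCast_ne_zero_of_lt (n := n) (k := j) hpos (by omega) ?_
      push_cast at h'
      linear_combination h'
  · exact arcEdge_of_eq_add hn h

lemma exists_isSpine_arcTree (hr : IsStepSeq r) (hn : 2 ≤ n) (h01 : r 1 = r 0 + 1) :
    ∃ (b : ZMod n) (p : (arcTree r).Walk (r 0) b), IsSpine p ∧
      (∀ j ≤ p.length, p.getVert j = r 0 + (j : ZMod n)) ∧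
      ∀ e ∈ (arcTree r).edgeSet, IsSide e → e ∈ p.edges := by
  obtain ⟨N, hN, h0, -, hrN⟩ := hr.exists_lift_of_one_eq hn h01
  have hlast := hN.le_of_zero h0 (n - 2)
  obtain ⟨p, hpath, hlen, hvert⟩ := exists_isPath_of_adj (G := arcTree r)
    (f := fun q => r 0 + (q : ZMod n)) (k := N (n - 2) + 1) (u := r 0) (by simp)
    (fun i (hi : i ≤ _) j (hj : j ≤ _) h =>
      (natCast_eq_iff_of_lt (by omega) (by omega)).1 (add_right_injective _ h))
    fun q hq => by
      obtain ⟨j, hj, hjq⟩ := hr.exists_arcEdge_eq_of_le_lift hn hN h0 hrN (Nat.le_of_lt_succ hq)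
      exact (hr.arcTree_adj hn).2 ⟨j, hj, by rw [hjq, Nat.cast_succ, add_assoc]⟩
  have hedge (x y : ZMod n) : s(x, y) ∈ p.edges ↔
      ∃ q < N (n - 2) + 1, s(r 0 + (q : ZMod n), r 0 + (q : ZMod n) + 1) = s(x, y) := by
    rw [p.mk_mem_edges_iff_exists, hlen]
    refine exists_congr fun q => and_congr_right fun hq => ?_
    rw [hvert q hq.le, hvert (q + 1) hq, Nat.cast_succ, add_assoc]
  have hside : ∀ e ∈ p.edges, IsSide e := by
    rintro ⟨x, y⟩ he
    obtain ⟨q, -, hq⟩ := (hedge x y).1 he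
    exact ⟨_, hq.symm⟩
  have hall : ∀ e ∈ (arcTree r).edgeSet, IsSide e → e ∈ p.edges := by
    rw [hr.edgeSet_arcTree hn]
    rintro _ ⟨j, hj, rfl⟩ hjside
    have hj : j < n - 1 := hj
    have hle : N j ≤ N (n - 2) := hN.monotone (by omega)
    rw [hr.arcEdge_eq_of_isSide hn h01 (by omega) hjside, hedge]
    exact ⟨N j, by omega, by rw [hrN j]⟩
  exact ⟨_, p, isSpine_of_forall_mem hpath hside hall, by rwa [hlen], hall⟩

/-- Whether the arc of index `i` grows to the left can be read off from the tree: the vertex to the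
left of the arc is joined to the right end `r i` before this end moves on, or never. -/
lemma arcTree_adj_iff_succ_eq (hr : IsStepSeq r) {i : ℕ} (hi : i + 2 < n) :
    (arcTree r).Adj (r i - ((i + 1 : ℕ) : ZMod n)) (r i) ↔ r (i + 1) = r i := by
  have hn : 2 ≤ n := by omega
  constructor
  · intro hadj
    by_contra hne
    have hup := (hr i).resolve_left hne
    have hnot : r i - ((i + 1 : ℕ) : ZMod n) ∉ arcSet (r (i + 1)) (i + 2) := by
      rw [hup, show r i - ((i + 1 : ℕ) : ZMod n) = r i + 1 - ((i + 2 : ℕ) : ZMod n) by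
        push_cast; ring, sub_mem_arcSet_iff (by omega) (by omega)]
      exact lt_irrefl _
    obtain ⟨j, hj, h⟩ := (hr.arcTree_adj hn).1 hadj
    rcases Sym2.eq_iff.1 h with ⟨hx, hy⟩ | ⟨hy, hx⟩
    · have hle := hr.le_of_arcVertex_eq hn hj hy
      exact hnot (hx ▸ hr.mem_arcSet hn (by omega))
    · have hij : i < j := by
        by_contra! hji
        exact hnot (hx ▸ (hr.arcVertex_mem_iff hn hj).2 (by omega))
      obtain ⟨e, he, hje⟩ := hr.exists_add (i + 1) (j - (i + 1))
      rw [Nat.add_sub_cancel' hij, hy, hup] at hje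
      refine natCast_ne_zero_of_lt (n := n) (k := e + 1) (by omega) (by omega) ?_
      push_cast
      linear_combination -hje
  · intro h
    rw [SimpleGraph.adj_comm, hr.arcTree_adj hn]
    exact ⟨i, by omega, arcEdge_of_eq h⟩

end IsStepSeq

/-- The caterpillar encoded by a growing sequence of arcs that starts with an increment `1`. -/
def arcCaterpillar (hn : 2 ≤ n) (hr : IsStepSeq r) (h01 : r 1 = r 0 + 1) : Caterpillar n :=
  ⟨arcTree r, hr.isTree_arcTree hn, hr.isNoncrossing_arcTree hn, hr.isCyclicInterval_arcTree hn h01⟩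

end ArcCaterpillar

section Leaves
variable {V : Type*} {G : SimpleGraph V}

lemma exists_adj_mem_notMem (hG : G.Connected) {S : Set V} {x y : V} (hx : x ∈ S) (hy : y ∉ S) :
    ∃ u ∈ S, ∃ v ∉ S, G.Adj u v := by
  obtain ⟨p⟩ := hG.preconnected x y
  obtain ⟨d, -, hd, hd'⟩ := p.exists_boundary_dart S hx hy
  exact ⟨d.fst, hd, d.snd, hd', d.adj⟩

lemma exists_adj_ne_of_not_isLeaf [Nontrivial V] (hG : G.Connected) {x : V}
    (hx : ¬ IsLeaf G x) (t : V) : ∃ y ≠ t, G.Adj x y := by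
  by_contra! h
  obtain ⟨y, hy⟩ := hG.preconnected.exists_adj_of_nontrivial x
  have hall (z : V) (hz : G.Adj x z) : z = t := not_imp_comm.1 (h z) (not_not_intro hz)
  exact hx ⟨y, hy, fun z hz => (hall z hz).trans (hall y hy).symm⟩

lemma not_isLeaf_of_adj (hG : G.Connected) {x y z : V} (hzx : z ≠ x) (hzy : z ≠ y)
    (hxy : G.Adj x y) (hx : IsLeaf G x) : ¬ IsLeaf G y := by
  intro hy
  have hz : z ∉ ({x, y} : Set V) := by simp [hzx, hzy]
  obtain ⟨u, rfl | rfl, v, hv, huv⟩ := exists_adj_mem_notMem hG (Set.mem_insert x {y}) hz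
  · exact hv (.inr (hx.unique huv hxy))
  · exact hv (.inl (hy.unique huv hxy.symm))

lemma exists_isLeaf [Finite V] [Nontrivial V] (hG : G.IsTree) : ∃ x, IsLeaf G x := by
  classical
  have := Fintype.ofFinite V
  obtain ⟨x, hx⟩ := hG.exists_vert_degree_one_of_nontrivial
  exact ⟨x, SimpleGraph.degree_eq_one_iff_existsUnique_adj.1 hx⟩

lemma exists_not_isLeaf [Finite V] (hV : 2 < Nat.card V) (hG : G.IsTree) :
    ∃ x, ¬ IsLeaf G x := by
  classical
  have := Fintype.ofFinite V
  have : Nontrivial V := Finite.one_lt_card_iff_nontrivial.1 (by omega)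
  obtain ⟨x, hx⟩ := exists_isLeaf hG
  obtain ⟨y, hxy⟩ := hG.connected.preconnected.exists_adj_of_nontrivial x
  obtain ⟨z, -, hz⟩ := Finset.exists_mem_notMem_of_card_lt_card (s := {x, y}) (t := Finset.univ)
    (Finset.card_le_two.trans_lt (by rwa [Finset.card_univ, ← Nat.card_eq_fintype_card]))
  rw [Finset.mem_insert, Finset.mem_singleton, not_or] at hz
  exact ⟨y, not_isLeaf_of_adj hG.connected hz.1 hz.2 hxy hx⟩

end Leaves

section SpineCoordinates
variable {n : ℕ}

lemma exists_eq_add_natCast [NeZero n] (a x : ZMod n) :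
    ∃ q, 1 ≤ q ∧ q ≤ n ∧ a + (q : ZMod n) = x := by
  obtain ⟨k, hk, hkx⟩ := exists_natCast_eq (x - a - 1)
  refine ⟨k + 1, by omega, hk, ?_⟩
  rw [Nat.cast_succ, hkx]
  ring

lemma add_natCast_eq_iff (a : ZMod n) {p q : ℕ} (hpq : p < q + n) (hqp : q < p + n) :
    a + (p : ZMod n) = a + (q : ZMod n) ↔ p = q := by
  rw [add_right_inj, ← Int.cast_natCast p, ← Int.cast_natCast q,
    intCast_eq_iff (by omega) (by omega), Nat.cast_inj]

/-- The caterpillar `C` in coordinates: the graph on `ℕ` in which `p` and `q` are adjacent if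
`a + p` and `a + q` are adjacent in `C`. It is invariant under translation of either end by `n`. -/
def Caterpillar.unroll (C : Caterpillar n) (a : ZMod n) : SimpleGraph ℕ :=
  C.1.comap fun q => a + (q : ZMod n)

lemma Caterpillar.unroll_adj {C : Caterpillar n} {a : ZMod n} {p q : ℕ} :
    (C.unroll a).Adj p q ↔ C.1.Adj (a + (p : ZMod n)) (a + (q : ZMod n)) := Iff.rfl

lemma Caterpillar.not_unroll_adj_of_alternating [NeZero n] (C : Caterpillar n) {a : ZMod n}
    {i j k l : ℕ} (hij : i < j) (hjk : j < k) (hkl : k < l) (hl : l < i + n)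
    (hik : (C.unroll a).Adj i k) : ¬ (C.unroll a).Adj j l := by
  intro hjl
  rw [unroll_adj] at hik hjl
  obtain ⟨y, rfl⟩ := ZMod.intCast_surjective a
  refine C.2.2.1 _ (C.1.mem_edgeSet.2 hik) _ (C.1.mem_edgeSet.2 hjl) ?_
  have hcast (q : ℕ) : (y : ZMod n) + (q : ZMod n) = ((y + q : ℤ) : ZMod n) := by push_cast; rfl
  rw [hcast, hcast, hcast, hcast, crosses_intCast_iff (b := y + i) (by omega) (by omega) (by omega)
    (by omega) (by omega) (by omega)]
  omega

/-- Coordinates `q ↦ a + q` with `1 ≤ q ≤ n` in which the non-leaves of the caterpillar `C` are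
`1, …, s`. -/
structure SpineCoordinates (C : Caterpillar n) (a : ZMod n) (s : ℕ) : Prop where
  one_le : 1 ≤ s
  lt : s < n
  not_isLeaf : ∀ q, 1 ≤ q → q ≤ s → ¬ IsLeaf C.1 (a + (q : ZMod n))
  isLeaf : ∀ q, s < q → q ≤ n → IsLeaf C.1 (a + (q : ZMod n))

lemma Caterpillar.exists_spineCoordinates (hn : 3 ≤ n) (C : Caterpillar n) :
    ∃ a s, SpineCoordinates C a s := by
  have : NeZero n := ⟨by omega⟩
  have : Fact (1 < n) := ⟨by omega⟩
  obtain ⟨c, k, hk⟩ := C.2.2.2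
  have hmem (x : ZMod n) : ¬ IsLeaf C.1 x ↔ ∃ j < k, x = c + (j : ZMod n) := Set.ext_iff.1 hk x
  have hkn : k < n := by
    by_contra hle
    obtain ⟨x, hx⟩ := exists_isLeaf C.2.1
    obtain ⟨j, hj, hjx⟩ := exists_natCast_eq (x - c)
    exact (hmem x).2 ⟨j, by omega, by rw [hjx]; ring⟩ hx
  obtain ⟨j, hj, -⟩ : ∃ j < k, _ :=
    (hmem _).1 (exists_not_isLeaf (by rw [Nat.card_zmod]; omega) C.2.1).choose_spec
  refine ⟨c - 1, k, by omega, hkn, fun q hq hqk => (hmem _).2 ⟨q - 1, by omega, ?_⟩,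
    fun q hkq hqn => ?_⟩
  · rw [Nat.cast_sub hq]
    push_cast
    ring
  · by_contra h
    obtain ⟨j, hj, hqj⟩ := (hmem _).1 h
    rw [show c + (j : ZMod n) = c - 1 + ((j + 1 : ℕ) : ZMod n) by push_cast; ring,
      add_natCast_eq_iff _ (by omega) (by omega)] at hqj
    omega

namespace SpineCoordinates
variable {C : Caterpillar n} {a : ZMod n} {s : ℕ}

lemma neZero (h : SpineCoordinates C a s) : NeZero n := ⟨h.lt.ne_bot⟩

lemma nontrivial (h : SpineCoordinates C a s) : Nontrivial (ZMod n) :=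
  have : Fact (1 < n) := ⟨h.one_le.trans_lt h.lt⟩
  inferInstance

lemma exists_adj_ne (h : SpineCoordinates C a s) {q : ℕ} (hq : 1 ≤ q) (hqs : q ≤ s) (t : ℕ) :
    ∃ p, 1 ≤ p ∧ p ≤ n ∧ p ≠ t ∧ (C.unroll a).Adj q p := by
  have := h.nontrivial
  have := h.neZero
  obtain ⟨y, hy, hadj⟩ := exists_adj_ne_of_not_isLeaf C.2.1.connected (h.not_isLeaf q hq hqs)
    (a + (t : ZMod n))
  obtain ⟨p, hp, hpn, rfl⟩ := exists_eq_add_natCast a y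
  exact ⟨p, hp, hpn, fun hpt => hy (by rw [hpt]), hadj⟩

lemma eq_of_adj_leaf (h : SpineCoordinates C a s) {y p q : ℕ} (hy : s < y) (hyn : y ≤ n)
    (hp : 1 ≤ p) (hpn : p ≤ n) (hq : 1 ≤ q) (hqn : q ≤ n) (hpy : (C.unroll a).Adj p y)
    (hqy : (C.unroll a).Adj q y) : p = q :=
  (add_natCast_eq_iff a (by omega) (by omega)).1 ((h.isLeaf y hy hyn).unique hpy.symm hqy.symm)

lemma exists_adj_leaf (h : SpineCoordinates C a s) {y : ℕ} (hy : s < y) (hyn : y ≤ n) :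
    ∃ p, 1 ≤ p ∧ p ≤ s ∧ (C.unroll a).Adj p y := by
  have := h.nontrivial
  have := h.neZero
  have hs := h.one_le
  obtain ⟨x, hx⟩ := C.2.1.connected.preconnected.exists_adj_of_nontrivial (a + (y : ZMod n))
  obtain ⟨p, hp, hpn, rfl⟩ := exists_eq_add_natCast a x
  refine ⟨p, hp, not_lt.1 fun hsp => ?_, hx.symm⟩
  refine not_isLeaf_of_adj C.2.1.connected (z := a + ((1 : ℕ) : ZMod n)) ?_ ?_ hx
    (h.isLeaf y hy hyn) (h.isLeaf p hsp hpn)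
  all_goals
    rw [Ne, add_natCast_eq_iff a (by omega) (by omega)]
    omega

lemma not_adj_of_forall_adj_succ (h : SpineCoordinates C a s) {i d : ℕ} (hd : 2 ≤ d) (hdn : d < n)
    (hadj : ∀ q, i ≤ q → q < i + d → (C.unroll a).Adj q (q + 1)) :
    ¬ (C.unroll a).Adj i (i + d) := by
  intro hchord
  have := h.neZero
  obtain ⟨p, hp, hlen, -⟩ := exists_isPath_of_adj (G := C.1)
    (f := fun e => a + ((i + e : ℕ) : ZMod n)) (k := d) rfl
    (fun e he e' he' hee' => by
      have he : e ≤ d := he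
      have he' : e' ≤ d := he'
      exact Nat.add_left_cancel
        ((add_natCast_eq_iff a (p := i + e) (q := i + e') (by omega) (by omega)).1 hee'))
    (fun e he => hadj (i + e) (by omega) (by omega))
  have hchord : C.1.Adj (a + ((i + 0 : ℕ) : ZMod n)) (a + ((i + d : ℕ) : ZMod n)) := hchord
  have hpath : p = hchord.toWalk := congrArg Subtype.val
    ((C.2.1.isAcyclic.subsingleton_path _ _).elim ⟨p, hp⟩ (SimpleGraph.Path.singleton hchord))
  have hlen' : p.length = 1 := congrArg SimpleGraph.Walk.length hpath
  omega

/-- Non-leaves inside a chord of minimal length only see their two neighbors on the polygon, so the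
chord would close a cycle. -/
lemma not_adj_of_two_le (h : SpineCoordinates C a s) (d : ℕ) : ∀ i, 1 ≤ i → 2 ≤ d → i + d ≤ s →
    ¬ (C.unroll a).Adj i (i + d) := by
  have := h.neZero
  have hsn := h.lt
  induction d using Nat.strong_induction_on with
  | _ d ih =>
  intro i hi hd hid hchord
  have hconsecutive (q p : ℕ) (hiq : i < q) (hqd : q < i + d) (hp : 1 ≤ p) (hpn : p ≤ n)
      (hqp : (C.unroll a).Adj q p) : p = q + 1 ∨ p + 1 = q := by
    have hip : i ≤ p := not_lt.1 fun hpi =>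
      C.not_unroll_adj_of_alternating hpi hiq hqd (by omega) hqp.symm hchord
    have hpd : p ≤ i + d := not_lt.1 fun hdp =>
      C.not_unroll_adj_of_alternating hiq hqd hdp (by omega) hchord hqp
    rcases lt_or_gt_of_ne hqp.ne with hlt | hlt
    · by_contra hne
      refine ih (p - q) (by omega) q (by omega) (by omega) (by omega) ?_
      rwa [Nat.add_sub_of_le hlt.le]
    · by_contra hne
      refine ih (q - p) (by omega) p (by omega) (by omega) (by omega) ?_
      rw [Nat.add_sub_of_le hlt.le]
      exact hqp.symm
  refine h.not_adj_of_forall_adj_succ hd (by omega) (fun q hiq hqd => ?_) hchord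
  rcases hiq.lt_or_eq with hiq | rfl
  · obtain ⟨p, hp, hpn, hpq, hqp⟩ := h.exists_adj_ne (q := q) (by omega) (by omega) (q - 1)
    rcases hconsecutive q p hiq hqd hp hpn hqp with rfl | hpq'
    · exact hqp
    · omega
  · obtain ⟨p, hp, hpn, hpi, hqp⟩ := h.exists_adj_ne (q := i + 1) (by omega) (by omega) (i + 2)
    obtain rfl : p = i := by
      have := hconsecutive (i + 1) p (by omega) (by omega) hp hpn hqp
      omega
    exact hqp.symm

lemma eq_add_one_or_of_adj (h : SpineCoordinates C a s) {p q : ℕ} (hp : 1 ≤ p) (hps : p ≤ s)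
    (hq : 1 ≤ q) (hqs : q ≤ s) (hpq : (C.unroll a).Adj p q) : q = p + 1 ∨ p = q + 1 := by
  by_contra hne
  rcases lt_or_gt_of_ne hpq.ne with hlt | hlt
  · refine h.not_adj_of_two_le (q - p) p hp (by omega) (by omega) ?_
    rwa [Nat.add_sub_of_le hlt.le]
  · refine h.not_adj_of_two_le (p - q) q hq (by omega) (by omega) ?_
    rw [Nat.add_sub_of_le hlt.le]
    exact hpq.symm

/-- Otherwise the non-leaves up to `q` and the leaves attached to them form a component. -/
lemma adj_succ_of_lt (h : SpineCoordinates C a s) {q : ℕ} (hq : 1 ≤ q) (hqs : q < s) :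
    (C.unroll a).Adj q (q + 1) := by
  have := h.neZero
  have hsn := h.lt
  by_contra hno
  let S : Set (ZMod n) := {x | (∃ p, 1 ≤ p ∧ p ≤ q ∧ a + (p : ZMod n) = x) ∨
    IsLeaf C.1 x ∧ ∃ p, 1 ≤ p ∧ p ≤ q ∧ C.1.Adj x (a + (p : ZMod n))}
  have hnotMem : a + ((q + 1 : ℕ) : ZMod n) ∉ S := by
    rintro (⟨p, hp, hpq, heq⟩ | ⟨hleaf, -⟩)
    · rw [add_natCast_eq_iff a (by omega) (by omega)] at heq
      omega
    · exact h.not_isLeaf (q + 1) (by omega) (by omega) hleaf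
  obtain ⟨x, hx, y, hy, hxy⟩ := exists_adj_mem_notMem C.2.1.connected
    (show a + ((1 : ℕ) : ZMod n) ∈ S from .inl ⟨1, le_rfl, hq, rfl⟩) hnotMem
  rcases hx with ⟨p, hp, hpq, rfl⟩ | ⟨hleaf, p, hp, hpq, hxp⟩
  · obtain ⟨t, ht, htn, rfl⟩ := exists_eq_add_natCast a y
    rcases le_or_gt t s with hts | hts
    · have htq : q < t := not_le.1 fun htq => hy (.inl ⟨t, ht, htq, rfl⟩)
      have htp := h.eq_add_one_or_of_adj hp (by omega) ht hts hxy
      obtain ⟨rfl, rfl⟩ : p = q ∧ t = p + 1 := by omega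
      exact hno hxy
    · exact hy (.inr ⟨h.isLeaf t hts htn, p, hp, hpq, hxy.symm⟩)
  · exact hy (.inl ⟨p, hp, hpq, hleaf.unique hxp hxy⟩)

lemma antitone_of_adj_leaf (h : SpineCoordinates C a s) {y y' p p' : ℕ} (hy : s < y)
    (hyy' : y < y') (hyn : y' ≤ n) (hp : 1 ≤ p) (hps : p' ≤ s) (hpy : (C.unroll a).Adj p y)
    (hpy' : (C.unroll a).Adj p' y') : p' ≤ p := by
  have := h.neZero
  exact not_lt.1 fun hlt =>
    C.not_unroll_adj_of_alternating hlt (by omega) hyy' (by omega) hpy hpy'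

lemma adj_zero_one (h : SpineCoordinates C a s) : (C.unroll a).Adj 0 1 := by
  have hs := h.one_le
  obtain ⟨y, hy, hyn, hy2, hadj⟩ := h.exists_adj_ne le_rfl hs 2
  have hsy : s < y := not_le.1 fun hys => by
    have := h.eq_add_one_or_of_adj le_rfl hs hy hys hadj
    omega
  obtain ⟨p, hp, hps, hpn⟩ := h.exists_adj_leaf h.lt le_rfl
  obtain rfl : p = 1 := by
    rcases hyn.lt_or_eq with hyn | rfl
    · exact le_antisymm (h.antitone_of_adj_leaf hsy hyn le_rfl le_rfl hps hadj hpn) hp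
    · exact h.eq_of_adj_leaf hsy le_rfl hp (by omega) le_rfl (by omega) hpn hadj
  rw [Caterpillar.unroll_adj, ZMod.natCast_self] at hpn
  rw [Caterpillar.unroll_adj, Nat.cast_zero]
  exact hpn.symm

lemma adj_last_succ (h : SpineCoordinates C a s) : (C.unroll a).Adj s (s + 1) := by
  have hs := h.one_le
  obtain ⟨y, hy, hyn, hys, hadj⟩ := h.exists_adj_ne hs le_rfl (s - 1)
  have hsy : s < y := not_le.1 fun hys => by
    have := h.eq_add_one_or_of_adj hs le_rfl hy hys hadj
    omega
  obtain ⟨p, hp, hps, hadj'⟩ := h.exists_adj_leaf (Nat.lt_succ_self s) h.lt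
  rcases eq_or_lt_of_le (Nat.succ_le_of_lt hsy) with rfl | hlt
  · exact hadj
  · have hsp := h.antitone_of_adj_leaf (Nat.lt_succ_self s) hlt hyn hp le_rfl hadj' hadj
    rwa [le_antisymm hps hsp] at hadj'

lemma adj_succ (h : SpineCoordinates C a s) {q : ℕ} (hq : q ≤ s) : (C.unroll a).Adj q (q + 1) := by
  rcases q.eq_zero_or_pos with rfl | hq0
  · exact h.adj_zero_one
  · rcases hq.lt_or_eq with hq | rfl
    · exact h.adj_succ_of_lt hq0 hq
    · exact h.adj_last_succ

end SpineCoordinates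

end SpineCoordinates

section Greedy
variable {n : ℕ} {C : Caterpillar n} {a : ZMod n} {s i N : ℕ}

open scoped Classical in
/-- The sequence of arcs, from the vertex `a` on, that after the first step grows to the left
whenever the caterpillar `C` has the edge for it. -/
noncomputable def greedySeq (C : Caterpillar n) (a : ZMod n) : ℕ → ZMod n
  | 0 => a
  | i + 1 => if 1 ≤ i ∧ C.1.Adj (greedySeq C a i - ((i + 1 : ℕ) : ZMod n)) (greedySeq C a i)
      then greedySeq C a i else greedySeq C a i + 1

lemma isStepSeq_greedySeq (C : Caterpillar n) (a : ZMod n) : IsStepSeq (greedySeq C a) := by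
  intro i
  rw [greedySeq]
  split_ifs
  exacts [.inl rfl, .inr rfl]

lemma greedySeq_one (C : Caterpillar n) (a : ZMod n) : greedySeq C a 1 = greedySeq C a 0 + 1 := by
  simp [greedySeq]

/-- The state of the greedy growth along a spine `1, …, s` when the arc has `i + 1` elements and
right end `N`: leaves outside the arc are attached at `N` or later. -/
structure GreedyInvariant (C : Caterpillar n) (a : ZMod n) (s i N : ℕ) : Prop where
  le_index : N ≤ i
  le_spine : N ≤ s
  le_of_adj : ∀ ⦃y p⦄, s < y → y + i < n + N → 1 ≤ p → p ≤ s → (C.unroll a).Adj p y → N ≤ p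

namespace GreedyInvariant

lemma one (hs : 1 ≤ s) : GreedyInvariant C a s 1 1 := ⟨le_rfl, hs, fun _ _ _ _ hp _ _ => hp⟩

lemma growLeft (hI : GreedyInvariant C a s i N) : GreedyInvariant C a s (i + 1) N :=
  ⟨hI.le_index.trans i.le_succ, hI.le_spine, fun _ _ hy hyi => hI.le_of_adj hy (by omega)⟩

lemma exists_adj_of_not_adj (hI : GreedyInvariant C a s i N) (h : SpineCoordinates C a s) {y : ℕ}
    (hyi : y + (i + 1) = n + N) (hy : s < y) (hNy : ¬ (C.unroll a).Adj N y) :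
    ∃ p, N < p ∧ p ≤ s ∧ (C.unroll a).Adj p y := by
  have := hI.le_index
  obtain ⟨p, hp, hps, hpy⟩ := h.exists_adj_leaf hy (by omega)
  refine ⟨p, (hI.le_of_adj hy (by omega) hp hps hpy).lt_of_ne ?_, hps, hpy⟩
  rintro rfl
  exact hNy hpy

lemma growRight (hI : GreedyInvariant C a s i N) (h : SpineCoordinates C a s) {y : ℕ}
    (hi : i + 3 ≤ n) (hyi : y + (i + 1) = n + N) (hNy : ¬ (C.unroll a).Adj N y) :
    GreedyInvariant C a s (i + 1) (N + 1) := by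
  have hNi := hI.le_index
  have hsn := h.lt
  refine ⟨by omega, hI.le_spine.lt_of_ne ?_, fun x p hx hxi hp hps hpx => ?_⟩
  · rintro rfl
    obtain ⟨p, hNp, hps, -⟩ := hI.exists_adj_of_not_adj h hyi (by omega) hNy
    omega
  · obtain ⟨t, hNt, hts, hty⟩ := hI.exists_adj_of_not_adj h hyi (by omega) hNy
    rcases eq_or_ne x y with rfl | hxy
    · rwa [h.eq_of_adj_leaf hx (by omega) hp (by omega) (by omega) (by omega) hpx hty]
    · exact Nat.succ_le_of_lt (hNt.trans_le
        (h.antitone_of_adj_leaf hx (by omega) (by omega) hp hts hpx hty))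

end GreedyInvariant

namespace SpineCoordinates

lemma exists_greedyInvariant (h : SpineCoordinates C a s) {i : ℕ} (hi : 1 ≤ i) (hin : i + 2 ≤ n) :
    ∃ N : ℕ, greedySeq C a i = a + (N : ZMod n) ∧ GreedyInvariant C a s i N := by
  induction i, hi using Nat.le_induction with
  | base =>
    refine ⟨1, ?_, .one h.one_le⟩
    rw [greedySeq_one, greedySeq, Nat.cast_one]
  | succ i hi ih =>
    obtain ⟨N, hN, hI⟩ := ih (by omega)
    obtain ⟨y, hy⟩ : ∃ y, y + (i + 1) = n + N := ⟨n + N - (i + 1), by omega⟩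
    have hadj : C.1.Adj (greedySeq C a i - ((i + 1 : ℕ) : ZMod n)) (greedySeq C a i) ↔
        (C.unroll a).Adj N y := by
      have hcast : (y : ZMod n) + ((i + 1 : ℕ) : ZMod n) = N := by
        rw [← Nat.cast_add, hy, Nat.cast_add, ZMod.natCast_self, zero_add]
      rw [hN, Caterpillar.unroll_adj, C.1.adj_comm,
        show a + (N : ZMod n) - ((i + 1 : ℕ) : ZMod n) = a + (y : ZMod n) by
          rw [← hcast]
          ring]
    rw [greedySeq, hadj]
    split_ifs with hNy
    · exact ⟨N, hN, hI.growLeft⟩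
    · refine ⟨N + 1, ?_, hI.growRight h (by omega) hy fun hadj => hNy ⟨hi, hadj⟩⟩
      rw [hN, Nat.cast_succ, add_assoc]

lemma exists_le_greedySeq_eq (h : SpineCoordinates C a s) {i : ℕ} (hin : i + 2 ≤ n) :
    ∃ N ≤ s, greedySeq C a i = a + (N : ZMod n) := by
  rcases i.eq_zero_or_pos with rfl | hi
  · exact ⟨0, s.zero_le, by rw [greedySeq, Nat.cast_zero, add_zero]⟩
  · obtain ⟨N, hN, hI⟩ := h.exists_greedyInvariant hi hin
    exact ⟨N, hI.le_spine, hN⟩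

lemma arcEdge_greedySeq_mem (h : SpineCoordinates C a s) {j : ℕ} (hj : j + 2 ≤ n) :
    arcEdge (greedySeq C a) j ∈ C.1.edgeSet := by
  have hn : 2 ≤ n := by omega
  by_cases hadj : 1 ≤ j ∧ C.1.Adj (greedySeq C a j - ((j + 1 : ℕ) : ZMod n)) (greedySeq C a j)
  · rw [arcEdge_of_eq (by rw [greedySeq, if_pos hadj])]
    exact hadj.2.symm
  · obtain ⟨N, hNs, hN⟩ := h.exists_le_greedySeq_eq hj
    rw [arcEdge_of_eq_add hn (by rw [greedySeq, if_neg hadj]), hN, add_assoc,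
      ← Nat.cast_succ]
    exact h.adj_succ hNs

lemma arcTree_greedySeq (h : SpineCoordinates C a s) : arcTree (greedySeq C a) = C.1 := by
  have hn : 2 ≤ n := h.one_le.trans_lt h.lt
  have hr := isStepSeq_greedySeq C a
  refine (SimpleGraph.isTree_iff_minimal_connected.1 C.2.1).eq_of_le
    (hr.isTree_arcTree hn).connected ?_
  rw [← SimpleGraph.edgeSet_subset_edgeSet, hr.edgeSet_arcTree hn]
  rintro _ ⟨j, hj, rfl⟩
  have hj : j < n - 1 := hj
  exact h.arcEdge_greedySeq_mem (by omega)

end SpineCoordinates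

theorem Caterpillar.exists_arcTree_eq (hn : 3 ≤ n) (C : Caterpillar n) :
    ∃ r : ℕ → ZMod n, IsStepSeq r ∧ r 1 = r 0 + 1 ∧ arcTree r = C.1 := by
  obtain ⟨a, s, h⟩ := C.exists_spineCoordinates hn
  exact ⟨greedySeq C a, isStepSeq_greedySeq C a, greedySeq_one C a, h.arcTree_greedySeq⟩

end Greedy

/-! ### Growing sequences and the multisets of their values -/

/-- Both sequences enumerate the same multiset in increasing order. -/
lemma eqOn_of_monotoneOn_of_map_eq {ι α : Type*} [LinearOrder ι] [PartialOrder α] {s : Finset ι}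
    {f g : ι → α} (hf : MonotoneOn f s) (hg : MonotoneOn g s) (h : s.val.map f = s.val.map g) :
    Set.EqOn f g s := by
  have hsorted {f : ι → α} (hf : MonotoneOn f s) : ((s.sort).map f).Pairwise (· ≤ ·) :=
    List.pairwise_map.2 ((s.pairwise_sort _).imp_of_mem fun hi hj hij =>
      hf ((s.mem_sort _).1 hi) ((s.mem_sort _).1 hj) hij)
  rw [← s.sort_eq (· ≤ ·), Multiset.map_coe, Multiset.map_coe, Multiset.coe_eq_coe] at h
  have hmap := h.eq_of_pairwise (fun _ _ _ _ => le_antisymm) (hsorted hf) (hsorted hg)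
  exact fun i hi => List.map_inj_left.1 hmap i ((s.mem_sort _).2 hi)

lemma map_val_update {ι α : Type*} [DecidableEq ι] {s : Finset ι} {i : ι} (hi : i ∈ s) (f : ι → α)
    (a : α) : f i ::ₘ s.val.map (Function.update f i a) = a ::ₘ s.val.map f := by
  have hrest : (s.erase i).val.map (Function.update f i a) = (s.erase i).val.map f :=
    Multiset.map_congr rfl fun j hj => Function.update_of_ne (Finset.ne_of_mem_erase hj) _ _
  rw [← Finset.insert_erase hi, Finset.insert_val_of_notMem (Finset.notMem_erase i s),
    Multiset.map_cons, Multiset.map_cons, hrest, Function.update_self, Multiset.cons_swap]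

lemma monotoneOn_update {ι α : Type*} [LinearOrder ι] [Preorder α] {s : Set ι} {f : ι → α} {i : ι}
    {a : α} (hf : MonotoneOn f s) (hle : ∀ j ∈ s, j < i → f j ≤ a)
    (hge : ∀ j ∈ s, i < j → a ≤ f j) : MonotoneOn (Function.update f i a) s := by
  intro j hj k hk hjk
  rcases eq_or_ne j i with rfl | hji <;> rcases eq_or_ne k j with rfl | hkj
  · exact le_rfl
  · rw [Function.update_self, Function.update_of_ne hkj]
    exact hge k hk (lt_of_le_of_ne hjk hkj.symm)
  · exact le_rfl
  · rw [Function.update_of_ne hji]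
    rcases eq_or_ne k i with rfl | hki
    · rw [Function.update_self]
      exact hle j hj (lt_of_le_of_ne hjk hkj.symm)
    · rw [Function.update_of_ne hki]
      exact hf hj hk hjk

/-- The sequence `r'` arises from `r` by adding `1` to the value at the index `i`, as far as the
indices `1, …, n - 2` are concerned. These are the values that determine a caterpillar. -/
def RaisesAt {n : ℕ} (r r' : ℕ → ZMod n) (i : ℕ) : Prop :=
  i ∈ Finset.Icc 1 (n - 2) ∧
    Set.EqOn r' (Function.update r i (r i + 1)) ↑(Finset.Icc 1 (n - 2))

section SpineValues
variable {n : ℕ} {r r' : ℕ → ZMod n}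

lemma val_add_one_of_ne [NeZero n] {x : ZMod n} (h : x + 1 ≠ 0) : (x + 1).val = x.val + 1 := by
  have hcast : ((x.val + 1 : ℕ) : ZMod n) = x + 1 := by rw [Nat.cast_succ, ZMod.natCast_zmod_val]
  have hlt : x.val + 1 < n := by
    refine lt_of_le_of_ne (ZMod.val_lt x) fun hn => h ?_
    rw [← hcast, hn, ZMod.natCast_self]
  rw [← hcast, ZMod.val_cast_of_lt hlt]

lemma exists_ne_notMem_spineValues (hn : 2 ≤ n) (r : ℕ → ZMod n) (x : ZMod n) :
    ∃ y ≠ x, y ∉ spineValues r := by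
  have : NeZero n := ⟨by omega⟩
  have hcard : (insert x (spineValues r).toFinset).card < (Finset.univ : Finset (ZMod n)).card := by
    have hinsert := Finset.card_insert_le x (spineValues r).toFinset
    have hvalues := (spineValues r).toFinset_card_le
    rw [spineValues, Multiset.card_map, Finset.card_val, Nat.card_Icc, ← spineValues] at hvalues
    rw [Finset.card_univ, ZMod.card]
    omega
  obtain ⟨y, -, hy⟩ := Finset.exists_mem_notMem_of_card_lt_card hcard
  rw [Finset.mem_insert, Multiset.mem_toFinset, not_or] at hy
  exact ⟨y, hy⟩

lemma IsStepSeq.monotoneOn_val_sub [NeZero n] (hr : IsStepSeq r) {y : ZMod n}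
    (hy : y ∉ spineValues r) :
    MonotoneOn (fun j => (r j - y).val) ↑(Finset.Icc 1 (n - 2)) := by
  rw [Finset.coe_Icc]
  refine monotoneOn_of_le_add_one Set.ordConnected_Icc fun j _ _ hj => ?_
  rcases hr j with h | h
  · simp only [h, le_refl]
  · have hne : r j - y + 1 ≠ 0 := fun h0 =>
      hy (mem_spineValues_iff.2 ⟨j + 1, hj, by linear_combination h + h0⟩)
    simp only [h, add_sub_right_comm, val_add_one_of_ne hne, Nat.le_succ]

lemma eqOn_of_spineValues_eq_of_monotoneOn [NeZero n] {y : ZMod n}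
    (hr : MonotoneOn (fun j => (r j - y).val) ↑(Finset.Icc 1 (n - 2)))
    (hr' : MonotoneOn (fun j => (r' j - y).val) ↑(Finset.Icc 1 (n - 2)))
    (h : spineValues r = spineValues r') : Set.EqOn r r' ↑(Finset.Icc 1 (n - 2)) := by
  intro j hj
  refine sub_left_injective (ZMod.val_injective n (eqOn_of_monotoneOn_of_map_eq hr hr' ?_ hj))
  simpa only [spineValues, Multiset.map_map, Function.comp_def] using
    congrArg (Multiset.map fun x => (x - y).val) h

namespace IsStepSeq

lemma eqOn_of_spineValues_eq (hr : IsStepSeq r) (hr' : IsStepSeq r') (hn : 2 ≤ n)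
    (h : spineValues r = spineValues r') : Set.EqOn r r' ↑(Finset.Icc 1 (n - 2)) := by
  have : NeZero n := ⟨by omega⟩
  obtain ⟨y, -, hy⟩ := exists_ne_notMem_spineValues hn r 0
  exact eqOn_of_spineValues_eq_of_monotoneOn (hr.monotoneOn_val_sub hy)
    (hr'.monotoneOn_val_sub (h ▸ hy)) h

/-- Only the last occurrence of the value `w` can be raised to `w + 1` without destroying
monotonicity. -/
lemma exists_raisesAt (hr : IsStepSeq r) (hr' : IsStepSeq r') (hn : 2 ≤ n) {w : ZMod n}
    (h : w ::ₘ spineValues r' = (w + 1) ::ₘ spineValues r) :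
    ∃ i, RaisesAt r r' i := by
  have : NeZero n := ⟨by omega⟩
  obtain ⟨y, hyw, hy⟩ := exists_ne_notMem_spineValues hn r (w + 1)
  have hw : w ∈ spineValues r :=
    (Multiset.mem_cons.1 (h ▸ Multiset.mem_cons_self w _)).resolve_left fun hw =>
      zmod_one_ne_zero hn (left_eq_add.1 hw)
  have hy' : y ∉ spineValues r' := fun hmem =>
    (Multiset.mem_cons.1 (h ▸ Multiset.mem_cons_of_mem hmem)).elim hyw hy
  obtain ⟨i, hlast, hmax⟩ :=
    Finset.exists_max_image ((Finset.Icc 1 (n - 2)).filter fun j => r j = w) id (by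
      simpa only [Finset.Nonempty, Finset.mem_filter, Finset.mem_Icc, mem_spineValues_iff] using hw)
  obtain ⟨hi, rfl⟩ := Finset.mem_filter.1 hlast
  refine ⟨i, hi, eqOn_of_spineValues_eq_of_monotoneOn (hr'.monotoneOn_val_sub hy') ?_
    ((Multiset.cons_inj_right (r i)).1 (h.trans (map_val_update hi r _).symm))⟩
  have hval : (r i + 1 - y).val = (r i - y).val + 1 := by
    rw [add_sub_right_comm, val_add_one_of_ne]
    exact fun h0 => hyw (by linear_combination -h0)
  have hmono := hr.monotoneOn_val_sub hy
  have hupdate := Function.comp_update (fun x => (x - y).val) r i (r i + 1)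
  simp only [Function.comp_def] at hupdate
  rw [hupdate, hval]
  refine monotoneOn_update hmono (fun j hj hji => (hmono hj hi hji.le).trans (Nat.le_succ _))
    fun j hj hij => lt_of_le_of_ne (hmono hi hj hij.le) fun heq => ?_
  have hji := sub_left_injective (ZMod.val_injective n heq)
  exact (hmax j (Finset.mem_filter.2 ⟨hj, hji.symm⟩)).not_gt hij

end IsStepSeq

end SpineValues

/-! ### Shifts of geometric caterpillars -/

section Degrees
variable {n : ℕ}

lemma ncard_sep_insert {α : Type*} [Finite α] {s : Set α} {a : α} (ha : a ∉ s) (p : α → Prop)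
    [Decidable (p a)] :
    {b ∈ insert a s | p b}.ncard = {b ∈ s | p b}.ncard + if p a then 1 else 0 := by
  split_ifs with h
  · rw [← Set.ncard_insert_of_notMem fun hmem => ha hmem.1]
    congr 1
    ext b
    simp only [Set.mem_sep_iff, Set.mem_insert_iff]
    grind
  · congr 1
    ext b
    simp only [Set.mem_sep_iff, Set.mem_insert_iff]
    grind

lemma Caterpillar.ncard_edgeSet_add_one [NeZero n] (C : Caterpillar n) :
    C.1.edgeSet.ncard + 1 = n := by
  rw [← Nat.card_coe_set_eq, (SimpleGraph.isTree_iff_connected_and_card.1 C.2.1).2, Nat.card_zmod]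

lemma CaterpillarShift.exists_ncard_incidenceSet [NeZero n] {C D : Caterpillar n}
    (h : CaterpillarShift C D) : ∃ w w' : ZMod n, IsSide s(w, w') ∧ ∀ y,
      (D.1.incidenceSet y).ncard + (if y = w then 1 else 0) =
        (C.1.incidenceSet y).ncard + if y = w' then 1 else 0 := by
  obtain ⟨_, _, p, hp, x, w, w', hadj, hw, hD⟩ := h
  set S := C.1.edgeSet \ {s(x, w)} with hS
  rw [Set.union_singleton] at hD
  have hC : C.1.edgeSet = insert s(x, w) S := by
    rw [hS, Set.insert_sdiff_self_of_mem (C.1.mem_edgeSet.2 hadj)]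
  have hxw : s(x, w) ∉ S := fun hmem => hmem.2 rfl
  have hxw' : s(x, w') ∉ S := by
    intro hmem
    have hcard := D.ncard_edgeSet_add_one.trans C.ncard_edgeSet_add_one.symm
    rw [hC, hD, Set.insert_eq_of_mem hmem, Set.ncard_insert_of_notMem hxw] at hcard
    omega
  have hne : x ≠ w' := (D.1.mem_edgeSet.1 (hD ▸ Set.mem_insert _ _)).ne
  refine ⟨w, w', hp.1.2 _ hw, fun y => ?_⟩
  rw [SimpleGraph.incidenceSet, SimpleGraph.incidenceSet, hC, hD, ncard_sep_insert hxw,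
    ncard_sep_insert hxw']
  simp only [Sym2.mem_iff]
  grind [hadj.ne]

end Degrees

section Raise
variable {n : ℕ} {r r' : ℕ → ZMod n}

namespace RaisesAt
variable {i : ℕ}

lemma eq_add_one (h : RaisesAt r r' i) : r' i = r i + 1 := by
  rw [h.2 h.1, Function.update_self]

lemma eq_of_ne (h : RaisesAt r r' i) {j : ℕ} (hj : 1 ≤ j) (hjn : j ≤ n - 2) (hji : j ≠ i) :
    r' j = r j := by
  rw [h.2 (Finset.mem_Icc.2 ⟨hj, hjn⟩), Function.update_of_ne hji]

end RaisesAt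

namespace IsStepSeq

lemma arcEdge_congr (hr : IsStepSeq r) (hr' : IsStepSeq r') {j : ℕ} (hj : j + 1 < n)
    (h : r j = r' j) (hsucc : j + 2 < n → r (j + 1) = r' (j + 1)) : arcEdge r j = arcEdge r' j := by
  rcases (by omega : j + 2 < n ∨ j + 2 = n) with hjn | hjn
  · rw [arcEdge, arcEdge, arcVertex, arcVertex, h, hsucc hjn]
  · rw [hr.arcEdge_last (by omega) hjn, hr'.arcEdge_last (by omega) hjn, h]

lemma arcTree_congr (hr : IsStepSeq r) (hr' : IsStepSeq r') (h : ∀ j ≤ n - 2, r j = r' j) :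
    arcTree r = arcTree r' := by
  rw [arcTree, arcTree]
  congr 1
  refine Set.image_congr fun j hj => ?_
  rw [Set.mem_Iio] at hj
  exact hr.arcEdge_congr hr' (by omega) (h j (by omega)) fun hj' => h _ (by omega)

end IsStepSeq

/-- Raising the value `w` at the index `i + 1` removes the edge `{x, w}` with `x = w - i - 1` from
the tree and adds `{x, w + 1}`. The edge `{w, w + 1}` stays, but its index drops from `i + 1`
to `i`. -/
lemma RaisesAt.arcEdge_eq (hr : IsStepSeq r) (hr' : IsStepSeq r') (h01 : r 1 = r 0 + 1)
    (h01' : r' 1 = r' 0 + 1) {i : ℕ} (h : RaisesAt r r' (i + 1)) :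
    (arcEdge r i = s(r (i + 1) - ((i + 1 : ℕ) : ZMod n), r (i + 1)) ∧
      arcEdge r' i = s(r (i + 1), r (i + 1) + 1)) ∧
    arcEdge r (i + 1) = s(r (i + 1), r (i + 1) + 1) ∧
      arcEdge r' (i + 1) = s(r (i + 1) - ((i + 1 : ℕ) : ZMod n), r (i + 1) + 1) := by
  have hi := Finset.mem_Icc.1 h.1
  have hup := h.eq_add_one
  have hn : 2 ≤ n := by omega
  constructor
  · have hprev : r' i = r (i + 1) := by
      rcases i with _ | i
      · exact add_right_cancel (h01'.symm.trans hup)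
      · exact hr'.eq_of_succ_eq_add_one hr (by omega)
          (h.eq_of_ne (by omega) (by omega) (by omega)) hup
    refine ⟨?_, by rw [arcEdge_of_eq_add hn (by rw [hup, hprev]), hprev]⟩
    rcases i with _ | i
    · rw [arcEdge_of_eq_add hn h01, ← h01, h01]
      simp
    · have heq : r (i + 1 + 1) = r (i + 1) :=
        hprev.symm.trans (h.eq_of_ne (by omega) (by omega) (by omega))
      rw [arcEdge_of_eq heq, heq, Sym2.eq_swap]
  · rcases (by omega : i + 3 = n ∨ i + 4 ≤ n) with hin | hin
    · refine ⟨hr.arcEdge_last hn hin, ?_⟩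
      rw [hr'.arcEdge_last hn hin, hup, Sym2.eq_swap, natCast_eq_neg_of_add_eq (k := 2) hin]
      push_cast
      exact Sym2.eq_iff.2 (.inl ⟨by ring, rfl⟩)
    · have hnext := h.eq_of_ne (j := i + 1 + 1) (by omega) (by omega) (by omega)
      have heq := hr'.succ_eq_of_eq_add_one hr (by omega) hnext hup
      refine ⟨arcEdge_of_eq_add hn (by rw [← hnext, heq, hup]), ?_⟩
      rw [arcEdge_of_eq heq, hup]
      push_cast
      exact Sym2.eq_iff.2 (.inr ⟨rfl, by ring⟩)

lemma RaisesAt.arcEdge_eq_of_ne (hr : IsStepSeq r) (hr' : IsStepSeq r') (h01 : r 1 = r 0 + 1)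
    (h01' : r' 1 = r' 0 + 1) {i : ℕ} (h : RaisesAt r r' (i + 1)) {j : ℕ} (hj : j + 1 < n)
    (hji : j ≠ i) (hji' : j ≠ i + 1) : arcEdge r' j = arcEdge r j := by
  refine hr'.arcEdge_congr hr hj ?_ fun hjn => h.eq_of_ne (by omega) (by omega) (by omega)
  rcases j with _ | j
  · refine add_right_cancel (b := 1) ?_
    rw [← h01, ← h01']
    have hi := Finset.mem_Icc.1 h.1
    exact h.eq_of_ne le_rfl (by omega) (by omega)
  · exact h.eq_of_ne (by omega) (by omega) hji'

lemma image_eq_sdiff_union {ι α : Type*} {s : Set ι} {f g : ι → α} {a b : ι} (hf : s.InjOn f)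
    (ha : a ∈ s) (hb : b ∈ s) (hab : a ≠ b) (hga : g a = f b)
    (h : ∀ j ∈ s, j ≠ a → j ≠ b → g j = f j) : g '' s = f '' s \ {f a} ∪ {g b} := by
  ext x
  simp only [Set.mem_union, Set.mem_sdiff, Set.mem_image, Set.mem_singleton_iff]
  constructor
  · rintro ⟨j, hj, rfl⟩
    have hfa {k : ι} (hk : k ∈ s) (hka : k ≠ a) : f k ≠ f a := fun h => hka (hf hk ha h)
    rcases eq_or_ne j b with rfl | hjb
    · exact .inr rfl
    rcases eq_or_ne j a with rfl | hja
    · exact .inl ⟨⟨b, hb, hga.symm⟩, hga ▸ hfa hb hab.symm⟩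
    · rw [h j hj hja hjb]
      exact .inl ⟨⟨j, hj, rfl⟩, hfa hj hja⟩
  · rintro (⟨⟨j, hj, rfl⟩, hja⟩ | rfl)
    · rcases eq_or_ne j b with rfl | hjb
      · exact ⟨a, ha, hga⟩
      · exact ⟨j, hj, h j hj (fun hja' => hja (congrArg f hja')) hjb⟩
    · exact ⟨b, hb, rfl⟩

lemma caterpillarShift_of_arcEdge (hr : IsStepSeq r) (hr' : IsStepSeq r') (h01 : r 1 = r 0 + 1)
    {C D : Caterpillar n} (hC : arcTree r = C.1) (hD : arcTree r' = D.1) {a b : ℕ}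
    (ha : a + 1 < n) (hb : b + 1 < n) (hab : a ≠ b) {x w w' : ZMod n} (hside : IsSide s(w, w'))
    (hra : arcEdge r a = s(x, w)) (hrb : arcEdge r b = s(w, w')) (hra' : arcEdge r' a = s(w, w'))
    (hrb' : arcEdge r' b = s(x, w'))
    (h : ∀ j, j + 1 < n → j ≠ a → j ≠ b → arcEdge r' j = arcEdge r j) : CaterpillarShift C D := by
  obtain ⟨C, _⟩ := C
  obtain ⟨D, _⟩ := D
  obtain rfl : arcTree r = C := hC
  obtain rfl : arcTree r' = D := hD
  have hn : 2 ≤ n := by omega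
  obtain ⟨_, p, hp, -, hedges⟩ := hr.exists_isSpine_arcTree hn h01
  refine ⟨_, _, p, hp, x, w, w', (hr.arcTree_adj hn).2 ⟨a, ha, hra⟩,
    hedges _ (hr.edgeSet_arcTree hn ▸ ⟨b, Nat.lt_sub_of_add_lt hb, hrb⟩) hside, ?_⟩
  change (arcTree r').edgeSet = (arcTree r).edgeSet \ _ ∪ _
  rw [hr.edgeSet_arcTree hn, hr'.edgeSet_arcTree hn, ← hra, ← hrb']
  exact image_eq_sdiff_union (hr.arcEdge_injOn hn) (Nat.lt_sub_of_add_lt ha)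
    (Nat.lt_sub_of_add_lt hb) hab (hra'.trans hrb.symm) fun j hj => h j (Nat.add_lt_of_lt_sub hj)

lemma RaisesAt.caterpillarShift (hr : IsStepSeq r) (hr' : IsStepSeq r') (h01 : r 1 = r 0 + 1)
    (h01' : r' 1 = r' 0 + 1) {C D : Caterpillar n} (hC : arcTree r = C.1) (hD : arcTree r' = D.1)
    {i : ℕ} (h : RaisesAt r r' i) : CaterpillarShift C D ∧ CaterpillarShift D C := by
  have hi := Finset.mem_Icc.1 h.1
  obtain ⟨i, rfl⟩ := Nat.exists_eq_add_of_le' hi.1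
  obtain ⟨⟨hri, hri'⟩, hrs, hrs'⟩ := h.arcEdge_eq hr hr' h01 h01'
  have hne {j : ℕ} (hj : j + 1 < n) := h.arcEdge_eq_of_ne hr hr' h01 h01' hj
  constructor
  · exact caterpillarShift_of_arcEdge hr hr' h01 hC hD (a := i) (b := i + 1) (by omega) (by omega)
      (by omega) (isSide_iff.2 (.inl rfl)) hri hrs hri' hrs' fun j => hne
  · exact caterpillarShift_of_arcEdge hr' hr h01' hD hC (a := i + 1) (b := i) (by omega) (by omega)
      (by omega) (isSide_iff.2 (.inr rfl)) hrs' (hri'.trans Sym2.eq_swap) (hrs.trans Sym2.eq_swap)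
      hri fun j hj hji hji' => (hne hj hji' hji).symm

end Raise

section CaterpillarGraph
variable {n : ℕ} {u v : YokeVertex n (n - 3)} {C D : Caterpillar n}

/-- The sequence of the right ends of the arcs of the caterpillar that `v` encodes. The interval
`[l_i, r_i]` of the encoding is the arc of index `i + 1`. -/
def spineSeq (v : YokeVertex n (n - 3)) : ℕ → ZMod n
  | 0 => v.psum 0
  | j + 1 => v.psum j + 1

lemma isStepSeq_spineSeq (v : YokeVertex n (n - 3)) : IsStepSeq (spineSeq v)
  | 0 => .inr rfl
  | j + 1 => (isStepSeq_psum v).add_const 1 j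

lemma raisesAt_spineSeq_iff (hn : 3 ≤ n) {i : ℕ} (hi : i ≤ n - 3) :
    RaisesAt (spineSeq u) (spineSeq v) (i + 1) ↔
      v.psum i = u.psum i + 1 ∧ ∀ j ≤ n - 3, j ≠ i → v.psum j = u.psum j := by
  constructor
  · intro h
    refine ⟨add_right_cancel h.eq_add_one, fun j hj hji => ?_⟩
    exact add_right_cancel (h.eq_of_ne (j := j + 1) (by omega) (by omega) (by omega))
  · rintro ⟨hup, hne⟩
    refine ⟨Finset.mem_Icc.2 ⟨by omega, by omega⟩, fun j hj => ?_⟩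
    rw [Finset.coe_Icc, Set.mem_Icc] at hj
    obtain ⟨j, rfl⟩ := Nat.exists_eq_add_of_le' hj.1
    rcases eq_or_ne j i with rfl | hji
    · rw [Function.update_self, spineSeq, spineSeq, hup]
    · rw [Function.update_of_ne (by omega), spineSeq, spineSeq, hne j (by omega) hji]

lemma yokeTight_caterpillar (hn : 3 ≤ n) : YokeTight n (n - 3) := ⟨by omega, by omega⟩

lemma yokeShift_iff_raisesAt (hn : 3 ≤ n) {i : Fin (n - 3 + 1)} :
    YokeShift i u v ↔ RaisesAt (spineSeq u) (spineSeq v) (i + 1) ∨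
      RaisesAt (spineSeq v) (spineSeq u) (i + 1) := by
  have hi : i.val ≤ n - 3 := by omega
  have hne (x : ZMod n) : x ≠ x + 1 := fun h => zmod_one_ne_zero (by omega) (left_eq_add.1 h)
  rw [yokeShift_iff_psum (yokeTight_caterpillar hn), raisesAt_spineSeq_iff hn hi,
    raisesAt_spineSeq_iff hn hi]
  constructor
  · intro h
    have heq (j : ℕ) (hj : j ≤ n - 3) (hji : j ≠ i) := (h j hj).2 hji
    rcases psum_eq_add_one_or (yokeTight_caterpillar hn) hi h with hup | hup
    · exact .inr ⟨hup, heq⟩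
    · exact .inl ⟨hup, fun j hj hji => (heq j hj hji).symm⟩
  · rintro (⟨hup, heq⟩ | ⟨hup, heq⟩) j hj
    · refine ⟨?_, fun hji => (heq j hj hji).symm⟩
      rintro h rfl
      exact hne _ (h.trans hup)
    · refine ⟨?_, heq j hj⟩
      rintro h rfl
      exact hne _ (h.symm.trans hup)

/-- The caterpillar `C` is the tree of the growing sequence of arcs that `v` encodes. -/
def CaterpillarRel (C : Caterpillar n) (v : YokeVertex n (n - 3)) : Prop :=
  arcTree (spineSeq v) = C.1

namespace CaterpillarRel

lemma biTotal (hn : 3 ≤ n) : Relator.BiTotal (CaterpillarRel (n := n)) := by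
  refine ⟨fun C => ?_, fun v => ⟨arcCaterpillar (by omega) (isStepSeq_spineSeq v) rfl, rfl⟩⟩
  obtain ⟨r, hr, h01, hC⟩ := C.exists_arcTree_eq hn
  obtain ⟨v, hv⟩ := exists_psum_eq (m := n - 3) (r := fun i => r (i + 1) - 1) (by omega) fun i _ =>
    (hr (i + 1)).imp (fun h => by rw [h]) fun h => by rw [h]; ring
  refine ⟨v, ((isStepSeq_spineSeq v).arcTree_congr hr fun j hj => ?_).trans hC⟩
  rcases j with _ | j
  · rw [spineSeq, hv 0 (by omega), h01, add_sub_cancel_right]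
  · rw [spineSeq, hv j (by omega), sub_add_cancel]

lemma ncard_incidenceSet (h : CaterpillarRel C v) (hn : 3 ≤ n) (x : ZMod n) :
    (C.1.incidenceSet x).ncard = (spineValues (spineSeq v)).count x + 1 := by
  rw [← h, (isStepSeq_spineSeq v).ncard_incidenceSet_arcTree (by omega)]

lemma biUnique (hn : 3 ≤ n) : Relator.BiUnique (CaterpillarRel (n := n)) := by
  refine ⟨fun _ _ _ h h' => Subtype.ext (h.symm.trans h'), fun C u v hu hv => ?_⟩
  have hvalues : spineValues (spineSeq u) = spineValues (spineSeq v) := Multiset.ext.2 fun x =>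
    add_right_cancel ((hu.ncard_incidenceSet hn x).symm.trans (hv.ncard_incidenceSet hn x))
  have heq := (isStepSeq_spineSeq u).eqOn_of_spineValues_eq (isStepSeq_spineSeq v) (by omega)
    hvalues
  exact eq_of_psum_eq (by omega) fun i hi => add_right_cancel
    (heq (x := i + 1) (Finset.mem_coe.2 (Finset.mem_Icc.2 ⟨by omega, by omega⟩)))

lemma exists_raisesAt (hu : CaterpillarRel C u) (hv : CaterpillarRel D v) (hn : 3 ≤ n)
    (h : CaterpillarShift C D) : (∃ i, RaisesAt (spineSeq u) (spineSeq v) i) ∨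
      ∃ i, RaisesAt (spineSeq v) (spineSeq u) i := by
  have : NeZero n := ⟨by omega⟩
  obtain ⟨w, w', hside, hdeg⟩ := h.exists_ncard_incidenceSet
  have hvalues : w ::ₘ spineValues (spineSeq v) = w' ::ₘ spineValues (spineSeq u) := by
    refine Multiset.ext.2 fun x => ?_
    have hx := hdeg x
    rw [hu.ncard_incidenceSet hn, hv.ncard_incidenceSet hn] at hx
    rw [Multiset.count_cons, Multiset.count_cons]
    omega
  rcases isSide_iff.1 hside with rfl | rfl
  · exact .inl ((isStepSeq_spineSeq u).exists_raisesAt (isStepSeq_spineSeq v) (by omega) hvalues)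
  · exact .inr ((isStepSeq_spineSeq v).exists_raisesAt (isStepSeq_spineSeq u) (by omega)
      hvalues.symm)

lemma caterpillarShift_iff (hu : CaterpillarRel C u) (hv : CaterpillarRel D v) (hn : 3 ≤ n) :
    CaterpillarShift C D ↔ ∃ i, YokeShift i u v := by
  constructor
  · have hindex {r r' : ℕ → ZMod n} {i : ℕ} (h : RaisesAt r r' i) :
        ∃ k : Fin (n - 3 + 1), RaisesAt r r' (k + 1) := by
      have hi := Finset.mem_Icc.1 h.1
      exact ⟨⟨i - 1, by omega⟩, by rwa [Nat.sub_add_cancel hi.1]⟩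
    intro h
    rcases hu.exists_raisesAt hv hn h with ⟨i, h⟩ | ⟨i, h⟩
    · exact (hindex h).imp fun _ h => (yokeShift_iff_raisesAt hn).2 (.inl h)
    · exact (hindex h).imp fun _ h => (yokeShift_iff_raisesAt hn).2 (.inr h)
  · rintro ⟨i, h⟩
    have hru := isStepSeq_spineSeq u
    have hrv := isStepSeq_spineSeq v
    rcases (yokeShift_iff_raisesAt hn).1 h with h | h
    · exact (h.caterpillarShift hru hrv rfl rfl hu hv).1
    · exact (h.caterpillarShift hrv hru rfl rfl hv hu).2

lemma caterpillarCode (h : CaterpillarRel C v) (hn : 3 ≤ n) : CaterpillarCode C v := by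
  obtain ⟨C, _⟩ := C
  obtain rfl : arcTree (spineSeq v) = C := h
  obtain ⟨b, p, hp, hvert, -⟩ := (isStepSeq_spineSeq v).exists_isSpine_arcTree (by omega) rfl
  refine ⟨_, b, p, hp, hvert, (psum_zero v).symm, fun i => v.psum i - i, fun i => v.psum i + 1,
    ?_, rfl, ?_⟩
  · simp only [Nat.cast_zero, sub_zero, spineSeq]
  rintro ⟨_ | i, hi⟩ h1 h2
  · exact absurd h1 (by simp)
  change i + 1 ≤ n - 3 at h2
  simp only [add_tsub_cancel_right]
  have hadj : (arcTree (spineSeq v)).Adj (v.psum i - (i : ZMod n) - 1) (v.psum i + 1) ↔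
      v.psum (i + 1) = v.psum i := by
    have hadj := (isStepSeq_spineSeq v).arcTree_adj_iff_succ_eq (i := i + 1) (by omega)
    rwa [spineSeq, spineSeq, add_left_inj, show v.psum i + 1 - ((i + 1 + 1 : ℕ) : ZMod n) =
      v.psum i - i - 1 by push_cast; ring] at hadj
  rcases psum_step v h2 with ⟨hv, hs⟩ | ⟨hv, hs⟩
  · exact .inl ⟨hadj.2 hs, by rw [hs]; push_cast; ring, by rw [hs], hv⟩
  · refine .inr ⟨fun h => ?_, by rw [hs]; push_cast; ring, by rw [hs], hv⟩
    exact zmod_one_ne_zero (by omega) (left_eq_add.1 ((hadj.1 h).symm.trans hs))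

end CaterpillarRel

theorem exists_caterpillarGraph_iso (hn : 3 ≤ n) :
    ∃ h : caterpillarGraph n ≃g yokeGraph n (n - 3), ∀ C, CaterpillarCode C (h C) := by
  obtain ⟨h, hrel⟩ := exists_iso_fromRel_of_biUnique (CaterpillarRel.biTotal hn)
    (CaterpillarRel.biUnique hn) fun C D u v hu hv => hu.caterpillarShift_iff hv hn
  exact ⟨h, fun C => (hrel C).caterpillarCode hn⟩

end CaterpillarGraph

end YokeFlip

theorem mainTheorem9 :
    (∀ n : ℕ, 5 ≤ n → ∃ g : ctftGraph n ≃g yokeGraph n (n - 4),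
      (∀ T : CTFT n, CTFTCode T (g T)) ∧
      ∀ (T T' : CTFT n) (i : Fin (n - 3)) (j : Fin (n - 4 + 1)), i.val = j.val →
        (CTFTFlip i T T' ↔ YokeShift j (g T) (g T'))) ∧
    (∀ n : ℕ, 2 ≤ n → ∃ f : arcGraph n ≃g yokeGraph n (n - 2),
      (∀ π : ArcPerm n, ArcCode π (f π)) ∧
      ∀ (π σ : ArcPerm n) (i : ℕ) (hi : i + 1 < n) (j : Fin (n - 2 + 1)), i = j.val →
        (ArcSwap i hi π σ ↔ YokeShift j (f π) (f σ))) ∧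
    (∀ n : ℕ, 3 ≤ n → ∃ h : caterpillarGraph n ≃g yokeGraph n (n - 3),
      ∀ C : Caterpillar n, CaterpillarCode C (h C)) :=
  ⟨fun _ hn => exists_ctftGraph_iso hn, fun _ hn => exists_arcGraph_iso hn,
    fun _ hn => exists_caterpillarGraph_iso hn⟩
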